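/- Let $M$ be a sphere with a Euclidean polyhedral metric: every point has a neighborhood isometric either to an open subset of $\mathbb{R}^2$ (a regular point) or, with the point going to the apex, to an open subset of a cone of angle $\alpha\neq 2\pi$ (a singular point). Let $\Sigma$ be the set of singular points. A geodesic triangulation $T$ of $M$ is a decomposition of $M$ into finitely many non-degenerate Euclidean triangles by geodesics with endpoints in $\Sigma$, with vertex set $\Sigma$; loops, multiple edges, and triangles with self-identifications on the boundary are allowed. *Polytopes.* Consider couples $(T,r)$, where $T$ is a geodesic triangulation and $r:\Sigma\to(0,\infty)$ is such that over every triangle $ijk$ of $T$ there is a non-degenerate pyramid with side edges of lengths $r_i,r_j,r_k$. Gluing these pyramids following the gluing of the triangles in $T$ gives a polyhedral complex with boundary $M$ and one apex. Two couples are equivalent if there is an isometry between their complexes (with their intrinsic metrics) that is the identity on $M$ and maps the apex to the apex. An equivalence class is a generalized polytope with boundary $M$. It is a generalized convex polytope if, for some representative $(T,r)$, at every edge of $T$ the sum of the dihedral angles of the adjacent pyramids is at most $\pi$. *Tessellations.* A Q-function on a subset of $\mathbb{R}^2$ is a function of the form $x\mapsto\|x-a\|^2+b$. For $q:\Sigma\to\mathbb{R}$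 let $\widetilde q_T:M\to\mathbb{R}$ be the PQ-extension of $q$ with respect to $T$, that is, the continuous function that is a Q-function on every (developed) triangle of $T$ and equals $q$ on $\Sigma$. The couple $(T,q)$ is a weighted Delaunay triangulation of $(M,\Sigma)$ if $\widetilde q_T$ is Q-concave: on each geodesic arc without singular points in its interior, $\widetilde q_T$ minus the squared arc length is concave. The weighted Delaunay tessellation $(\overline T,q)$ is obtained from $(T,q)$ by removing all edges of $T$ such that $\widetilde q_T$ is a Q-function near every interior point of the edge; it retains the weights $q$. **Theorem.** Weighted Delaunay tessellations of $(M,\Sigma)$ with positive associated function $\widetilde q_T$ (that is, $\widetilde q_T>0$ everywhere on $M$) are in one-to-one correspondence with generalized convex polytopes with boundary $M$. More precisely, there is a bijection $\Phi$ from generalized convex polytopes to such tessellations with the following properties. 1. If $(T,r)$ is any representative of a generalized convex polytope $P$, then $(T,r^2)$ is a weighted Delaunay triangulation with $\widetilde{q}_T>0$ for $q=r^2$, and $\Phi(P)=(\overline T,r^2)$. 2. Conversely, if $(T,q)$ is a weighted Delaunay triangulation with $\widetilde q_T>0$, then $(T,\sqrt q)$ represents the generalized convex polytope $\Phi^{-1}(\overline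 T,q)$, and all its total dihedral angles at the edges of $T$ are at most $\pi$. -/

import Mathlib

open scoped Real

noncomputable section

namespace PolyhedralSphere

/-- The Euclidean plane. -/
abbrev E2 : Type := EuclideanSpace ℝ (Fin 2)

/-- Euclidean 3-space. -/
abbrev E3 : Type := EuclideanSpace ℝ (Fin 3)

/-- The standard embedding of the plane as the horizontal coordinate plane of 3-space. -/
def lift (x : E2) : E3 := !₂[x 0, x 1, 0]

/-! ### Euclidean polyhedral metrics -/

/-- The distance in the Euclidean cone of total angle `α`, in polar coordinates `(ρ, θ)` with
`ρ ≥ 0` and `θ ∈ ℝ / αℤ`; `‖θ - θ'‖` is the length of the shorter arc of the circle of length `α`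
between `θ` and `θ'`. -/
def coneDist (α : ℝ) (p q : ℝ × AddCircle α) : ℝ :=
  √(p.1 ^ 2 + q.1 ^ 2 - 2 * p.1 * q.1 * Real.cos (min ‖p.2 - q.2‖ π))

section Metric

variable {M : Type*} [MetricSpace M]

/-- `φ` is an isometry of the open disc of radius `ε` about the origin of the plane onto the open
ball of radius `ε` about `m`, and it sends the origin to `m`. -/
structure IsFlatChart (m : M) (ε : ℝ) (φ : E2 → M) : Prop where
  center : φ 0 = m
  isometric : ∀ x ∈ Metric.ball (0 : E2) ε, ∀ y ∈ Metric.ball (0 : E2) ε,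
    dist (φ x) (φ y) = dist x y
  image : φ '' Metric.ball 0 ε = Metric.ball m ε

/-- `m` has a neighbourhood isometric to an open subset of the Euclidean plane. -/
def IsRegularPoint (m : M) : Prop := ∃ ε > 0, ∃ φ : E2 → M, IsFlatChart m ε φ

/-- `m` has a neighbourhood isometric to an open subset of the cone of angle `α`, in such a way
that `m` is sent to the apex. -/
def IsConePoint (α : ℝ) (m : M) : Prop :=
  0 < α ∧ ∃ ε > 0, ∃ φ : ℝ × AddCircle α → M,
    (∀ θ, φ (0, θ) = m) ∧
    (∀ p q : ℝ × AddCircle α, p.1 ∈ Set.Ico 0 ε → q.1 ∈ Set.Ico 0 ε →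
      dist (φ p) (φ q) = coneDist α p q) ∧
    φ '' {p | p.1 ∈ Set.Ico 0 ε} = Metric.ball m ε

/-- The metric of `M` is a Euclidean polyhedral metric. -/
def IsPolyhedralMetric (M : Type*) [MetricSpace M] : Prop :=
  ∀ m : M, IsRegularPoint m ∨ ∃ α : ℝ, α ≠ 2 * π ∧ IsConePoint α m

/-- The set `Σ` of singular points. -/
def singularSet (M : Type*) [MetricSpace M] : Set M := {m | ¬ IsRegularPoint m}

/-! ### Geodesic triangulations -/

/-- A decomposition of `M` into Euclidean triangles by geodesics with endpoints in `Σ`, with vertex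
set `Σ`. Every triangle `t` is given by its development, a non-degenerate triangle in the plane
with corners `corner t k`, and by the map `chart t` from the developed closed triangle to `M`
(the values of `chart t` outside of this triangle are irrelevant). A triangle may be glued to
itself along sides and at corners; so `chart t` is isometric near each point of the triangle other
than the corners, but it need not be injective. -/
structure GeodesicTriangulation (M : Type*) [MetricSpace M] where
  numFaces : ℕ
  corner : Fin numFaces → Fin 3 → E2
  corner_indep : ∀ t, AffineIndependent ℝ (corner t)
  chart : Fin numFaces → E2 → M
  chart_continuousOn : ∀ t,
    ContinuousOn (chart t) (convexHull ℝ (Set.range (corner t)))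
  chart_isometric : ∀ t, ∀ x ∈ convexHull ℝ (Set.range (corner t)) \ Set.range (corner t),
    ∃ ε > 0, ∀ y ∈ convexHull ℝ (Set.range (corner t)) ∩ Metric.ball x ε,
      ∀ z ∈ convexHull ℝ (Set.range (corner t)) ∩ Metric.ball x ε,
        dist (chart t y) (chart t z) = dist y z
  /-- the points of `Σ` are the vertices -/
  chart_mem_singularSet : ∀ t, ∀ x ∈ convexHull ℝ (Set.range (corner t)),
    (chart t x ∈ singularSet M ↔ x ∈ Set.range (corner t))
  /-- the triangles cover `M` -/
  cover : ∀ m : M, ∃ t, ∃ x ∈ convexHull ℝ (Set.range (corner t)), chart t x = m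
  /-- the interior of a triangle is embedded and disjoint from everything else -/
  interior_inj : ∀ t t', ∀ x ∈ interior (convexHull ℝ (Set.range (corner t))),
    ∀ x' ∈ convexHull ℝ (Set.range (corner t')), chart t x = chart t' x' → t = t' ∧ x = x'
  /-- an edge has no self-intersections in its interior -/
  side_inj : ∀ t, ∀ k : Fin 3,
    Set.InjOn (chart t) (openSegment ℝ (corner t (k + 1)) (corner t (k + 2)))
  /-- the interiors of two edges coincide or are disjoint -/
  side_eq_or_disjoint : ∀ t t', ∀ k k' : Fin 3,
    chart t '' openSegment ℝ (corner t (k + 1)) (corner t (k + 2)) =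
      chart t' '' openSegment ℝ (corner t' (k' + 1)) (corner t' (k' + 2)) ∨
    Disjoint (chart t '' openSegment ℝ (corner t (k + 1)) (corner t (k + 2)))
      (chart t' '' openSegment ℝ (corner t' (k' + 1)) (corner t' (k' + 2)))

namespace GeodesicTriangulation

variable (T : GeodesicTriangulation M)

/-- The developed closed triangle. -/
def face (t : Fin T.numFaces) : Set E2 := convexHull ℝ (Set.range (T.corner t))

/-- The singular point of `M` at the `k`-th corner of the triangle `t`. -/
def vertex (t : Fin T.numFaces) (k : Fin 3) : singularSet M :=
  ⟨T.chart t (T.corner t k),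
    (T.chart_mem_singularSet t _ (subset_convexHull ℝ _ ⟨k, rfl⟩)).2 ⟨k, rfl⟩⟩

/-- The interior, as a subset of `M`, of the side of the triangle `t` opposite to its `k`-th
corner. -/
def openSide (t : Fin T.numFaces) (k : Fin 3) : Set M :=
  T.chart t '' openSegment ℝ (T.corner t (k + 1)) (T.corner t (k + 2))

/-- The edges of the triangulation. An edge is represented by the set of its interior points, so
that different edges with the same endpoints are distinguished. -/
def edges : Set (Set M) := {E | ∃ t k, E = T.openSide t k}

end GeodesicTriangulation

/-! ### Generalized polytopes -/

/-- A couple `(T, r)` of a geodesic triangulation and of positive radii at the singular points, such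
that over every triangle of `T` there is a pyramid with the given lengths of side edges. The
pyramid over the triangle `t` is placed in 3-space with the base in the horizontal coordinate
plane and with the apex above it; so `apex t` is determined by `T` and `r`. -/
structure Couple (M : Type*) [MetricSpace M] where
  T : GeodesicTriangulation M
  radius : singularSet M → ℝ
  radius_pos : ∀ i, 0 < radius i
  apex : Fin T.numFaces → E3
  apex_height : ∀ t, 0 < apex t 2
  dist_apex : ∀ t k, dist (apex t) (lift (T.corner t k)) = radius (T.vertex t k)

namespace Couple

variable (C : Couple M)

/-- The pyramid over the triangle `t`. -/
def pyramid (t : Fin C.T.numFaces) : Set E3 :=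
  convexHull ℝ (insert (C.apex t) (lift '' C.T.face t))

theorem apex_mem (t : Fin C.T.numFaces) : C.apex t ∈ C.pyramid t :=
  subset_convexHull ℝ _ (Set.mem_insert _ _)

theorem lift_mem {t : Fin C.T.numFaces} {x : E2} (hx : x ∈ C.T.face t) :
    lift x ∈ C.pyramid t :=
  subset_convexHull ℝ _ (Set.mem_insert_of_mem _ ⟨x, hx, rfl⟩)

/-- The gluing of the pyramids. Each point of a pyramid lies on a segment from a base point to the
apex. Points of two pyramids are glued if they divide such segments in the same ratio `s`, and the
base points represent the same point of `M` or both points are apices. -/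
def Glued (p q : Σ t, C.pyramid t) : Prop :=
  ∃ s ∈ Set.Icc (0 : ℝ) 1, ∃ x ∈ C.T.face p.1, ∃ y ∈ C.T.face q.1,
    (p.2 : E3) = (1 - s) • lift x + s • C.apex p.1 ∧
    (q.2 : E3) = (1 - s) • lift y + s • C.apex q.1 ∧
    (s = 1 ∨ C.T.chart p.1 x = C.T.chart q.1 y)

/-- The polyhedral complex glued from the pyramids. -/
def Complex : Type := Quot C.Glued

/-- The point of the complex represented by a point of a pyramid. -/
def toComplex (t : Fin C.T.numFaces) (u : C.pyramid t) : C.Complex := Quot.mk _ ⟨t, u⟩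

/-- `C.IsChain p q ℓ` means that `p` and `q` can be joined in the complex by a polygonal path of
length `ℓ`, each segment of which lies in one of the pyramids. -/
inductive IsChain : C.Complex → C.Complex → ℝ → Prop
  | nil (p : C.Complex) : IsChain p p 0
  | cons (t : Fin C.T.numFaces) (u v : C.pyramid t) (q : C.Complex) (ℓ : ℝ) :
      IsChain (C.toComplex t v) q ℓ → IsChain (C.toComplex t u) q (dist u v + ℓ)

/-- The intrinsic distance of the complex. -/
def complexDist (p q : C.Complex) : ℝ := sInf {ℓ | C.IsChain p q ℓ}

/-- There is an isometry between the complexes of two couples that is identical on the boundary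
(which is `M` for both complexes) and maps the apex to the apex. -/
def Equivalent (C C' : Couple M) : Prop :=
  ∃ e : C.Complex ≃ C'.Complex,
    (∀ p q, C'.complexDist (e p) (e q) = C.complexDist p q) ∧
    (∀ t t', e (C.toComplex t ⟨C.apex t, C.apex_mem t⟩) = C'.toComplex t' ⟨C'.apex t', C'.apex_mem t'⟩) ∧
    ∀ t t' x x', ∀ hx : x ∈ C.T.face t, ∀ hx' : x' ∈ C'.T.face t',
      C.T.chart t x = C'.T.chart t' x' →
        e (C.toComplex t ⟨lift x, C.lift_mem hx⟩) = C'.toComplex t' ⟨lift x', C'.lift_mem hx'⟩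

theorem toComplex_apex (t t' : Fin C.T.numFaces) :
    C.toComplex t ⟨C.apex t, C.apex_mem t⟩ = C.toComplex t' ⟨C.apex t', C.apex_mem t'⟩ := by
  refine Quot.sound ⟨1, by simp, C.T.corner t 0, subset_convexHull ℝ _ ⟨0, rfl⟩,
    C.T.corner t' 0, subset_convexHull ℝ _ ⟨0, rfl⟩, by simp, by simp, Or.inl rfl⟩

theorem toComplex_lift {t t' : Fin C.T.numFaces} {x x' : E2} (hx : x ∈ C.T.face t)
    (hx' : x' ∈ C.T.face t') (h : C.T.chart t x = C.T.chart t' x') :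
    C.toComplex t ⟨lift x, C.lift_mem hx⟩ = C.toComplex t' ⟨lift x', C.lift_mem hx'⟩ :=
  Quot.sound ⟨0, by simp, x, hx, x', hx', by simp, by simp, Or.inr h⟩

theorem exists_face (C' : Couple M) (t : Fin C.T.numFaces) : ∃ _t' : Fin C'.T.numFaces, True := by
  obtain ⟨t', -⟩ := C'.T.cover (C.T.chart t 0)
  exact ⟨t', trivial⟩

instance setoid (M : Type*) [MetricSpace M] : Setoid (Couple M) where
  r := Equivalent
  iseqv := by
    refine ⟨fun C => ?_, ?_, ?_⟩
    · exact ⟨Equiv.refl _, fun _ _ => rfl, fun t t' => C.toComplex_apex t t',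
        fun t t' x x' hx hx' h => C.toComplex_lift hx hx' h⟩
    · rintro C C' ⟨e, hd, ha, hb⟩
      refine ⟨e.symm, fun p q => ?_, fun t t' => ?_, fun t t' x x' hx hx' h => ?_⟩
      · simpa using (hd (e.symm p) (e.symm q)).symm
      · rw [Equiv.symm_apply_eq, ha]
      · rw [Equiv.symm_apply_eq, hb t' t x' x hx' hx h.symm]
    · rintro C C' C'' ⟨e, hd, ha, hb⟩ ⟨e', hd', ha', hb'⟩
      refine ⟨e.trans e', fun p q => ?_, fun t t' => ?_, fun t t'' x x'' hx hx'' h => ?_⟩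
      · simp [hd, hd']
      · obtain ⟨s, -⟩ := C.exists_face C' t
        simp [ha t s, ha' s t']
      · obtain ⟨s, y, hy, hs⟩ := C'.T.cover (C.T.chart t x)
        simp [hb t s x y hx hy hs.symm, hb' s t'' y x'' hy hx'' (hs.trans h)]

end Couple

/-- The component of `w` orthogonal to the direction `d`. -/
def perpPart (d w : E3) : E3 := w - (inner ℝ d w / inner ℝ d d) • d

namespace Couple

variable (C : Couple M)

/-- The dihedral angle of the pyramid over the triangle `t` at the base side opposite to the `k`-th
corner of `t`: the angle between the base and the lateral face at this side, measured in a plane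
orthogonal to the side. -/
def dihedralAngle (t : Fin C.T.numFaces) (k : Fin 3) : ℝ :=
  InnerProductGeometry.angle
    (perpPart (lift (C.T.corner t (k + 2)) - lift (C.T.corner t (k + 1)))
      (lift (C.T.corner t k) - lift (C.T.corner t (k + 1))))
    (perpPart (lift (C.T.corner t (k + 2)) - lift (C.T.corner t (k + 1)))
      (C.apex t - lift (C.T.corner t (k + 1))))

open Classical in
/-- The sum `θ` of the dihedral angles of the pyramids at a boundary edge. -/
def boundaryAngle (E : Set M) : ℝ :=
  ∑ p : Fin C.T.numFaces × Fin 3, if C.T.openSide p.1 p.2 = E then C.dihedralAngle p.1 p.2 else 0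

/-- All the total dihedral angles at the boundary edges are at most `π`. -/
def HasConvexBoundary : Prop := ∀ E ∈ C.T.edges, C.boundaryAngle E ≤ π

end Couple

/-- Generalized polytopes with boundary `M`. -/
def GeneralizedPolytope (M : Type*) [MetricSpace M] : Type _ := Quotient (Couple.setoid M)

/-- The couple `C` is a representative of the generalized polytope `P`. -/
def Couple.Represents (C : Couple M) (P : GeneralizedPolytope M) : Prop :=
  Quotient.mk (Couple.setoid M) C = P

/-- Generalized convex polytopes with boundary `M`. -/
def GeneralizedConvexPolytope (M : Type*) [MetricSpace M] : Type _ :=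
  {P : GeneralizedPolytope M // ∃ C : Couple M, C.Represents P ∧ C.HasConvexBoundary}

/-! ### Weighted Delaunay tessellations -/

/-- `f` agrees on `s` with a function of the form `x ↦ ‖x - a‖ ^ 2 + b`. -/
def IsQFunctionOn (f : E2 → ℝ) (s : Set E2) : Prop :=
  ∃ (a : E2) (b : ℝ), ∀ x ∈ s, f x = ‖x - a‖ ^ 2 + b

/-- `f` is the PQ-extension of `q` with respect to `T`: it is continuous, it is a Q-function on
every triangle of `T`, and it takes the given values at the singular points. -/
def IsPQExtension (T : GeodesicTriangulation M) (q : singularSet M → ℝ) (f : M → ℝ) : Prop :=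
  Continuous f ∧ (∀ t, IsQFunctionOn (fun x => f (T.chart t x)) (T.face t)) ∧
    ∀ i : singularSet M, f i = q i

/-- `γ` is a geodesic arc of length `L`, parametrized by arc length: it is locally shortest. -/
def IsGeodesicArc (γ : ℝ → M) (L : ℝ) : Prop :=
  ∀ s ∈ Set.Icc 0 L, ∃ ε > 0, ∀ u ∈ Set.Icc 0 L, ∀ v ∈ Set.Icc 0 L,
    |u - s| < ε → |v - s| < ε → dist (γ u) (γ v) = |u - v|

/-- On each geodesic arc with no singular points in its interior, `f` becomes concave after
subtracting the squared arc length. (If all cone angles are less than `2π`, then geodesic arcs never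
pass through singular points.) -/
def IsQConcave (f : M → ℝ) : Prop :=
  ∀ (L : ℝ) (γ : ℝ → M), IsGeodesicArc γ L → (∀ s ∈ Set.Ioo 0 L, γ s ∉ singularSet M) →
    ConcaveOn ℝ (Set.Icc 0 L) (fun s => f (γ s) - s ^ 2)

/-- `f` is a Q-function in a neighbourhood of the point `m`. -/
def IsQFunctionNear (f : M → ℝ) (m : M) : Prop :=
  ∃ ε > 0, ∃ φ : E2 → M, IsFlatChart m ε φ ∧
    IsQFunctionOn (fun x => f (φ x)) (Metric.ball 0 ε)

/-- The edges of `T` that are not inessential for `f`; an edge is inessential if `f` is a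
Q-function in a neighbourhood of any interior point of the edge. -/
def essentialEdges (T : GeodesicTriangulation M) (f : M → ℝ) : Set (Set M) :=
  {E | E ∈ T.edges ∧ ¬ ∀ m ∈ E, IsQFunctionNear f m}

/-- A system of edges in `M` (given by the sets of their interior points) with weights at the
singular points. -/
structure WeightedTessellation (M : Type*) [MetricSpace M] where
  edges : Set (Set M)
  weight : singularSet M → ℝ

/-- `(T, q)` is a weighted Delaunay triangulation of `(M, Σ)`, its PQ-extension is positive
everywhere on `M`, and `τ` is the weighted Delaunay tessellation obtained from `(T, q)` by removing
all inessential edges. -/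
def IsPositiveDelaunayTessellationOf (τ : WeightedTessellation M)
    (T : GeodesicTriangulation M) (q : singularSet M → ℝ) : Prop :=
  ∃ f : M → ℝ, IsPQExtension T q f ∧ IsQConcave f ∧ (∀ m, 0 < f m) ∧
    τ.edges = essentialEdges T f ∧ τ.weight = q

/-- Weighted Delaunay tessellations of `(M, Σ)` with positive associated PQ-function. -/
def PositiveDelaunayTessellation (M : Type*) [MetricSpace M] : Type _ :=
  {τ : WeightedTessellation M // ∃ T q, IsPositiveDelaunayTessellationOf τ T q}

end Metric

end PolyhedralSphere

end

open scoped Real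

noncomputable section

namespace PolyhedralSphere

/-! Everything is expressed through one function on `M`. By Pythagoras, the squared distance from a
point `x` of the base plane to the apex of a pyramid is `‖x - a‖ ^ 2 + b`, with `a` the foot of the
altitude and `b` its squared length (`dist_lift_sq`). So a couple `(T, r)` amounts to a PQ-extension
`f` of `r ^ 2` whose constants `b` are all positive, and `f` is the squared distance from boundary
points to the apex (`Couple.sqDist`).

Convexity. Develop the two triangles at an edge into one plane. Their Q-functions agree along the
edge, so the centres lie on a common perpendicular, and `f` is a Q-function plus `2 * J * min
(distance to the edge line) 0`, where `J` is the sum of the signed distances from the edge to the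
two centres (`IsQData.edge_formula`). Hence `f` is Q-concave iff all `J` are nonnegative, and an
edge is inessential iff `J = 0`. Both apices have the same distance `R` to the edge line, and the
dihedral angles have cosines `h / R` and `h' / R` with `h + h' = J`; so their sum is at most `π` iff
`0 ≤ J` (`Couple.hasConvexBoundary_iff`).

Uniqueness. A PQ-extension lies below every continuous Q-concave function with the same values on
`Σ` (`IsPQExtension.le_of_isQConcave`), so a Q-concave PQ-extension depends on the weights only, not
on `T`. Away from `Σ`, the essential edges are the points where `f` is not locally a Q-function, so
they do not depend on `T` either (`IsQData.essentialEdges_eq`).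

Existence of pyramids. That `f` is positive and Q-concave has to imply that every `b` is positive
(`IsQData.pos_of_isQConcave`). Otherwise take the minimal `b`, which is at most `0`, and a lowest
point of `f` over the triangles attaining it. The centre is not this point, as `f` is positive
there, so some side through the point separates it from the centre. Crossing this side leads to
another minimal triangle; inside an edge this is a contradiction at once, and at a vertex the
crossings turn around it by triangle angles, which is possible only finitely often.

Equivalence. The complex is a cone over `M`. Distances inside a pyramid are determined by `f` at the
base points, the base distance and the ratios, by the law of cosines (`Couple.dist_pt_sq`).
Therefore equal functions `f` give isometric complexes even for different triangulations; conversely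
`f` is recovered as the squared distance to the apex (`Couple.complexDist_apex`). So generalized
polytopes are classified by `f` (`Couple.equivalent_iff`), and the bijection follows. -/

/-! ### Cyclic indices of triangle corners -/

theorem Fin.sum_three_cyclic {A : Type*} [AddCommMonoid A] (g : Fin 3 → A) (k : Fin 3) :
    ∑ i, g i = g k + g (k + 1) + g (k + 2) := by
  rw [Fin.sum_univ_three]
  fin_cases k
  · rfl
  · change g 0 + g 1 + g 2 = g 1 + g 2 + g 0
    rw [add_assoc, add_comm]
  · change g 0 + g 1 + g 2 = g 2 + g 0 + g 1
    rw [add_comm, add_assoc]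

theorem Fin.one_one (k : Fin 3) : k + 1 + 1 = k + 2 := by revert k; decide

theorem Fin.one_two (k : Fin 3) : k + 1 + 2 = k := by revert k; decide

theorem Fin.two_one (k : Fin 3) : k + 2 + 1 = k := by revert k; decide

theorem Fin.two_two (k : Fin 3) : k + 2 + 2 = k + 1 := by revert k; decide

theorem Fin.add_two_ne_add_one (k : Fin 3) : k + 2 ≠ k + 1 := by revert k; decide

theorem Fin.three_cases (k j : Fin 3) : j = k ∨ j = k + 1 ∨ j = k + 2 := by
  revert k j; decide

theorem Fin.forall_three_iff (k : Fin 3) {p : Fin 3 → Prop} :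
    (∀ j, p j) ↔ p k ∧ p (k + 1) ∧ p (k + 2) := by
  refine ⟨fun h => ⟨h _, h _, h _⟩, fun h j => ?_⟩
  rcases Fin.three_cases k j with rfl | rfl | rfl
  exacts [h.1, h.2.1, h.2.2]

/-! ### Plane geometry -/

theorem eq_of_orthonormal {e n : E2} (he : ‖e‖ = 1) (hn : ‖n‖ = 1) (hen : inner ℝ e n = 0) (v : E2) :
    v = inner ℝ e v • e + inner ℝ n v • n := by
  have ho : Orthonormal ℝ ![e, n] := by
    refine ⟨fun i => by fin_cases i <;> simpa, fun i j hij => ?_⟩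
    fin_cases i <;> fin_cases j <;> simp_all [real_inner_comm]
  have hc : Fintype.card (Fin 2) = Module.finrank ℝ E2 := by simp
  let b : OrthonormalBasis (Fin 2) ℝ E2 :=
    OrthonormalBasis.mk ho (by
      rw [ho.linearIndependent.span_eq_top_of_card_eq_finrank' hc])
  have h := b.sum_repr' v
  simpa [b, Fin.sum_univ_two] using h.symm

theorem inner_eq_of_orthonormal {e n : E2} (he : ‖e‖ = 1) (hn : ‖n‖ = 1) (hen : inner ℝ e n = 0)
    (v w : E2) : inner ℝ v w = inner ℝ e v * inner ℝ e w + inner ℝ n v * inner ℝ n w := by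
  conv_lhs => rw [eq_of_orthonormal he hn hen v]
  simp [inner_add_left, inner_smul_left]

theorem normSq_eq_of_orthonormal {e n : E2} (he : ‖e‖ = 1) (hn : ‖n‖ = 1) (hen : inner ℝ e n = 0)
    (v : E2) : ‖v‖ ^ 2 = inner ℝ e v ^ 2 + inner ℝ n v ^ 2 := by
  rw [← real_inner_self_eq_norm_sq, inner_eq_of_orthonormal he hn hen]; ring

section Triangle

variable (c : Fin 3 → E2)

/-- The vector along the side opposite to the `k`-th corner. -/
def sideVec (k : Fin 3) : E2 := c (k + 2) - c (k + 1)

/-- The altitude from the side opposite to the `k`-th corner to this corner. -/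
def altVec (k : Fin 3) : E2 :=
  (c k - c (k + 1)) -
    (inner ℝ (sideVec c k) (c k - c (k + 1)) / inner ℝ (sideVec c k) (sideVec c k)) • sideVec c k

/-- The unit vector along the side opposite to the `k`-th corner. -/
def sideDir (k : Fin 3) : E2 := ‖sideVec c k‖⁻¹ • sideVec c k

/-- The inner unit normal of the side opposite to the `k`-th corner. -/
def triNormal (k : Fin 3) : E2 := ‖altVec c k‖⁻¹ • altVec c k

/-- The signed distance to the side opposite to the `k`-th corner. -/
def height (k : Fin 3) (y : E2) : ℝ := inner ℝ (y - c (k + 1)) (triNormal c k)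

variable {c} (h : AffineIndependent ℝ c)
include h

theorem sideVec_ne_zero (k : Fin 3) : sideVec c k ≠ 0 := by
  rw [sideVec, sub_ne_zero]
  exact fun e => Fin.add_two_ne_add_one k (h.injective e)

theorem altVec_ne_zero (k : Fin 3) : altVec c k ≠ 0 := by
  intro h0
  rw [altVec, sub_eq_zero] at h0
  set s := inner ℝ (sideVec c k) (c k - c (k + 1)) / inner ℝ (sideVec c k) (sideVec c k)
  have hk : c k = AffineMap.lineMap (c (k + 1)) (c (k + 2)) s := by
    rw [AffineMap.lineMap_apply_module', ← sideVec, ← h0, sub_add_cancel]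
  have := h.notMem_affineSpan_sdiff k {k + 1, k + 2}
  refine this ?_
  have e : ({k + 1, k + 2} : Set (Fin 3)) \ {k} = {k + 1, k + 2} := by
    have : k + 1 ≠ k ∧ k + 2 ≠ k := by clear * -; revert k; decide
    rw [sdiff_eq_left]
    simp [this.1.symm, this.2.symm]
  rw [e, Set.image_pair, hk]
  exact AffineMap.lineMap_mem_affineSpan_pair _ _ _

theorem norm_sideVec_pos (k : Fin 3) : 0 < ‖sideVec c k‖ := norm_pos_iff.2 (sideVec_ne_zero h k)

theorem norm_altVec_pos (k : Fin 3) : 0 < ‖altVec c k‖ := norm_pos_iff.2 (altVec_ne_zero h k)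

theorem norm_sideDir (k : Fin 3) : ‖sideDir c k‖ = 1 := by
  rw [sideDir, norm_smul, norm_inv, norm_norm, inv_mul_cancel₀ (norm_sideVec_pos h k).ne']

theorem norm_triNormal (k : Fin 3) : ‖triNormal c k‖ = 1 := by
  rw [triNormal, norm_smul, norm_inv, norm_norm, inv_mul_cancel₀ (norm_altVec_pos h k).ne']

theorem inner_sideVec_altVec (k : Fin 3) : inner ℝ (sideVec c k) (altVec c k) = 0 := by
  have : inner ℝ (sideVec c k) (sideVec c k) ≠ 0 := inner_self_ne_zero.2 (sideVec_ne_zero h k)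
  rw [altVec, inner_sub_right, inner_smul_right, div_mul_cancel₀ _ this, sub_self]

theorem inner_sideVec_triNormal (k : Fin 3) : inner ℝ (sideVec c k) (triNormal c k) = 0 := by
  rw [triNormal, inner_smul_right, inner_sideVec_altVec h, mul_zero]

theorem inner_sideDir_triNormal (k : Fin 3) : inner ℝ (sideDir c k) (triNormal c k) = 0 := by
  rw [sideDir, inner_smul_left, inner_sideVec_triNormal h, mul_zero]

omit h in
theorem height_one (k : Fin 3) : height c k (c (k + 1)) = 0 := by simp [height]

theorem height_two (k : Fin 3) : height c k (c (k + 2)) = 0 := inner_sideVec_triNormal h k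

omit h in
theorem height_sub (k : Fin 3) (y z : E2) :
    height c k y - height c k z = inner ℝ (y - z) (triNormal c k) := by
  rw [height, height, ← inner_sub_left]; congr 1; abel

theorem height_self (k : Fin 3) : height c k (c k) = ‖altVec c k‖ := by
  have e : c k - c (k + 1) = altVec c k +
    (inner ℝ (sideVec c k) (c k - c (k + 1)) / inner ℝ (sideVec c k) (sideVec c k)) •
      sideVec c k := by rw [altVec, sub_add_cancel]
  have hp := (norm_altVec_pos h k).ne'
  rw [height, e, inner_add_left, inner_smul_left, inner_sideVec_triNormal h, mul_zero, add_zero,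
    triNormal, inner_smul_right, real_inner_self_eq_norm_sq]
  field_simp

/-- The affine basis of the plane given by the corners of a triangle. -/
def triBasis : AffineBasis (Fin 3) ℝ E2 :=
  ⟨c, h, by rw [h.affineSpan_eq_top_iff_card_eq_finrank_add_one]; simp⟩

theorem triBasis_apply (k : Fin 3) : triBasis h k = c k := rfl

/-- When `y - c (k + 1)` is expanded in barycentric coordinates, only the term of `c k` has a
component along the normal. Heights are thus barycentric coordinates up to positive factors, and the
triangle, its interior, sides and corners are all described by their signs. -/
theorem height_eq (k : Fin 3) (y : E2) : height c k y = (triBasis h).coord k y * ‖altVec c k‖ := by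
  have h1 := (triBasis h).linear_combination_coord_eq_self y
  have h2 := (triBasis h).sum_coord_apply_eq_one y
  rw [Fin.sum_three_cyclic _ k] at h1 h2
  have h3 := height_self h k
  have h4 := height_two h k
  set w := fun i => (triBasis h).coord i y
  simp only [triBasis_apply] at h1 h2
  have : y - c (k + 1) = w k • (c k - c (k + 1)) + w (k + 2) • (c (k + 2) - c (k + 1)) := by
    have : w (k + 1) = 1 - w k - w (k + 2) := by simp only [w]; linarith
    simp only [w] at this ⊢
    rw [this] at h1
    conv_lhs => rw [← h1]
    module
  rw [height, this, inner_add_left, inner_smul_left, inner_smul_left, ← height, ← height, h3, h4]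
  simp [w]

theorem eq_sum_height (y : E2) :
    y = ∑ k, (height c k y / ‖altVec c k‖) • c k ∧ ∑ k, height c k y / ‖altVec c k‖ = 1 := by
  have e : ∀ k, height c k y / ‖altVec c k‖ = (triBasis h).coord k y := fun k => by
    rw [height_eq h, mul_div_assoc, div_self (norm_altVec_pos h k).ne', mul_one]
  simp only [e]
  exact ⟨((triBasis h).linear_combination_coord_eq_self y).symm,
    (triBasis h).sum_coord_apply_eq_one y⟩

theorem mem_triangle_iff (y : E2) :
    y ∈ convexHull ℝ (Set.range c) ↔ ∀ k, 0 ≤ height c k y := by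
  have := (triBasis h).convexHull_eq_nonneg_coord
  change convexHull ℝ (Set.range c) = _ at this
  rw [this]
  refine forall_congr' fun k => ?_
  rw [height_eq h, mul_nonneg_iff_of_pos_right (norm_altVec_pos h k)]

theorem mem_interior_triangle_iff (y : E2) :
    y ∈ interior (convexHull ℝ (Set.range c)) ↔ ∀ k, 0 < height c k y := by
  have := (triBasis h).interior_convexHull
  change interior (convexHull ℝ (Set.range c)) = _ at this
  rw [this]
  refine forall_congr' fun k => ?_
  rw [height_eq h, mul_pos_iff_of_pos_right (norm_altVec_pos h k)]

theorem mem_openSide_iff (k : Fin 3) (y : E2) :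
    y ∈ openSegment ℝ (c (k + 1)) (c (k + 2)) ↔
      height c k y = 0 ∧ 0 < height c (k + 1) y ∧ 0 < height c (k + 2) y := by
  constructor
  · rintro ⟨a, b, ha, hb, hab, rfl⟩
    have e : ∀ j, height c j (a • c (k + 1) + b • c (k + 2)) =
        a * height c j (c (k + 1)) + b * height c j (c (k + 2)) := fun j => by
      have : a • c (k + 1) + b • c (k + 2) - c (j + 1) =
        a • (c (k + 1) - c (j + 1)) + b • (c (k + 2) - c (j + 1)) := by
        have : a = 1 - b := by linarith
        subst this; module
      simp [height, this, inner_add_left, inner_smul_left]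
    have h12 := height_self h (k + 1)
    have h22 := height_self h (k + 2)
    have h11 := height_one (c := c) (k + 1)
    have h21 := height_two h (k + 2)
    have e1 : k + 1 + 1 = k + 2 := Fin.one_one k
    have e2 : k + 2 + 2 = k + 1 := Fin.two_two k
    rw [e1] at h11
    rw [e2] at h21
    have := norm_altVec_pos h (k + 1)
    have := norm_altVec_pos h (k + 2)
    refine ⟨by simp [e, height_one, height_two h], ?_, ?_⟩
    · rw [e, h12, h11]; positivity
    · rw [e, h22, h21]; positivity
  · rintro ⟨h0, h1, h2⟩
    obtain ⟨e, es⟩ := eq_sum_height h y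
    rw [Fin.sum_three_cyclic _ k, h0] at e es
    simp only [zero_div, zero_smul, zero_add] at e es
    exact ⟨_, _, div_pos h1 (norm_altVec_pos h _), div_pos h2 (norm_altVec_pos h _), es, e.symm⟩

theorem eq_corner_iff (k : Fin 3) (y : E2) :
    y = c k ↔ height c (k + 1) y = 0 ∧ height c (k + 2) y = 0 := by
  constructor
  · rintro rfl
    have h11 := height_two h (k + 1)
    have h21 := height_one (c := c) (k + 2)
    have e1 : k + 1 + 2 = k := Fin.one_two k
    have e2 : k + 2 + 1 = k := Fin.two_one k
    rw [e1] at h11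
    rw [e2] at h21
    exact ⟨h11, h21⟩
  · rintro ⟨h1, h2⟩
    obtain ⟨e, es⟩ := eq_sum_height h y
    rw [Fin.sum_three_cyclic _ k, h1, h2] at e es
    simp only [zero_div, zero_smul, add_zero] at e es
    rw [e, es, one_smul]

theorem triangle_trichotomy {y : E2} (hy : y ∈ convexHull ℝ (Set.range c)) :
    y ∈ interior (convexHull ℝ (Set.range c)) ∨
      (∃ k, y ∈ openSegment ℝ (c (k + 1)) (c (k + 2))) ∨ y ∈ Set.range c := by
  rw [mem_triangle_iff h] at hy
  by_cases h0 : ∀ k, 0 < height c k y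
  · exact Or.inl ((mem_interior_triangle_iff h y).2 h0)
  push Not at h0
  obtain ⟨k, hk⟩ := h0
  have hk0 : height c k y = 0 := le_antisymm hk (hy k)
  have e1 : k + 1 + 1 = k + 2 := Fin.one_one k
  have e2 : k + 1 + 2 = k := Fin.one_two k
  have e3 : k + 2 + 1 = k := Fin.two_one k
  have e4 : k + 2 + 2 = k + 1 := Fin.two_two k
  right
  rcases (hy (k + 1)).eq_or_lt with h1 | h1
  · refine Or.inr ⟨k + 2, ((eq_corner_iff h _ _).2 ?_).symm⟩
    rw [e3, e4]; exact ⟨hk0, h1.symm⟩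
  rcases (hy (k + 2)).eq_or_lt with h2 | h2
  · refine Or.inr ⟨k + 1, ((eq_corner_iff h _ _).2 ?_).symm⟩
    rw [e1, e2]; exact ⟨h2.symm, hk0⟩
  · exact Or.inl ⟨k, (mem_openSide_iff h k y).2 ⟨hk0, h1, h2⟩⟩

omit h in
theorem height_continuous (k : Fin 3) : Continuous (height c k) := by
  unfold height; fun_prop

omit h in
theorem openSide_subset (k : Fin 3) :
    openSegment ℝ (c (k + 1)) (c (k + 2)) ⊆ convexHull ℝ (Set.range c) :=
  (openSegment_subset_segment ..).trans (segment_subset_convexHull ⟨_, rfl⟩ ⟨_, rfl⟩)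

theorem notMem_range_of_mem_openSide {k : Fin 3} {y : E2}
    (hy : y ∈ openSegment ℝ (c (k + 1)) (c (k + 2))) : y ∉ Set.range c := by
  rintro ⟨j, rfl⟩
  rw [mem_openSide_iff h] at hy
  obtain ⟨h0, h1, h2⟩ := hy
  obtain ⟨g1, g2⟩ := (eq_corner_iff h j _).1 rfl
  rcases Fin.three_cases k j with rfl | rfl | rfl
  · exact h1.ne' g1
  · rw [Fin.one_one] at g1
    exact h2.ne' g1
  · rw [Fin.two_two] at g2
    exact h1.ne' g2

theorem openSide_index_unique {k j : Fin 3} {y : E2}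
    (hk : y ∈ openSegment ℝ (c (k + 1)) (c (k + 2)))
    (hj : y ∈ openSegment ℝ (c (j + 1)) (c (j + 2))) : k = j := by
  rw [mem_openSide_iff h] at hk hj
  rcases Fin.three_cases k j with rfl | rfl | rfl
  · rfl
  · exact absurd hj.1 hk.2.1.ne'
  · exact absurd hj.1 hk.2.2.ne'

/-- Near an interior point of a side, a triangle is a half-plane. -/
theorem exists_halfplane {k : Fin 3} {x : E2}
    (hx : x ∈ openSegment ℝ (c (k + 1)) (c (k + 2))) :
    ∃ ε > 0, ∀ y, dist y x < ε →
      (y ∈ convexHull ℝ (Set.range c) ↔ 0 ≤ inner ℝ (y - x) (triNormal c k)) ∧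
      (0 < inner ℝ (y - x) (triNormal c k) → y ∈ interior (convexHull ℝ (Set.range c))) := by
  obtain ⟨h0, h1, h2⟩ := (mem_openSide_iff h k x).1 hx
  have a1 := (height_continuous (c := c) (k + 1)).continuousAt.eventually (lt_mem_nhds h1)
  have a2 := (height_continuous (c := c) (k + 2)).continuousAt.eventually (lt_mem_nhds h2)
  obtain ⟨ε, hε, H⟩ := Metric.eventually_nhds_iff.1 (a1.and a2)
  refine ⟨ε, hε, fun y hy => ?_⟩
  obtain ⟨b1, b2⟩ := H hy
  have e := height_sub (c := c) k y x
  rw [h0, sub_zero] at e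
  rw [mem_triangle_iff h, Fin.forall_three_iff k, mem_interior_triangle_iff h,
    Fin.forall_three_iff k, e]
  exact ⟨⟨fun q => q.1, fun q => ⟨q, b1.le, b2.le⟩⟩, fun q => ⟨q, b1, b2⟩⟩

end Triangle

/-- An isometric map between subsets of the plane extends to an isometry of the plane. -/
theorem exists_affineIsometry {S : Set E2} {F : E2 → E2}
    (hF : ∀ y ∈ S, ∀ z ∈ S, dist (F y) (F z) = dist y z) {p : Fin 3 → E2}
    (hp : AffineIndependent ℝ p) (hpS : ∀ i, p i ∈ S) :
    ∃ A : E2 ≃ᵃⁱ[ℝ] E2, ∀ y ∈ S, F y = A y := by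
  have hin : ∀ y ∈ S, ∀ z ∈ S,
      inner ℝ (F y - F (p 0)) (F z - F (p 0)) = inner ℝ (y - p 0) (z - p 0) := by
    intro y hy z hz
    have e : ∀ u v w : E2, inner ℝ (u - w) (v - w) =
        (dist u w ^ 2 + dist v w ^ 2 - dist u v ^ 2) / 2 := fun u v w => by
      rw [real_inner_eq_norm_mul_self_add_norm_mul_self_sub_norm_sub_mul_self_div_two]
      simp only [dist_eq_norm, sub_sub_sub_cancel_right, sq]
    rw [e, e, hF y hy _ (hpS 0), hF z hz _ (hpS 0), hF y hy z hz]
  have hli : LinearIndependent ℝ ![p 1 - p 0, p 2 - p 0] := by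
    rw [affineIndependent_iff_linearIndependent_vsub ℝ _ 0] at hp
    let e : Fin 2 → {x : Fin 3 // x ≠ 0} := ![⟨1, by decide⟩, ⟨2, by decide⟩]
    have he : Function.Injective e := by decide
    have h2 := hp.comp e he
    have h3 : (fun i : {x : Fin 3 // x ≠ 0} => p i -ᵥ p 0) ∘ e = ![p 1 - p 0, p 2 - p 0] := by
      funext i
      fin_cases i <;> rfl
    rwa [h3] at h2
  let b : Module.Basis (Fin 2) ℝ E2 := basisOfLinearIndependentOfCardEqFinrank hli (by simp)
  have hb0 : b 0 = p 1 - p 0 := by simp [b]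
  have hb1 : b 1 = p 2 - p 0 := by simp [b]
  let L : E2 →ₗ[ℝ] E2 := b.constr ℝ ![F (p 1) - F (p 0), F (p 2) - F (p 0)]
  have hL0 : L (b 0) = F (p 1) - F (p 0) := by simp [L]
  have hL1 : L (b 1) = F (p 2) - F (p 0) := by simp [L]
  have hrep : ∀ v, v = b.repr v 0 • b 0 + b.repr v 1 • b 1 := fun v => by
    conv_lhs => rw [← b.sum_repr v]
    rw [Fin.sum_univ_two]
  have hLn : ∀ v, ‖L v‖ = ‖v‖ := by
    intro v
    rw [← sq_eq_sq₀ (norm_nonneg _) (norm_nonneg _), hrep v, map_add, map_smul, map_smul, hL0, hL1,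
      hb0, hb1, ← real_inner_self_eq_norm_sq, ← real_inner_self_eq_norm_sq]
    simp only [inner_add_left, inner_add_right, inner_smul_left, inner_smul_right,
      hin _ (hpS 1) _ (hpS 1), hin _ (hpS 1) _ (hpS 2), hin _ (hpS 2) _ (hpS 1),
      hin _ (hpS 2) _ (hpS 2)]
  let Li : E2 →ₗᵢ[ℝ] E2 := ⟨L, hLn⟩
  let Le : E2 ≃ₗᵢ[ℝ] E2 := Li.toLinearIsometryEquiv rfl
  have hLe : ∀ v, Le v = L v := fun v => rfl
  refine ⟨(AffineIsometryEquiv.vaddConst ℝ (p 0)).symm.trans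
    (Le.toAffineIsometryEquiv.trans (AffineIsometryEquiv.vaddConst ℝ (F (p 0)))), fun y hy => ?_⟩
  simp only [AffineIsometryEquiv.coe_trans, Function.comp_apply,
    AffineIsometryEquiv.coe_vaddConst_symm, LinearIsometryEquiv.coe_toAffineIsometryEquiv,
    AffineIsometryEquiv.coe_vaddConst, vsub_eq_sub, vadd_eq_add]
  rw [← sub_eq_iff_eq_add, ← sub_eq_zero]
  -- The discrepancy is written as `Le v`. Since `F` preserves inner products, `v` is orthogonal to
  -- both basis vectors, hence zero.
  obtain ⟨v, hv⟩ := Le.surjective (F y - F (p 0) - Le (y - p 0))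
  rw [← hv]
  have h0 : inner ℝ (b 0) v = 0 := by
    rw [← Le.inner_map_map, hv, inner_sub_right, Le.inner_map_map, hLe, hL0,
      hin _ (hpS 1) _ hy, hb0, sub_self]
  have h1 : inner ℝ (b 1) v = 0 := by
    rw [← Le.inner_map_map, hv, inner_sub_right, Le.inner_map_map, hLe, hL1,
      hin _ (hpS 2) _ hy, hb1, sub_self]
  have : inner ℝ v v = 0 := by
    have h2 : inner ℝ (b.repr v 0 • b 0 + b.repr v 1 • b 1) v = 0 := by
      rw [inner_add_left, inner_smul_left, inner_smul_left, h0, h1]; simp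
    rwa [← hrep] at h2
  rw [inner_self_eq_zero.1 this, map_zero]

theorem affineIsometry_apply (A : E2 ≃ᵃⁱ[ℝ] E2) (x y : E2) :
    A y = A.linearIsometryEquiv (y - x) + A x := by
  have := A.map_vadd x (y - x)
  simpa using this

/-! ### Flat charts and the two triangles at an edge -/

section Metric
variable {M : Type*} [MetricSpace M]

theorem IsFlatChart.mono {m : M} {ε ε' : ℝ} {φ : E2 → M} (h : IsFlatChart m ε φ) (h0 : 0 < ε')
    (hle : ε' ≤ ε) : IsFlatChart m ε' φ := by
  have hs : Metric.ball (0 : E2) ε' ⊆ Metric.ball 0 ε := Metric.ball_subset_ball hle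
  have hc : (0 : E2) ∈ Metric.ball (0 : E2) ε := Metric.mem_ball_self (h0.trans_le hle)
  refine ⟨h.center, fun x hx y hy => h.isometric x (hs hx) y (hs hy), ?_⟩
  ext z
  constructor
  · rintro ⟨w, hw, rfl⟩
    rw [Metric.mem_ball, ← h.center, h.isometric w (hs hw) 0 hc]
    exact hw
  · intro hz
    have : z ∈ φ '' Metric.ball 0 ε := by rw [h.image]; exact Metric.ball_subset_ball hle hz
    obtain ⟨w, hw, rfl⟩ := this
    refine ⟨w, ?_, rfl⟩
    rwa [Metric.mem_ball, ← h.center, h.isometric w hw 0 hc] at hz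

theorem IsFlatChart.injOn {m : M} {ε : ℝ} {φ : E2 → M} (h : IsFlatChart m ε φ) :
    Set.InjOn φ (Metric.ball 0 ε) := fun x hx y hy e => by
  rw [← dist_eq_zero, ← h.isometric x hx y hy, e, dist_self]

namespace GeodesicTriangulation
variable (T : GeodesicTriangulation M)

theorem corner_mem_face (t : Fin T.numFaces) (k : Fin 3) : T.corner t k ∈ T.face t :=
  subset_convexHull ℝ _ ⟨k, rfl⟩

theorem isCompact_face (t : Fin T.numFaces) : IsCompact (T.face t) :=
  (Set.finite_range _).isCompact_convexHull (𝕜 := ℝ)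

theorem convex_face (t : Fin T.numFaces) : Convex ℝ (T.face t) := convex_convexHull _ _

/-- The developed open side opposite to the `k`-th corner. -/
abbrev side (t : Fin T.numFaces) (k : Fin 3) : Set E2 :=
  openSegment ℝ (T.corner t (k + 1)) (T.corner t (k + 2))

theorem side_subset (t : Fin T.numFaces) (k : Fin 3) : T.side t k ⊆ T.face t := openSide_subset k

theorem notMem_range_of_mem_side {t : Fin T.numFaces} {k : Fin 3} {x : E2} (hx : x ∈ T.side t k) :
    x ∉ Set.range (T.corner t) := notMem_range_of_mem_openSide (T.corner_indep t) hx

theorem isRegularPoint_iff {t : Fin T.numFaces} {x : E2} (hx : x ∈ T.face t) :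
    IsRegularPoint (T.chart t x) ↔ x ∉ Set.range (T.corner t) := by
  rw [← T.chart_mem_singularSet t x hx]
  exact (not_not).symm

/-- In a flat chart, the chart of a triangle is given by an isometry of the plane. -/
theorem exists_transition {t : Fin T.numFaces} {x : E2} (hx : x ∈ T.face t)
    (hxc : x ∉ Set.range (T.corner t)) {ε : ℝ} (hε : 0 < ε) {φ : E2 → M}
    (hφ : IsFlatChart (T.chart t x) ε φ) :
    ∃ A : E2 ≃ᵃⁱ[ℝ] E2, A x = 0 ∧ ∃ δ > 0, ∀ y ∈ T.face t, dist y x < δ →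
      T.chart t y = φ (A y) := by
  obtain ⟨η, hη, H⟩ := T.chart_isometric t x ⟨hx, hxc⟩
  set δ := min η ε
  have hδ : 0 < δ := lt_min hη hε
  set S := T.face t ∩ Metric.ball x δ
  have hS : ∀ y ∈ S, ∀ z ∈ S, dist (T.chart t y) (T.chart t z) = dist y z := fun y hy z hz =>
    H y ⟨hy.1, Metric.ball_subset_ball (min_le_left _ _) hy.2⟩ z
      ⟨hz.1, Metric.ball_subset_ball (min_le_left _ _) hz.2⟩
  have hxS : x ∈ S := ⟨hx, Metric.mem_ball_self hδ⟩
  have hex : ∀ y, ∃ w, y ∈ S → w ∈ Metric.ball (0 : E2) ε ∧ φ w = T.chart t y := by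
    intro y
    by_cases hy : y ∈ S
    · have : T.chart t y ∈ φ '' Metric.ball 0 ε := by
        rw [hφ.image, Metric.mem_ball, hS y hy x hxS]
        exact hy.2.trans_le (min_le_right _ _)
      obtain ⟨w, hw⟩ := this
      exact ⟨w, fun _ => hw⟩
    · exact ⟨0, fun h => absurd h hy⟩
  -- `F` is the map `T.chart t` read in the flat chart. It is isometric on `S`, so it is the
  -- restriction of an isometry as soon as `S` contains an affinely independent triple.
  choose F hF using hex
  have hFiso : ∀ y ∈ S, ∀ z ∈ S, dist (F y) (F z) = dist y z := fun y hy z hz => by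
    rw [← hφ.isometric _ (hF y hy).1 _ (hF z hz).1, (hF y hy).2, (hF z hz).2, hS y hy z hz]
  obtain ⟨R, hR⟩ := (T.isCompact_face t).isBounded.subset_ball x
  have hR0 : 0 < R := Metric.pos_of_mem_ball (hR hx)
  set τ := δ / (R + δ)
  have hτ : 0 < τ := by positivity
  have hτ1 : τ ≤ 1 := by rw [div_le_one (by positivity)]; linarith
  -- The triple is the whole triangle shrunk towards `x`; the ratio is chosen so that `τ * R < δ`,
  -- with all corners within `R` of `x`.
  let p : Fin 3 → E2 := fun i => AffineMap.homothety x τ (T.corner t i)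
  have hp : AffineIndependent ℝ p := by
    have hinj : Function.Injective (AffineMap.homothety x τ : E2 →ᵃ[ℝ] E2) := by
      intro y z hyz
      simp only [AffineMap.homothety_apply, vsub_eq_sub, vadd_eq_add, add_left_inj] at hyz
      exact sub_left_injective (smul_right_injective _ hτ.ne' hyz)
    exact (T.corner_indep t).map' _ hinj
  have hpS : ∀ i, p i ∈ S := by
    intro i
    have e : p i = x + τ • (T.corner t i - x) := by
      simp [p, AffineMap.homothety_apply, add_comm]
    refine ⟨?_, ?_⟩
    · rw [e]
      exact (T.convex_face t).add_smul_sub_mem hx (T.corner_mem_face t i) ⟨hτ.le, hτ1⟩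
    · have := hR (T.corner_mem_face t i)
      rw [Metric.mem_ball, dist_eq_norm] at this ⊢
      rw [e, add_sub_cancel_left, norm_smul, Real.norm_of_nonneg hτ.le]
      calc τ * ‖T.corner t i - x‖ < τ * R := by gcongr
        _ < δ := by
          rw [div_mul_eq_mul_div, div_lt_iff₀ (by positivity)]
          nlinarith
  obtain ⟨A, hA⟩ := exists_affineIsometry hFiso hp hpS
  refine ⟨A, ?_, δ, hδ, fun y hy hyx => ?_⟩
  · rw [← hA x hxS]
    refine hφ.injOn (hF x hxS).1 (Metric.mem_ball_self hε) ?_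
    rw [(hF x hxS).2, hφ.center]
  · rw [← hA y ⟨hy, hyx⟩, (hF y ⟨hy, hyx⟩).2]

/-- Every point near `m` has a preimage near a preimage of `m`. -/
theorem exists_near_preimage (m : M) (δ : Fin T.numFaces → E2 → ℝ)
    (hδ : ∀ t, ∀ x ∈ T.face t, T.chart t x = m → 0 < δ t x) :
    ∃ η > 0, ∀ m', dist m' m < η → ∃ t, ∃ x ∈ T.face t, ∃ y ∈ T.face t, T.chart t x = m ∧
      T.chart t y = m' ∧ dist y x < δ t x := by
  -- `K t` is what remains of the triangle outside the prescribed balls about the preimages of `m`.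
  -- The images of these compact sets form a closed set that misses `m`.
  let K : Fin T.numFaces → Set E2 := fun t =>
    T.face t \ ⋃ x ∈ {x | x ∈ T.face t ∧ T.chart t x = m}, Metric.ball x (δ t x)
  have hK : ∀ t, IsCompact (K t) := fun t =>
    (T.isCompact_face t).diff (isOpen_biUnion fun x _ => Metric.isOpen_ball)
  have hc : IsClosed (⋃ t, T.chart t '' K t) := isClosed_iUnion_of_finite fun t =>
    ((hK t).image_of_continuousOn ((T.chart_continuousOn t).mono Set.sdiff_subset)).isClosed
  have hm : m ∉ ⋃ t, T.chart t '' K t := by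
    simp only [Set.mem_iUnion, not_exists]
    rintro t ⟨x, ⟨hx, hx'⟩, hxm⟩
    refine hx' (Set.mem_biUnion ⟨hx, hxm⟩ (Metric.mem_ball_self (hδ t x hx hxm)))
  obtain ⟨η, hη, H⟩ := Metric.isOpen_iff.1 hc.isOpen_compl m hm
  refine ⟨η, hη, fun m' hm' => ?_⟩
  obtain ⟨t, y, hy, rfl⟩ := T.cover m'
  have h1 := H hm'
  by_cases h2 : y ∈ K t
  · exact (h1 (Set.mem_iUnion.2 ⟨t, y, h2, rfl⟩)).elim
  · have : y ∈ ⋃ x ∈ {x | x ∈ T.face t ∧ T.chart t x = m}, Metric.ball x (δ t x) := by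
      by_contra h3; exact h2 ⟨hy, h3⟩
    simp only [Set.mem_iUnion] at this
    obtain ⟨x, ⟨hx, hxm⟩, hyx⟩ := this
    exact ⟨t, x, hx, y, hy, hxm, rfl, hyx⟩

theorem trichotomy {t : Fin T.numFaces} {x : E2} (hx : x ∈ T.face t) :
    x ∈ interior (T.face t) ∨ (∃ k, x ∈ T.side t k) ∨ x ∈ Set.range (T.corner t) :=
  triangle_trichotomy (T.corner_indep t) hx

/-- The inner unit normal of a side. -/
abbrev normal (t : Fin T.numFaces) (k : Fin 3) : E2 := triNormal (T.corner t) k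

/-- A flat chart at an interior point of an edge, developing the two adjacent triangles. -/
structure IsEdgeChart (t : Fin T.numFaces) (k : Fin 3) (x : E2) (t' : Fin T.numFaces) (k' : Fin 3)
    (x' : E2) (ε : ℝ) (φ : E2 → M) (A A' : E2 ≃ᵃⁱ[ℝ] E2) : Prop where
  pos : 0 < ε
  flat : IsFlatChart (T.chart t x) ε φ
  map_left : A x = 0
  map_right : A' x' = 0
  chart_left : ∀ y ∈ T.face t, dist y x < ε → T.chart t y = φ (A y)
  chart_right : ∀ y ∈ T.face t', dist y x' < ε → T.chart t' y = φ (A' y)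
  mem_left : ∀ y, dist y x < ε → (y ∈ T.face t ↔ 0 ≤ inner ℝ (y - x) (T.normal t k))
  mem_right : ∀ y, dist y x' < ε → (y ∈ T.face t' ↔ 0 ≤ inner ℝ (y - x') (T.normal t' k'))
  normal : A'.linearIsometryEquiv (T.normal t' k') = -A.linearIsometryEquiv (T.normal t k)

/-- The local data at an interior point of a side. -/
theorem exists_half_chart {t : Fin T.numFaces} {k : Fin 3} {x : E2} (hx : x ∈ T.side t k)
    {ε : ℝ} (hε : 0 < ε) {φ : E2 → M} (hφ : IsFlatChart (T.chart t x) ε φ) :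
    ∃ A : E2 ≃ᵃⁱ[ℝ] E2, A x = 0 ∧ ∃ δ > 0, ∀ y, dist y x < δ →
      (y ∈ T.face t → T.chart t y = φ (A y)) ∧
      (y ∈ T.face t ↔ 0 ≤ inner ℝ (y - x) (T.normal t k)) ∧
      (0 < inner ℝ (y - x) (T.normal t k) → y ∈ interior (T.face t)) := by
  obtain ⟨A, hA, δ, hδ, H⟩ := T.exists_transition (T.side_subset t k hx)
    (T.notMem_range_of_mem_side hx) hε hφ
  obtain ⟨δ', hδ', H'⟩ := exists_halfplane (T.corner_indep t) hx
  refine ⟨A, hA, min δ δ', lt_min hδ hδ', fun y hy => ⟨fun h => H y h ?_, H' y ?_⟩⟩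
  · exact hy.trans_le (min_le_left _ _)
  · exact hy.trans_le (min_le_right _ _)

/-- Each preimage of an interior point of an edge fills a half-disc of a flat chart. Half-discs of
distinct preimages can overlap only along their boundary, by `interior_inj`, so their inner normals
are opposite. The half-disc opposite to the first one has to be covered, which gives a second
preimage; a third one would need a normal opposite to both. -/
theorem exists_edgeChart {t : Fin T.numFaces} {k : Fin 3} {x : E2} (hx : x ∈ T.side t k) :
    ∃ t' k' x', x' ∈ T.side t' k' ∧ (t', x') ≠ (t, x) ∧ T.chart t' x' = T.chart t x ∧
      (∃ ε φ A A', T.IsEdgeChart t k x t' k' x' ε φ A A') ∧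
      ∀ t'' x'', x'' ∈ T.face t'' → T.chart t'' x'' = T.chart t x →
        (t'', x'') = (t, x) ∨ (t'', x'') = (t', x') := by
  obtain ⟨ε, hε, φ, hφ⟩ := (T.isRegularPoint_iff (T.side_subset t k hx)).2
    (T.notMem_range_of_mem_side hx)
  -- every preimage lies on a side
  have hpre : ∀ t₁ x₁, x₁ ∈ T.face t₁ → T.chart t₁ x₁ = T.chart t x → ∃ k₁, x₁ ∈ T.side t₁ k₁ := by
    intro t₁ x₁ hx₁ he
    rcases T.trichotomy hx₁ with h | h | h
    · obtain ⟨rfl, rfl⟩ := T.interior_inj t₁ t x₁ h x (T.side_subset t k hx) he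
      exact ⟨k, hx⟩
    · exact h
    · exact absurd ((T.isRegularPoint_iff hx₁).1 (he ▸ ⟨ε, hε, φ, hφ⟩)) (not_not.2 h)
  -- two different preimages have opposite normals
  have hopp : ∀ t₁ k₁ x₁ (A₁ : E2 ≃ᵃⁱ[ℝ] E2) δ₁ t₂ k₂ x₂ (A₂ : E2 ≃ᵃⁱ[ℝ] E2) δ₂,
      x₁ ∈ T.side t₁ k₁ → A₁ x₁ = 0 → 0 < δ₁ → x₂ ∈ T.side t₂ k₂ → A₂ x₂ = 0 → 0 < δ₂ →
      (∀ y, dist y x₁ < δ₁ → (y ∈ T.face t₁ → T.chart t₁ y = φ (A₁ y)) ∧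
      (y ∈ T.face t₁ ↔ 0 ≤ inner ℝ (y - x₁) (T.normal t₁ k₁)) ∧
      (0 < inner ℝ (y - x₁) (T.normal t₁ k₁) → y ∈ interior (T.face t₁))) →
      (∀ y, dist y x₂ < δ₂ → (y ∈ T.face t₂ → T.chart t₂ y = φ (A₂ y)) ∧
      (y ∈ T.face t₂ ↔ 0 ≤ inner ℝ (y - x₂) (T.normal t₂ k₂)) ∧
      (0 < inner ℝ (y - x₂) (T.normal t₂ k₂) → y ∈ interior (T.face t₂))) →
      (t₂, x₂) ≠ (t₁, x₁) →
      A₂.linearIsometryEquiv (T.normal t₂ k₂) = -A₁.linearIsometryEquiv (T.normal t₁ k₁) := by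
    intro t₁ k₁ x₁ A₁ δ₁ t₂ k₂ x₂ A₂ δ₂ hx₁ hA₁ hδ₁ hx₂ hA₂ hδ₂ H₁ H₂ hne
    set n₁ := A₁.linearIsometryEquiv (T.normal t₁ k₁) with hn₁
    set n₂ := A₂.linearIsometryEquiv (T.normal t₂ k₂) with hn₂
    have hN₁ : ‖n₁‖ = 1 := by rw [hn₁, LinearIsometryEquiv.norm_map, norm_triNormal (T.corner_indep t₁)]
    have hN₂ : ‖n₂‖ = 1 := by rw [hn₂, LinearIsometryEquiv.norm_map, norm_triNormal (T.corner_indep t₂)]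
    -- no point of the chart is inside both half-discs
    have key : ∀ w : E2, ‖w‖ < δ₁ → ‖w‖ < δ₂ → 0 < inner ℝ w n₁ → 0 < inner ℝ w n₂ →
        t₂ = t₁ ∧ A₂.symm w = A₁.symm w := by
      have aux : ∀ (A : E2 ≃ᵃⁱ[ℝ] E2) (z w n : E2), A z = 0 → dist (A.symm w) z = ‖w‖ ∧
          inner ℝ (A.symm w - z) n = inner ℝ w (A.linearIsometryEquiv n) := by
        intro A z w n hA
        constructor
        · rw [← A.dist_map, A.apply_symm_apply, hA, dist_zero_right]
        · rw [← A.linearIsometryEquiv.inner_map_map]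
          have := affineIsometry_apply A z (A.symm w)
          rw [A.apply_symm_apply, hA, add_zero] at this
          rw [← this]
      intro w h1 h2 p1 p2
      obtain ⟨d1, i1⟩ := aux A₁ x₁ w (T.normal t₁ k₁) hA₁
      obtain ⟨d2, i2⟩ := aux A₂ x₂ w (T.normal t₂ k₂) hA₂
      rw [← hn₁] at i1
      rw [← hn₂] at i2
      obtain ⟨c1, -, m1⟩ := H₁ (A₁.symm w) (d1 ▸ h1)
      obtain ⟨c2, -, m2⟩ := H₂ (A₂.symm w) (d2 ▸ h2)
      have m1 := m1 (i1 ▸ p1)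
      have m2 := m2 (i2 ▸ p2)
      refine T.interior_inj t₂ t₁ _ m2 _ (interior_subset m1) ?_
      rw [c1 (interior_subset m1), c2 (interior_subset m2), A₁.apply_symm_apply,
        A₂.apply_symm_apply]
    by_contra hnn
    apply hne
    -- If the normals are not opposite, the vectors `τ • (n₁ + n₂)` lie strictly inside both
    -- half-discs. They then have the same preimage in the same triangle, and letting `τ` tend to
    -- `0` yields `x₁ = x₂`.
    have hI : -1 < inner ℝ n₁ n₂ := by
      refine lt_of_le_of_ne ?_ ?_
      · have := abs_real_inner_le_norm n₁ n₂
        rw [hN₁, hN₂] at this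
        linarith [(abs_le.1 this).1]
      · intro h
        apply hnn
        have := (inner_eq_neg_one_iff_of_norm_eq_one (𝕜 := ℝ) hN₁ hN₂).1 h.symm
        rw [this, neg_neg]
    set δ := min δ₁ δ₂
    have hδ : 0 < δ := lt_min hδ₁ hδ₂
    have hw : ∀ τ : ℝ, 0 < τ → τ * 2 < δ → t₂ = t₁ ∧
        A₂.symm (τ • (n₁ + n₂)) = A₁.symm (τ • (n₁ + n₂)) := by
      intro τ h0 h1
      have hn : ‖τ • (n₁ + n₂)‖ < δ := by
        rw [norm_smul, Real.norm_of_nonneg h0.le]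
        refine lt_of_le_of_lt ?_ h1
        gcongr
        linarith [norm_add_le n₁ n₂]
      refine key _ (hn.trans_le (min_le_left _ _)) (hn.trans_le (min_le_right _ _)) ?_ ?_
      · rw [inner_smul_left, inner_add_left, real_inner_self_eq_norm_sq, hN₁, real_inner_comm]
        simp only [conj_trivial]
        exact mul_pos h0 (by linarith)
      · rw [inner_smul_left, inner_add_left, real_inner_self_eq_norm_sq, hN₂]
        simp only [conj_trivial]
        exact mul_pos h0 (by linarith)
    have hlim : Filter.Tendsto (fun τ : ℝ => τ • (n₁ + n₂)) (nhdsWithin 0 (Set.Ioi 0)) (nhds 0) := by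
      have : Continuous (fun τ : ℝ => τ • (n₁ + n₂)) := by fun_prop
      have := this.tendsto 0
      rw [zero_smul] at this
      exact this.mono_left nhdsWithin_le_nhds
    have h1 := (A₁.symm.continuous.tendsto 0).comp hlim
    have h2 := (A₂.symm.continuous.tendsto 0).comp hlim
    have heq : (A₁.symm ∘ fun τ : ℝ => τ • (n₁ + n₂)) =ᶠ[nhdsWithin 0 (Set.Ioi 0)]
        (A₂.symm ∘ fun τ : ℝ => τ • (n₁ + n₂)) := by
      have : Set.Ioo (0 : ℝ) (δ / 2) ∈ nhdsWithin (0 : ℝ) (Set.Ioi 0) :=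
        Ioo_mem_nhdsGT (by linarith)
      filter_upwards [this] with τ hτ
      exact ((hw τ hτ.1 (by linarith [hτ.2])).2).symm
    have h3 := tendsto_nhds_unique (h1.congr' heq) h2
    rw [Prod.mk.injEq]
    refine ⟨(hw (δ / 4) (by linarith) (by linarith)).1, ?_⟩
    rw [← A₁.symm_apply_apply x₁, hA₁, h3, ← hA₂, A₂.symm_apply_apply]
  -- choose the local data for all preimages
  have hdata : ∀ t₁ x₁, ∃ A : E2 ≃ᵃⁱ[ℝ] E2, ∃ δ : ℝ, ∃ k₁, x₁ ∈ T.face t₁ →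
      T.chart t₁ x₁ = T.chart t x → x₁ ∈ T.side t₁ k₁ ∧ A x₁ = 0 ∧ 0 < δ ∧ ∀ y, dist y x₁ < δ →
      (y ∈ T.face t₁ → T.chart t₁ y = φ (A y)) ∧
      (y ∈ T.face t₁ ↔ 0 ≤ inner ℝ (y - x₁) (T.normal t₁ k₁)) ∧
      (0 < inner ℝ (y - x₁) (T.normal t₁ k₁) → y ∈ interior (T.face t₁)) := by
    intro t₁ x₁
    by_cases h : x₁ ∈ T.face t₁ ∧ T.chart t₁ x₁ = T.chart t x
    · obtain ⟨k₁, hk₁⟩ := hpre t₁ x₁ h.1 h.2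
      obtain ⟨A, hA, δ, hδ, H⟩ := T.exists_half_chart hk₁ hε (h.2 ▸ hφ)
      exact ⟨A, δ, k₁, fun _ _ => ⟨hk₁, hA, hδ, H⟩⟩
    · exact ⟨AffineIsometryEquiv.refl ℝ E2, 0, 0, fun h1 h2 => absurd ⟨h1, h2⟩ h⟩
  choose A δ κ hD using hdata
  obtain ⟨hxk, hAx, hδx, Hx⟩ := hD t x (T.side_subset t k hx) rfl
  obtain rfl : κ t x = k := openSide_index_unique (T.corner_indep t) hxk hx
  set n := (A t x).linearIsometryEquiv (T.normal t (κ t x)) with hn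
  have hN : ‖n‖ = 1 := by
    rw [hn, LinearIsometryEquiv.norm_map, norm_triNormal (T.corner_indep t)]
  -- the opposite half-disc is covered by another triangle
  obtain ⟨η, hη, Hη⟩ := T.exists_near_preimage (T.chart t x) (fun t₁ x₁ => min (δ t₁ x₁) ε)
    (fun t₁ x₁ h1 h2 => lt_min (hD t₁ x₁ h1 h2).2.2.1 hε)
  obtain ⟨t', x', hx', hmx', hne⟩ : ∃ t' x', x' ∈ T.face t' ∧ T.chart t' x' = T.chart t x ∧
      (t', x') ≠ (t, x) := by
    -- The probe `(-τ) • n` lies outside the half-disc of `(t, x)`, so the nearby preimage of its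
    -- image belongs to another preimage of the centre.
    set τ := min η ε / 2
    have hτ : 0 < τ := half_pos (lt_min hη hε)
    have hτ' : τ < min η ε := half_lt_self (lt_min hη hε)
    have hnw : ‖(-τ) • n‖ = τ := by rw [norm_smul, hN, norm_neg, Real.norm_of_nonneg hτ.le, mul_one]
    have hwε : (-τ) • n ∈ Metric.ball (0 : E2) ε := by
      rw [mem_ball_zero_iff, hnw]; exact hτ'.trans_le (min_le_right _ _)
    have hdist : dist (φ ((-τ) • n)) (T.chart t x) < η := by
      rw [← hφ.center, hφ.isometric _ hwε _ (Metric.mem_ball_self hε), dist_zero_right, hnw]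
      exact hτ'.trans_le (min_le_left _ _)
    obtain ⟨t', x', hx', y, hy, hm, hym, hd⟩ := Hη _ hdist
    refine ⟨t', x', hx', hm, fun he => ?_⟩
    rw [Prod.mk.injEq] at he
    obtain ⟨rfl, rfl⟩ := he
    obtain ⟨c1, c2, -⟩ := Hx y (hd.trans_le (min_le_left _ _))
    have hA : A t' x' y = A t' x' y - 0 := by simp
    have hyb : A t' x' y ∈ Metric.ball (0 : E2) ε := by
      rw [Metric.mem_ball, ← hAx, AffineIsometryEquiv.dist_map]
      exact hd.trans_le (min_le_right _ _)
    have hyw := hφ.injOn hyb hwε ((c1 hy).symm.trans hym)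
    have := c2.1 hy
    rw [← (A t' x').linearIsometryEquiv.inner_map_map, ← hn] at this
    have e := affineIsometry_apply (A t' x') x' y
    rw [hAx, add_zero] at e
    rw [← e, hyw, inner_smul_left, real_inner_self_eq_norm_sq, hN] at this
    simp only [conj_trivial] at this
    linarith
  obtain ⟨hxk', hAx', hδx', Hx'⟩ := hD t' x' hx' hmx'
  have hnn := hopp t _ x _ _ t' _ x' _ _ hx hAx hδx hxk' hAx' hδx' Hx Hx' hne
  refine ⟨t', κ t' x', x', hxk', hne, hmx', ?_, ?_⟩
  · set ε' := min ε (min (δ t x) (δ t' x'))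
    have hε' : 0 < ε' := lt_min hε (lt_min hδx hδx')
    have l1 : ε' ≤ δ t x := (min_le_right _ _).trans (min_le_left _ _)
    have l2 : ε' ≤ δ t' x' := (min_le_right _ _).trans (min_le_right _ _)
    exact ⟨ε', φ, A t x, A t' x', hε', hφ.mono hε' (min_le_left _ _), hAx, hAx',
      fun y hy hd => (Hx y (hd.trans_le l1)).1 hy, fun y hy hd => (Hx' y (hd.trans_le l2)).1 hy,
      fun y hd => (Hx y (hd.trans_le l1)).2.1, fun y hd => (Hx' y (hd.trans_le l2)).2.1, hnn⟩
  · intro t'' x'' hx'' hmx''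
    by_contra hcon
    push Not at hcon
    obtain ⟨hxk'', hAx'', hδx'', Hx''⟩ := hD t'' x'' hx'' hmx''
    have h1 := hopp t _ x _ _ t'' _ x'' _ _ hx hAx hδx hxk'' hAx'' hδx'' Hx Hx'' hcon.1
    have h2 := hopp t' _ x' _ _ t'' _ x'' _ _ hxk' hAx' hδx' hxk'' hAx'' hδx'' Hx' Hx'' hcon.2
    rw [h1, hnn, neg_neg, ← hn, neg_eq_iff_add_eq_zero, ← two_smul ℝ, smul_eq_zero] at h2
    rcases h2 with h2 | h2
    · norm_num at h2
    · rw [h2, norm_zero] at hN; norm_num at hN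

end GeodesicTriangulation
end Metric

/-! ### Isometric gluing of triangle sides -/

section Metric
variable {M : Type*} [MetricSpace M]

/-- By continuity the map and its inverse preserve the closed interval. The resulting inequalities
at the end points leave only the identity and the reversal. -/
theorem affine_bijOn_unit {r κ : ℝ} (hr : r ≠ 0) (h1 : ∀ s ∈ Set.Ioo (0 : ℝ) 1, r * s + κ ∈ Set.Ioo (0 : ℝ) 1)
    (h2 : ∀ y ∈ Set.Ioo (0 : ℝ) 1, (y - κ) / r ∈ Set.Ioo (0 : ℝ) 1) :
    (r = 1 ∧ κ = 0) ∨ (r = -1 ∧ κ = 1) := by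
  have ext : ∀ g : ℝ → ℝ, Continuous g → (∀ s ∈ Set.Ioo (0 : ℝ) 1, g s ∈ Set.Ioo (0 : ℝ) 1) →
      ∀ s ∈ Set.Icc (0 : ℝ) 1, g s ∈ Set.Icc (0 : ℝ) 1 := fun g hg H s hs => by
    rw [← closure_Ioo zero_ne_one] at hs ⊢
    exact map_mem_closure hg hs H
  have g1 := ext (fun s => r * s + κ) (by fun_prop) h1
  have g2 := ext (fun y => (y - κ) / r) (by fun_prop) h2
  have a0 := g1 0 (by simp)
  have a1 := g1 1 (by simp)
  have b0 := g2 0 (by simp)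
  have b1 := g2 1 (by simp)
  simp only [Set.mem_Icc] at a0 a1 b0 b1
  rcases hr.lt_or_gt with h | h
  · rw [le_div_iff_of_neg h, div_le_iff_of_neg h] at b0 b1
    right
    constructor <;> linarith
  · rw [le_div_iff₀ h, div_le_iff₀ h] at b0 b1
    left
    constructor <;> linarith

/-- Two arcs with the same interior, both parametrized proportionally to arc length, have the same
length and agree up to reversal. -/
theorem arcs_match {P P' : ℝ → M} {ℓ ℓ' : ℝ} (hℓ : 0 < ℓ) (hℓ' : 0 < ℓ')
    (hc : ContinuousOn P (Set.Icc 0 1)) (hc' : ContinuousOn P' (Set.Icc 0 1))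
    (hi : Set.InjOn P (Set.Ioo 0 1)) (hi' : Set.InjOn P' (Set.Ioo 0 1))
    (him : P '' Set.Ioo 0 1 = P' '' Set.Ioo 0 1)
    (h0 : P' 0 ∉ P' '' Set.Ioo 0 1) (h1 : P' 1 ∉ P' '' Set.Ioo 0 1)
    (hloc : ∀ s ∈ Set.Ioo (0 : ℝ) 1, ∃ ε > 0, ∀ u ∈ Set.Ioo (0 : ℝ) 1, |u - s| < ε →
      dist (P u) (P s) = ℓ * |u - s|)
    (hloc' : ∀ s ∈ Set.Ioo (0 : ℝ) 1, ∃ ε > 0, ∀ u ∈ Set.Ioo (0 : ℝ) 1, |u - s| < ε →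
      dist (P' u) (P' s) = ℓ' * |u - s|) :
    ℓ = ℓ' ∧ ((∀ s ∈ Set.Icc (0 : ℝ) 1, P s = P' s) ∨
      (∀ s ∈ Set.Icc (0 : ℝ) 1, P s = P' (1 - s))) := by
  have hex : ∀ s, ∃ r, s ∈ Set.Ioo (0 : ℝ) 1 → r ∈ Set.Ioo (0 : ℝ) 1 ∧ P' r = P s := by
    intro s
    by_cases hs : s ∈ Set.Ioo (0 : ℝ) 1
    · have : P s ∈ P' '' Set.Ioo 0 1 := him ▸ ⟨s, hs, rfl⟩
      obtain ⟨r, hr⟩ := this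
      exact ⟨r, fun _ => hr⟩
    · exact ⟨0, fun h => absurd h hs⟩
  -- `σ` is the change of parameter from `P` to `P'`. It is continuous by compactness and scales
  -- lengths locally by `ℓ / ℓ'`; the aim is to show that it is affine.
  choose σ hσ using hex
  have hσc : ContinuousOn σ (Set.Ioo 0 1) := by
    intro s hs
    rw [Metric.continuousWithinAt_iff]
    intro ε hε
    set K := Set.Icc (0 : ℝ) 1 \ Metric.ball (σ s) ε
    have hK : IsClosed (P' '' K) :=
      ((isCompact_Icc.diff Metric.isOpen_ball).image_of_continuousOn
        (hc'.mono Set.sdiff_subset)).isClosed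
    have hPs : P s ∉ P' '' K := by
      rintro ⟨r, ⟨hr, hr'⟩, he⟩
      have hm : P' r ∈ P' '' Set.Ioo 0 1 := by rw [he, ← him]; exact ⟨s, hs, rfl⟩
      have hr0 : r ∈ Set.Ioo (0 : ℝ) 1 := by
        refine ⟨hr.1.lt_of_ne ?_, hr.2.lt_of_ne ?_⟩
        · rintro rfl; exact h0 hm
        · rintro rfl; exact h1 hm
      rw [hi' hr0 (hσ s hs).1 (he.trans (hσ s hs).2.symm)] at hr'
      exact hr' (Metric.mem_ball_self hε)
    have hnear : ∀ᶠ u in nhdsWithin s (Set.Ioo 0 1), P u ∈ (P' '' K)ᶜ :=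
      ((hc.mono Set.Ioo_subset_Icc_self) s hs).eventually (hK.isOpen_compl.mem_nhds hPs)
    obtain ⟨δ, hδ, H⟩ := Metric.mem_nhdsWithin_iff.1 hnear
    refine ⟨δ, hδ, fun {u} hu hd => ?_⟩
    have := H ⟨hd, hu⟩
    by_contra hcon
    exact this ⟨σ u, ⟨Set.Ioo_subset_Icc_self (hσ u hu).1, hcon⟩, (hσ u hu).2⟩
  have hσi : Set.InjOn σ (Set.Ioo 0 1) := fun u hu v hv e =>
    hi hu hv (by rw [← (hσ u hu).2, ← (hσ v hv).2, e])
  have habs : ∀ s ∈ Set.Ioo (0 : ℝ) 1, ∀ᶠ u in nhds s, |σ u - σ s| = ℓ / ℓ' * |u - s| := by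
    intro s hs
    obtain ⟨ε, hε, H⟩ := hloc s hs
    obtain ⟨ε', hε', H'⟩ := hloc' (σ s) (hσ s hs).1
    have hcs : ContinuousAt σ s := hσc.continuousAt (Ioo_mem_nhds hs.1 hs.2)
    filter_upwards [Ioo_mem_nhds hs.1 hs.2, Metric.ball_mem_nhds s hε,
      hcs.eventually (Metric.ball_mem_nhds _ hε')] with u hu hu1 hu2
    have e1 := H u hu hu1
    have e2 := H' (σ u) (hσ u hu).1 hu2
    rw [(hσ u hu).2, (hσ s hs).2, e1] at e2
    field_simp
    linarith
  have hlin : ∃ r : ℝ, |r| = ℓ / ℓ' ∧ ∀ s ∈ Set.Ioo (0 : ℝ) 1, ∀ᶠ u in nhds s,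
      σ u = σ s + r * (u - s) := by
    -- A continuous injection of an interval is monotone, so the slope `ℓ / ℓ'` or `-(ℓ / ℓ')` has
    -- the same sign everywhere.
    have hq : 0 < ℓ / ℓ' := by positivity
    rcases hσc.strictMonoOn_of_injOn_Ioo zero_lt_one hσi with hm | hm
    · refine ⟨ℓ / ℓ', abs_of_pos hq, fun s hs => ?_⟩
      filter_upwards [habs s hs, Ioo_mem_nhds hs.1 hs.2] with u h hu
      rcases le_total s u with hsu | hsu
      · have := hm.monotoneOn hs hu hsu
        rw [abs_of_nonneg (by linarith), abs_of_nonneg (by linarith)] at h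
        linarith
      · have := hm.monotoneOn hu hs hsu
        rw [abs_of_nonpos (by linarith), abs_of_nonpos (by linarith)] at h
        linarith
    · refine ⟨-(ℓ / ℓ'), by rw [abs_neg, abs_of_pos hq], fun s hs => ?_⟩
      filter_upwards [habs s hs, Ioo_mem_nhds hs.1 hs.2] with u h hu
      rcases le_total s u with hsu | hsu
      · have := hm.antitoneOn hs hu hsu
        rw [abs_of_nonpos (by linarith), abs_of_nonneg (by linarith)] at h
        linarith
      · have := hm.antitoneOn hu hs hsu
        rw [abs_of_nonneg (by linarith), abs_of_nonpos (by linarith)] at h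
        linarith
  obtain ⟨r, hr, hlin⟩ := hlin
  have hr0 : r ≠ 0 := by
    rintro rfl
    rw [abs_zero] at hr
    have : 0 < ℓ / ℓ' := by positivity
    linarith
  have hder : ∀ s ∈ Set.Ioo (0 : ℝ) 1, HasDerivAt (fun u => σ u - r * u) 0 s := by
    intro s hs
    have : (fun u => σ u - r * u) =ᶠ[nhds s] fun _ => σ s - r * s := by
      filter_upwards [hlin s hs] with u hu
      rw [hu]; ring
    exact (hasDerivAt_const s _).congr_of_eventuallyEq this
  obtain ⟨κ, hκ⟩ : ∃ κ, ∀ s ∈ Set.Ioo (0 : ℝ) 1, σ s = r * s + κ := by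
    refine ⟨σ (1 / 2) - r * (1 / 2), fun s hs => ?_⟩
    have := isOpen_Ioo.is_const_of_deriv_eq_zero (isPreconnected_Ioo (a := (0 : ℝ)) (b := 1))
      (fun s hs => (hder s hs).differentiableAt.differentiableWithinAt)
      (fun s hs => (hder s hs).deriv) hs (y := 1 / 2) ⟨by norm_num, by norm_num⟩
    linarith
  have hcase := affine_bijOn_unit hr0 (fun s hs => hκ s hs ▸ (hσ s hs).1) (fun y hy => by
    have : P' y ∈ P '' Set.Ioo 0 1 := him ▸ ⟨y, hy, rfl⟩
    obtain ⟨s, hs, he⟩ := this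
    have := hi' hy (hσ s hs).1 (he.symm.trans (hσ s hs).2.symm)
    rw [this, hκ s hs]
    have e : (r * s + κ - κ) / r = s := by field_simp; ring
    rwa [e])
  have hcl : Set.Icc (0 : ℝ) 1 ⊆ closure (Set.Ioo 0 1) := (closure_Ioo zero_ne_one).ge
  rcases hcase with ⟨rfl, rfl⟩ | ⟨rfl, rfl⟩
  · rw [abs_one] at hr
    refine ⟨((div_eq_one_iff_eq hℓ'.ne').1 hr.symm), Or.inl ?_⟩
    refine Set.EqOn.of_subset_closure (s := Set.Ioo 0 1) ?_ hc hc' Set.Ioo_subset_Icc_self hcl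
    intro s hs
    rw [← (hσ s hs).2, hκ s hs, one_mul, add_zero]
  · rw [abs_neg, abs_one] at hr
    refine ⟨((div_eq_one_iff_eq hℓ'.ne').1 hr.symm), Or.inr ?_⟩
    refine Set.EqOn.of_subset_closure (s := Set.Ioo 0 1) ?_ hc
      (hc'.comp (by fun_prop) fun s hs => ?_) Set.Ioo_subset_Icc_self hcl
    · intro s hs
      rw [← (hσ s hs).2, hκ s hs]
      congr 1; ring
    · exact ⟨by linarith [hs.2], by linarith [hs.1]⟩

namespace GeodesicTriangulation
variable (T : GeodesicTriangulation M)

theorem openSide_nonempty (t : Fin T.numFaces) (k : Fin 3) : (T.side t k).Nonempty :=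
  ⟨_, ⟨2⁻¹, 2⁻¹, by norm_num, by norm_num, by norm_num, rfl⟩⟩

theorem openSide_eq_of_mem {t t' : Fin T.numFaces} {k k' : Fin 3} {x x' : E2} (hx : x ∈ T.side t k)
    (hx' : x' ∈ T.side t' k') (h : T.chart t' x' = T.chart t x) :
    T.openSide t' k' = T.openSide t k := by
  rcases T.side_eq_or_disjoint t' t k' k with e | e
  · exact e
  · exact absurd ⟨x, hx, h.symm⟩ (Set.disjoint_left.1 e ⟨x', hx', rfl⟩)

/-- It suffices to look at one interior point of the edge: it has exactly two preimages, every side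
with this image contains one of them, and a point lies on at most one open side of its triangle. The
partner may belong to the same triangle; it differs as a side because sides are embedded. -/
theorem exists_partner (p : Fin T.numFaces × Fin 3) :
    ∃ p' : Fin T.numFaces × Fin 3, p' ≠ p ∧
      ∀ p'', T.openSide p''.1 p''.2 = T.openSide p.1 p.2 ↔ p'' = p ∨ p'' = p' := by
  obtain ⟨t, k⟩ := p
  obtain ⟨x, hx⟩ := T.openSide_nonempty t k
  obtain ⟨t', k', x', hx', hne, hm, -, huniq⟩ := T.exists_edgeChart hx
  have he := T.openSide_eq_of_mem hx hx' hm
  refine ⟨(t', k'), ?_, fun p'' => ⟨fun h => ?_, ?_⟩⟩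
  · intro e
    rw [Prod.mk.injEq] at e
    obtain ⟨rfl, rfl⟩ := e
    exact hne (by rw [T.side_inj t' k' hx' hx hm])
  · obtain ⟨t'', k''⟩ := p''
    have hmem : T.chart t x ∈ T.openSide t'' k'' := by
      simp only at h
      rw [h]; exact ⟨x, hx, rfl⟩
    obtain ⟨x'', hx'', hm''⟩ := hmem
    rcases huniq t'' x'' (T.side_subset _ _ hx'') hm'' with e | e
    · rw [Prod.mk.injEq] at e
      obtain ⟨rfl, rfl⟩ := e
      left
      rw [openSide_index_unique (T.corner_indep t'') hx'' hx]
    · rw [Prod.mk.injEq] at e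
      obtain ⟨rfl, rfl⟩ := e
      right
      rw [openSide_index_unique (T.corner_indep t'') hx'' hx']
  · rintro (rfl | rfl)
    · rfl
    · exact he

/-- The other triangle side that is glued to the given one. -/
def partner (p : Fin T.numFaces × Fin 3) : Fin T.numFaces × Fin 3 := (T.exists_partner p).choose

theorem partner_ne (p : Fin T.numFaces × Fin 3) : T.partner p ≠ p :=
  (T.exists_partner p).choose_spec.1

theorem openSide_eq_iff (p p'' : Fin T.numFaces × Fin 3) :
    T.openSide p''.1 p''.2 = T.openSide p.1 p.2 ↔ p'' = p ∨ p'' = T.partner p :=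
  (T.exists_partner p).choose_spec.2 p''

theorem openSide_partner (p : Fin T.numFaces × Fin 3) :
    T.openSide (T.partner p).1 (T.partner p).2 = T.openSide p.1 p.2 :=
  (T.openSide_eq_iff p _).2 (Or.inr rfl)

theorem exists_edgeChart_partner (p : Fin T.numFaces × Fin 3) {x : E2} (hx : x ∈ T.side p.1 p.2) :
    ∃ x' ∈ T.side (T.partner p).1 (T.partner p).2, T.chart (T.partner p).1 x' = T.chart p.1 x ∧
      ∃ ε φ A A', T.IsEdgeChart p.1 p.2 x (T.partner p).1 (T.partner p).2 x' ε φ A A' := by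
  obtain ⟨t', k', x', hx', hne, hm, hE, -⟩ := T.exists_edgeChart hx
  have he := T.openSide_eq_of_mem hx hx' hm
  rcases (T.openSide_eq_iff p (t', k')).1 he with h | h
  · subst h
    exact absurd (by rw [T.side_inj t' k' hx' hx hm]) hne
  · rw [← h]
    exact ⟨x', hx', hm, hE⟩

open AffineMap in
theorem lineMap_mem_side {t : Fin T.numFaces} {k : Fin 3} {s : ℝ} (hs : s ∈ Set.Ioo (0 : ℝ) 1) :
    lineMap (T.corner t (k + 1)) (T.corner t (k + 2)) s ∈ T.side t k := by
  rw [side, openSegment_eq_image_lineMap]; exact ⟨s, hs, rfl⟩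

open AffineMap in
/-- Two triangle sides with the same image are glued isometrically. -/
theorem sides_match {t t' : Fin T.numFaces} {k k' : Fin 3}
    (h : T.openSide t k = T.openSide t' k') :
    ‖sideVec (T.corner t) k‖ = ‖sideVec (T.corner t') k'‖ ∧
    ((∀ s ∈ Set.Icc (0 : ℝ) 1,
      T.chart t (lineMap (T.corner t (k + 1)) (T.corner t (k + 2)) s) =
        T.chart t' (lineMap (T.corner t' (k' + 1)) (T.corner t' (k' + 2)) s)) ∨
    (∀ s ∈ Set.Icc (0 : ℝ) 1,
      T.chart t (lineMap (T.corner t (k + 1)) (T.corner t (k + 2)) s) =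
        T.chart t' (lineMap (T.corner t' (k' + 1)) (T.corner t' (k' + 2)) (1 - s)))) := by
  have hface : ∀ t k, ∀ s ∈ Set.Icc (0 : ℝ) 1,
      lineMap (T.corner t (k + 1)) (T.corner t (k + 2)) s ∈ T.face t := fun t k s hs =>
    (T.convex_face t).lineMap_mem (T.corner_mem_face _ _) (T.corner_mem_face _ _) hs
  have hpos : ∀ t k, 0 < ‖sideVec (T.corner t) k‖ := fun t k => norm_sideVec_pos (T.corner_indep t) k
  have hinj : ∀ t k, Function.Injective
      (lineMap (T.corner t (k + 1)) (T.corner t (k + 2)) : ℝ → E2) := fun t k =>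
    lineMap_injective ℝ fun e => Fin.add_two_ne_add_one k ((T.corner_indep t).injective e).symm
  have hc : ∀ t k, ContinuousOn
      (fun s => T.chart t (lineMap (T.corner t (k + 1)) (T.corner t (k + 2)) s))
      (Set.Icc (0 : ℝ) 1) := fun t k =>
    (T.chart_continuousOn t).comp (lineMap_continuous.continuousOn) fun s hs => hface t k s hs
  have hi : ∀ t k, Set.InjOn
      (fun s => T.chart t (lineMap (T.corner t (k + 1)) (T.corner t (k + 2)) s))
      (Set.Ioo (0 : ℝ) 1) := fun t k u hu v hv e =>
    hinj t k (T.side_inj t k (T.lineMap_mem_side hu) (T.lineMap_mem_side hv) e)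
  have him : ∀ t k, (fun s => T.chart t (lineMap (T.corner t (k + 1)) (T.corner t (k + 2)) s)) ''
      Set.Ioo (0 : ℝ) 1 = T.openSide t k := fun t k => by
    rw [openSide, openSegment_eq_image_lineMap, Set.image_image]
  -- End points of edges are singular while interior points are regular, so an end point is never an
  -- interior point of an edge.
  have hend : ∀ t k j, T.chart t (T.corner t j) ∉ T.openSide t k := by
    rintro t k j ⟨x, hx, he⟩
    have h1 := (T.isRegularPoint_iff (T.side_subset t k hx)).2 (T.notMem_range_of_mem_side hx)
    rw [he, T.isRegularPoint_iff (T.corner_mem_face t j)] at h1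
    exact h1 ⟨j, rfl⟩
  have hloc : ∀ t k, ∀ s ∈ Set.Ioo (0 : ℝ) 1, ∃ ε > 0, ∀ u ∈ Set.Ioo (0 : ℝ) 1, |u - s| < ε →
      dist (T.chart t (lineMap (T.corner t (k + 1)) (T.corner t (k + 2)) u))
        (T.chart t (lineMap (T.corner t (k + 1)) (T.corner t (k + 2)) s)) =
      ‖sideVec (T.corner t) k‖ * |u - s| := by
    intro t k s hs
    obtain ⟨ε, hε, H⟩ := T.chart_isometric t _
      ⟨hface t k s (Set.Ioo_subset_Icc_self hs), T.notMem_range_of_mem_side (T.lineMap_mem_side hs)⟩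
    have hd : ∀ u, dist (lineMap (T.corner t (k + 1)) (T.corner t (k + 2)) u)
        (lineMap (T.corner t (k + 1)) (T.corner t (k + 2)) s) =
        ‖sideVec (T.corner t) k‖ * |u - s| := fun u => by
      rw [dist_lineMap_lineMap, dist_comm (T.corner t (k + 1)), dist_eq_norm (T.corner t (k + 2)),
        Real.dist_eq, mul_comm]
      rfl
    refine ⟨ε / ‖sideVec (T.corner t) k‖, div_pos hε (hpos t k), fun u hu hus => ?_⟩
    rw [← hd u]
    refine H _ ⟨hface t k u (Set.Ioo_subset_Icc_self hu), ?_⟩ _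
      ⟨hface t k s (Set.Ioo_subset_Icc_self hs), Metric.mem_ball_self hε⟩
    rw [Metric.mem_ball, hd u, mul_comm]
    exact (lt_div_iff₀ (hpos t k)).1 hus
  have e0 := hend t' k' (k' + 1)
  have e1 := hend t' k' (k' + 2)
  refine arcs_match (hpos t k) (hpos t' k') (hc t k) (hc t' k') (hi t k) (hi t' k')
    (by rw [him, him, h]) ?_ ?_ (hloc t k) (hloc t' k')
  · rw [him]; simpa using e0
  · rw [him]; simpa using e1

end GeodesicTriangulation
end Metric

/-! ### Q-functions and PQ-extensions -/

/-- All Q-functions have the same quadratic part, so along a segment they are determined by the end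
values and the length; `a` and `b` enter only through the end values. -/
theorem quad_lineMap (c₁ c₂ a : E2) (b s : ℝ) :
    ‖AffineMap.lineMap c₁ c₂ s - a‖ ^ 2 + b =
      (1 - s) * (‖c₁ - a‖ ^ 2 + b) + s * (‖c₂ - a‖ ^ 2 + b) - s * (1 - s) * ‖c₂ - c₁‖ ^ 2 := by
  have e1 : AffineMap.lineMap c₁ c₂ s - a = (c₁ - a) + s • (c₂ - c₁) := by
    rw [AffineMap.lineMap_apply_module']; abel
  have e2 : c₂ - a = (c₁ - a) + (c₂ - c₁) := by abel
  rw [e1, e2, norm_add_sq_real, norm_add_sq_real, inner_smul_right, norm_smul, mul_pow,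
    Real.norm_eq_abs, sq_abs]
  ring

/-- The set where two Q-functions agree is convex by `quad_lineMap`. -/
theorem qFunction_eqOn_triangle {c : Fin 3 → E2} {a a' : E2} {b b' : ℝ}
    (h : ∀ k, ‖c k - a‖ ^ 2 + b = ‖c k - a'‖ ^ 2 + b') {x : E2}
    (hx : x ∈ convexHull ℝ (Set.range c)) : ‖x - a‖ ^ 2 + b = ‖x - a'‖ ^ 2 + b' := by
  have hconv : Convex ℝ {x : E2 | ‖x - a‖ ^ 2 + b = ‖x - a'‖ ^ 2 + b'} := by
    rw [convex_iff_forall_pos]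
    intro y hy z hz s r hs hr hsr
    have e : s • y + r • z = AffineMap.lineMap y z r := by
      rw [AffineMap.lineMap_apply_module]; congr 2; linarith
    simp only [Set.mem_ofPred_eq] at hy hz ⊢
    rw [e, quad_lineMap, quad_lineMap, hy, hz]
  exact convexHull_min (by rintro _ ⟨k, rfl⟩; exact h k) hconv hx

section Metric
variable {M : Type*} [MetricSpace M]

/-- `f` is given on the triangle `t` by the Q-function with parameters `a t` and `b t`. -/
def IsQData (T : GeodesicTriangulation M) (f : M → ℝ) (a : Fin T.numFaces → E2)
    (b : Fin T.numFaces → ℝ) : Prop :=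
  ∀ t, ∀ x ∈ T.face t, f (T.chart t x) = ‖x - a t‖ ^ 2 + b t

theorem IsPQExtension.exists_qData {T : GeodesicTriangulation M} {q : singularSet M → ℝ} {f : M → ℝ}
    (h : IsPQExtension T q f) : ∃ a b, IsQData T f a b := by
  choose a b hab using h.2.1
  exact ⟨a, b, hab⟩

theorem IsPQExtension.eq {T : GeodesicTriangulation M} {q : singularSet M → ℝ} {f g : M → ℝ}
    (hf : IsPQExtension T q f) (hg : IsPQExtension T q g) : f = g := by
  obtain ⟨a, b, ha⟩ := hf.exists_qData
  obtain ⟨a', b', ha'⟩ := hg.exists_qData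
  funext m
  obtain ⟨t, x, hx, rfl⟩ := T.cover m
  rw [ha t x hx, ha' t x hx]
  refine qFunction_eqOn_triangle (fun k => ?_) hx
  have hc := T.corner_mem_face t k
  rw [← ha t _ hc, ← ha' t _ hc]
  exact (hf.2.2 (T.vertex t k)).trans (hg.2.2 (T.vertex t k)).symm

namespace GeodesicTriangulation
variable (T : GeodesicTriangulation M)

/-- Q-functions on the triangles with prescribed values at the vertices agree on the sides. -/
theorem qFunction_glue {q : singularSet M → ℝ} {a : Fin T.numFaces → E2} {b : Fin T.numFaces → ℝ}
    (hq : ∀ t k, ‖T.corner t k - a t‖ ^ 2 + b t = q (T.vertex t k)) {t t' : Fin T.numFaces}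
    {x x' : E2} (hx : x ∈ T.face t) (hx' : x' ∈ T.face t') (h : T.chart t x = T.chart t' x') :
    ‖x - a t‖ ^ 2 + b t = ‖x' - a t'‖ ^ 2 + b t' := by
  rcases T.trichotomy hx with hi | ⟨k, hk⟩ | ⟨k, rfl⟩
  · obtain ⟨rfl, rfl⟩ := T.interior_inj t t' x hi x' hx' h
    rfl
  · rcases T.trichotomy hx' with hi' | ⟨k', hk'⟩ | hc'
    · obtain ⟨rfl, rfl⟩ := T.interior_inj t' t x' hi' x hx h.symm
      rfl
    · obtain ⟨hl, hm⟩ := T.sides_match (T.openSide_eq_of_mem hk' hk h)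
      have hk2 := hk
      rw [side, openSegment_eq_image_lineMap] at hk2
      obtain ⟨s, hs, rfl⟩ := hk2
      have hv : ∀ j j', T.chart t (T.corner t j) = T.chart t' (T.corner t' j') →
          ‖T.corner t j - a t‖ ^ 2 + b t = ‖T.corner t' j' - a t'‖ ^ 2 + b t' := by
        intro j j' he
        rw [hq, hq]
        congr 1
        exact Subtype.ext he
      rcases hm with hm | hm
      · have h0 := hm 0 (by simp)
        have h1 := hm 1 (by simp)
        simp only [AffineMap.lineMap_apply_zero, AffineMap.lineMap_apply_one] at h0 h1
        have e := T.side_inj t' k' hk' (T.lineMap_mem_side hs)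
          (h.symm.trans (hm s (Set.Ioo_subset_Icc_self hs)))
        -- Both points have the same parameter on sides of equal length with equal end values, so
        -- `quad_lineMap` gives the same value.
        rw [e, quad_lineMap, quad_lineMap, hv _ _ h0, hv _ _ h1, ← sideVec, ← sideVec, hl]
      · have h0 := hm 0 (by simp)
        have h1 := hm 1 (by simp)
        simp only [AffineMap.lineMap_apply_zero, AffineMap.lineMap_apply_one, sub_zero, sub_self]
          at h0 h1
        have hs' : 1 - s ∈ Set.Ioo (0 : ℝ) 1 := ⟨by linarith [hs.2], by linarith [hs.1]⟩
        have e := T.side_inj t' k' hk' (T.lineMap_mem_side hs')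
          (h.symm.trans (hm s (Set.Ioo_subset_Icc_self hs)))
        rw [e, quad_lineMap, quad_lineMap, hv _ _ h0, hv _ _ h1, ← sideVec, ← sideVec, hl]
        ring
    · have h1 := (T.isRegularPoint_iff hx).2 (T.notMem_range_of_mem_side hk)
      rw [h, T.isRegularPoint_iff hx'] at h1
      exact absurd hc' h1
  · have h1 : ¬ IsRegularPoint (T.chart t (T.corner t k)) := by
      rw [T.isRegularPoint_iff hx]; exact not_not.2 ⟨k, rfl⟩
    rw [h, T.isRegularPoint_iff hx', not_not] at h1
    obtain ⟨k', rfl⟩ := h1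
    rw [hq, hq]
    congr 1
    exact Subtype.ext h

/-- `M` carries the quotient topology of the triangles: it is covered by finitely many continuous
images of compact sets, so a preimage is closed once it is closed in every triangle. -/
theorem continuous_of_chart {X : Type*} [TopologicalSpace X] {f : M → X}
    (h : ∀ t, ContinuousOn (fun x => f (T.chart t x)) (T.face t)) : Continuous f := by
  rw [continuous_iff_isClosed]
  intro K hK
  have e : f ⁻¹' K = ⋃ t, T.chart t '' (T.face t ∩ (fun x => f (T.chart t x)) ⁻¹' K) := by
    ext m
    simp only [Set.mem_iUnion, Set.mem_image, Set.mem_preimage]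
    constructor
    · intro hm
      obtain ⟨t, x, hx, rfl⟩ := T.cover m
      exact ⟨t, x, ⟨hx, hm⟩, rfl⟩
    · rintro ⟨t, x, ⟨-, hx⟩, rfl⟩
      exact hx
  rw [e]
  refine isClosed_iUnion_of_finite fun t => ?_
  have hcl := (h t).preimage_isClosed_of_isClosed (T.isCompact_face t).isClosed hK
  exact (((T.isCompact_face t).of_isClosed_subset hcl Set.inter_subset_left).image_of_continuousOn
    ((T.chart_continuousOn t).mono Set.inter_subset_left)).isClosed

theorem exists_pqExtension {q : singularSet M → ℝ} {a : Fin T.numFaces → E2}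
    {b : Fin T.numFaces → ℝ} (hq : ∀ t k, ‖T.corner t k - a t‖ ^ 2 + b t = q (T.vertex t k)) :
    ∃ f, IsPQExtension T q f ∧ IsQData T f a b := by
  choose τ ξ hξ hm using T.cover
  have hQ : IsQData T (fun m => ‖ξ m - a (τ m)‖ ^ 2 + b (τ m)) a b := fun t x hx =>
    T.qFunction_glue hq (hξ _) hx (hm _)
  refine ⟨_, ⟨T.continuous_of_chart fun t => ?_, fun t => ⟨a t, b t, hQ t⟩, fun i => ?_⟩, hQ⟩
  · have : ContinuousOn (fun x => ‖x - a t‖ ^ 2 + b t) (T.face t) := by fun_prop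
    exact this.congr (hQ t)
  · obtain ⟨t, x, hx, he⟩ := T.cover (i : M)
    have h1 : x ∈ Set.range (T.corner t) := (T.chart_mem_singularSet t x hx).1 (he ▸ i.2)
    obtain ⟨k, rfl⟩ := h1
    have h2 := hQ t _ hx
    rw [he] at h2
    refine h2.trans ?_
    rw [hq]
    congr 1
    exact Subtype.ext he

end GeodesicTriangulation

/-! ### Couples and PQ-functions -/

/-- Pythagoras. This is the dictionary between apices and Q-functions: the centre is the foot of the
altitude, the constant is the squared altitude. -/
theorem dist_lift_sq (p : E3) (x : E2) :
    dist p (lift x) ^ 2 = ‖x - !₂[p 0, p 1]‖ ^ 2 + p 2 ^ 2 := by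
  rw [EuclideanSpace.dist_eq, Real.sq_sqrt (by positivity), EuclideanSpace.norm_eq,
    Real.sq_sqrt (by positivity)]
  simp only [Fin.sum_univ_three, Fin.sum_univ_two, Real.dist_eq, sq_abs, lift, Real.norm_eq_abs,
    PiLp.sub_apply]
  simp
  ring

namespace Couple
variable (C : Couple M)

/-- The foot of the altitude of the pyramid over `t`. -/
def foot (t : Fin C.T.numFaces) : E2 := !₂[C.apex t 0, C.apex t 1]

theorem exists_sqDist : ∃ f, IsPQExtension C.T (fun i => C.radius i ^ 2) f ∧
    IsQData C.T f C.foot (fun t => C.apex t 2 ^ 2) :=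
  C.T.exists_pqExtension fun t k => by
    rw [← C.dist_apex t k, dist_lift_sq]; rfl

/-- The squared distance from the points of the boundary to the apex, within the pyramids. -/
def sqDist : M → ℝ := C.exists_sqDist.choose

theorem isPQExtension_sqDist : IsPQExtension C.T (fun i => C.radius i ^ 2) C.sqDist :=
  C.exists_sqDist.choose_spec.1

theorem isQData_sqDist : IsQData C.T C.sqDist C.foot (fun t => C.apex t 2 ^ 2) :=
  C.exists_sqDist.choose_spec.2

theorem sqDist_chart {t : Fin C.T.numFaces} {x : E2} (hx : x ∈ C.T.face t) :
    C.sqDist (C.T.chart t x) = dist (C.apex t) (lift x) ^ 2 := by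
  rw [C.isQData_sqDist t x hx, dist_lift_sq]; rfl

theorem sqDist_pos (m : M) : 0 < C.sqDist m := by
  obtain ⟨t, x, hx, rfl⟩ := C.T.cover m
  rw [C.isQData_sqDist t x hx]
  have := C.apex_height t
  positivity

end Couple

/-- The dictionary read backwards: the apex is placed at height `√(b t)` above the centre `a t`,
which requires the constants to be positive. -/
theorem IsPQExtension.exists_couple {T : GeodesicTriangulation M} {q : singularSet M → ℝ}
    {f : M → ℝ} (hf : IsPQExtension T q f) (hpos : ∀ m, 0 < f m) {a : Fin T.numFaces → E2}
    {b : Fin T.numFaces → ℝ} (hQ : IsQData T f a b) (hb : ∀ t, 0 < b t) :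
    ∃ C : Couple M, C.T = T ∧ (∀ i, C.radius i ^ 2 = q i) ∧ C.sqDist = f := by
  have hq : ∀ i, 0 < q i := fun i => hf.2.2 i ▸ hpos i
  let C : Couple M :=
    { T := T
      radius := fun i => √(q i)
      radius_pos := fun i => Real.sqrt_pos.2 (hq i)
      apex := fun t => !₂[a t 0, a t 1, √(b t)]
      apex_height := fun t => by simpa using hb t
      dist_apex := fun t k => by
        rw [← Real.sqrt_sq dist_nonneg, dist_lift_sq]
        congr 1
        have h1 := hQ t _ (T.corner_mem_face t k)
        have h2 := hf.2.2 (T.vertex t k)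
        have h3 : (!₂[a t 0, a t 1] : E2) = a t := by
          ext i; fin_cases i <;> rfl
        have h4 : (!₂[a t 0, a t 1, √(b t)] : E3) 2 ^ 2 = b t := by
          simpa using Real.sq_sqrt (hb t).le
        rw [h4, ← h2]
        refine Eq.trans ?_ h1.symm
        rw [← h3]; rfl }
  have hr : ∀ i, C.radius i ^ 2 = q i := fun i => Real.sq_sqrt (hq i).le
  refine ⟨C, rfl, hr, ?_⟩
  have h1 := C.isPQExtension_sqDist
  have h2 : (fun i => C.radius i ^ 2) = q := funext hr
  rw [h2] at h1
  exact h1.eq hf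

/-! ### Local form of PQ-functions -/

theorem IsFlatChart.translate {m : M} {ε : ℝ} {φ : E2 → M} (h : IsFlatChart m ε φ) {w : E2}
    (hw : w ∈ Metric.ball (0 : E2) ε) : IsRegularPoint (φ w) := by
  rw [mem_ball_zero_iff] at hw
  have hε : 0 < ε := (norm_nonneg _).trans_lt hw
  have hsub : ∀ v ∈ Metric.ball (0 : E2) (ε - ‖w‖), w + v ∈ Metric.ball (0 : E2) ε := by
    intro v hv
    rw [mem_ball_zero_iff] at hv ⊢
    linarith [norm_add_le w v]
  have hw' : w ∈ Metric.ball (0 : E2) ε := mem_ball_zero_iff.2 hw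
  refine ⟨ε - ‖w‖, by linarith, fun v => φ (w + v), by simp, fun x hx y hy => ?_, ?_⟩
  · rw [h.isometric _ (hsub x hx) _ (hsub y hy), dist_add_left]
  · ext z
    constructor
    · rintro ⟨v, hv, rfl⟩
      rw [Metric.mem_ball, h.isometric _ (hsub v hv) _ hw', dist_self_add_left]
      exact mem_ball_zero_iff.1 hv
    · intro hz
      have hzm : z ∈ Metric.ball m ε := by
        rw [Metric.mem_ball] at hz ⊢
        have e : dist (φ w) m = ‖w‖ := by
          rw [← h.center, h.isometric _ hw' _ (Metric.mem_ball_self hε), dist_zero_right]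
        linarith [dist_triangle z (φ w) m]
      rw [← h.image] at hzm
      obtain ⟨u, hu, rfl⟩ := hzm
      refine ⟨u - w, ?_, by simp⟩
      rw [mem_ball_zero_iff, ← dist_eq_norm, ← h.isometric _ hu _ hw']
      exact hz

/-- In a flat chart geodesics are straight. -/
theorem IsFlatChart.geodesic {m : M} {ε : ℝ} {φ : E2 → M} (h : IsFlatChart m ε φ) {γ : ℝ → M}
    {I : Set ℝ} (hγ : ∀ u ∈ I, ∀ v ∈ I, dist (γ u) (γ v) = |u - v|) {s u₁ : ℝ} (hs : s ∈ I)
    (hm : γ s = m) (hu₁ : u₁ ∈ I) (hne : u₁ ≠ s) (hlt : |u₁ - s| < ε) :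
    ∃ e : E2, ‖e‖ = 1 ∧ ∀ u ∈ I, |u - s| < ε → γ u = φ ((u - s) • e) := by
  have hε : 0 < ε := (abs_nonneg _).trans_lt hlt
  have h0 : (0 : E2) ∈ Metric.ball (0 : E2) ε := Metric.mem_ball_self hε
  have hex : ∀ u ∈ I, |u - s| < ε → ∃ w ∈ Metric.ball (0 : E2) ε, φ w = γ u := by
    intro u hu hus
    have : γ u ∈ φ '' Metric.ball 0 ε := by
      rw [h.image, Metric.mem_ball, ← hm, hγ u hu s hs]; exact hus
    exact this
  have hnorm : ∀ u ∈ I, ∀ w ∈ Metric.ball (0 : E2) ε, φ w = γ u → ‖w‖ = |u - s| := by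
    intro u hu w hw he
    rw [← hγ u hu s hs, ← he, hm, ← h.center, h.isometric w hw 0 h0, dist_zero_right]
  obtain ⟨w₁, hw₁, he₁⟩ := hex u₁ hu₁ hlt
  have hn₁ := hnorm u₁ hu₁ w₁ hw₁ he₁
  have hd : u₁ - s ≠ 0 := sub_ne_zero.2 hne
  refine ⟨(u₁ - s)⁻¹ • w₁, ?_, fun u hu hus => ?_⟩
  · rw [norm_smul, hn₁, norm_inv, Real.norm_eq_abs, inv_mul_cancel₀ (abs_ne_zero.2 hd)]
  · obtain ⟨w, hw, he⟩ := hex u hu hus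
    have hn := hnorm u hu w hw he
    have hd1 : ‖w - w₁‖ = |u - u₁| := by
      rw [← dist_eq_norm, ← h.isometric w hw w₁ hw₁, he, he₁, hγ u hu u₁ hu₁]
    have hin : inner ℝ w w₁ = (u - s) * (u₁ - s) := by
      rw [real_inner_eq_norm_mul_self_add_norm_mul_self_sub_norm_sub_mul_self_div_two, hn, hn₁, hd1,
        abs_mul_abs_self, abs_mul_abs_self, abs_mul_abs_self]
      ring
    rw [← he]
    congr 1
    rw [← sub_eq_zero, ← norm_eq_zero, ← sq_eq_zero_iff, norm_sub_sq_real, norm_smul, norm_smul,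
      inner_smul_right, inner_smul_right, hin, hn, hn₁, norm_inv, Real.norm_eq_abs,
      Real.norm_eq_abs, mul_pow, mul_pow, inv_pow, sq_abs, sq_abs]
    field_simp
    ring

variable {T : GeodesicTriangulation M} {f : M → ℝ} {a : Fin T.numFaces → E2}
  {b : Fin T.numFaces → ℝ}

/-- The sum over both triangles at an edge of the signed distances from the edge to the centres of
the Q-functions. -/
def jump (T : GeodesicTriangulation M) (a : Fin T.numFaces → E2) (p : Fin T.numFaces × Fin 3) : ℝ :=
  height (T.corner p.1) p.2 (a p.1) +
    height (T.corner (T.partner p).1) (T.partner p).2 (a (T.partner p).1)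

theorem height_eq_of_mem_side {t : Fin T.numFaces} {k : Fin 3} {x : E2} (hx : x ∈ T.side t k)
    (y : E2) : inner ℝ (y - x) (T.normal t k) = height (T.corner t) k y := by
  rw [← height_sub, ((mem_openSide_iff (T.corner_indep t) k x).1 hx).1, sub_zero]

/-- The difference of two Q-functions is affine, with gradient twice the difference of the centres.
If it vanishes along a line, this gradient has no tangential component. -/
theorem qFunctions_across_line {n α α' : E2} {b b' ε : ℝ} (hε : 0 < ε) (hn : ‖n‖ = 1)
    (h : ∀ w : E2, ‖w‖ < ε → inner ℝ w n = 0 → ‖w - α‖ ^ 2 + b = ‖w - α'‖ ^ 2 + b') :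
    ‖α‖ ^ 2 + b = ‖α'‖ ^ 2 + b' ∧ α' = α + (inner ℝ α' n - inner ℝ α n) • n := by
  have h0 : ‖α‖ ^ 2 + b = ‖α'‖ ^ 2 + b' := by simpa using h 0 (by simpa) (by simp)
  refine ⟨h0, ?_⟩
  set v := α' - α - inner ℝ (α' - α) n • n with hv
  have hvn : inner ℝ v n = 0 := by
    rw [hv, inner_sub_left, inner_smul_left, real_inner_self_eq_norm_sq, hn]; simp
  have hv0 : inner ℝ v (α' - α) = 0 := by
    set τ := ε / (2 * (‖v‖ + 1))
    have hτ : 0 < τ := by positivity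
    have h1 := h (τ • v) ?_ ?_
    · rw [norm_sub_sq_real, norm_sub_sq_real, inner_smul_left, inner_smul_left] at h1
      simp only [conj_trivial] at h1
      have h2 : τ * inner ℝ v (α' - α) = 0 := by rw [inner_sub_right]; linarith
      exact (mul_eq_zero.1 h2).resolve_left hτ.ne'
    · rw [norm_smul, Real.norm_of_nonneg hτ.le, div_mul_eq_mul_div, div_lt_iff₀ (by positivity)]
      nlinarith [norm_nonneg v]
    · rw [inner_smul_left, hvn, mul_zero]
  have hvv : inner ℝ v v = 0 := by
    conv_lhs => rw [hv]
    rw [← hv]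
    have : inner ℝ v (α' - α - inner ℝ (α' - α) n • n) = 0 := by
      rw [inner_sub_right, hv0, inner_smul_right, hvn]; simp
    rwa [← hv] at this
  have hvz := inner_self_eq_zero.1 hvv
  rw [hv, sub_eq_zero, inner_sub_left] at hvz
  rw [← hvz]; abel

/-- Both triangles are developed into one flat chart, with `n` pointing into the triangle `p.1`. The
centres `α` and `α'` have normal coordinates `h` and `-h'` and differ by a multiple of `n`, so `α' =
α - J • n` with `J = h + h'`; expanding the squares gives the term `2 * J * ⟪w, n⟫` on the far side.
Equality of the values at the origin gives the first claim: over pyramids both sides are the squared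
distance from the apex to the edge line. -/
theorem IsQData.edge_formula (hQ : IsQData T f a b) (p : Fin T.numFaces × Fin 3) {x : E2}
    (hx : x ∈ T.side p.1 p.2) :
    height (T.corner p.1) p.2 (a p.1) ^ 2 + b p.1 =
        height (T.corner (T.partner p).1) (T.partner p).2 (a (T.partner p).1) ^ 2 +
          b (T.partner p).1 ∧
    ∃ ε > 0, ∃ φ n α, IsFlatChart (T.chart p.1 x) ε φ ∧ ‖n‖ = 1 ∧ ∀ w : E2, ‖w‖ < ε →
      f (φ w) = ‖w - α‖ ^ 2 + b p.1 + 2 * jump T a p * min (inner ℝ w n) 0 := by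
  obtain ⟨x', hx', hm, ε, φ, A, A', hE⟩ := T.exists_edgeChart_partner p hx
  unfold jump
  set p' := T.partner p
  set n := A.linearIsometryEquiv (T.normal p.1 p.2) with hndef
  have hn : ‖n‖ = 1 := by
    rw [hndef, LinearIsometryEquiv.norm_map, norm_triNormal (T.corner_indep _)]
  have aux : ∀ (t : Fin T.numFaces) (k : Fin 3) (B : E2 ≃ᵃⁱ[ℝ] E2) (z : E2), B z = 0 →
      z ∈ T.side t k → ∀ y : E2, dist y z = ‖B y‖ ∧ ‖y - a t‖ = ‖B y - B (a t)‖ ∧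
        inner ℝ (y - z) (T.normal t k) =
          inner ℝ (B y) (B.linearIsometryEquiv (T.normal t k)) := by
    intro t k B z hB hz y
    refine ⟨?_, ?_, ?_⟩
    · rw [← B.dist_map, hB, dist_zero_right]
    · rw [← dist_eq_norm, ← B.dist_map, dist_eq_norm]
    · rw [← B.linearIsometryEquiv.inner_map_map]
      have := affineIsometry_apply B z y
      rw [hB, add_zero] at this
      rw [← this]
  set α := A (a p.1)
  set α' := A' (a p'.1)
  have hα : inner ℝ α n = height (T.corner p.1) p.2 (a p.1) := by
    rw [← height_eq_of_mem_side hx, (aux _ p.2 A x hE.map_left hx (a p.1)).2.2]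
  have hα' : inner ℝ α' n = -height (T.corner p'.1) p'.2 (a p'.1) := by
    rw [← height_eq_of_mem_side hx', (aux _ p'.2 A' x' hE.map_right hx' (a p'.1)).2.2, hE.normal,
      inner_neg_right, neg_neg]
  have hup : ∀ w : E2, ‖w‖ < ε → 0 ≤ inner ℝ w n → f (φ w) = ‖w - α‖ ^ 2 + b p.1 := by
    intro w hw hwn
    obtain ⟨e1, e2, e3⟩ := aux _ p.2 A x hE.map_left hx (A.symm w)
    rw [A.apply_symm_apply] at e1 e2 e3
    have hd : dist (A.symm w) x < ε := e1 ▸ hw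
    have hmem := (hE.mem_left _ hd).2 (e3 ▸ hwn)
    have := hE.chart_left _ hmem hd
    rw [A.apply_symm_apply] at this
    rw [← this, hQ _ _ hmem, e2]
  have hdown : ∀ w : E2, ‖w‖ < ε → inner ℝ w n ≤ 0 → f (φ w) = ‖w - α'‖ ^ 2 + b p'.1 := by
    intro w hw hwn
    obtain ⟨e1, e2, e3⟩ := aux _ p'.2 A' x' hE.map_right hx' (A'.symm w)
    rw [A'.apply_symm_apply] at e1 e2 e3
    rw [hE.normal, inner_neg_right] at e3
    have hd : dist (A'.symm w) x' < ε := e1 ▸ hw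
    have hmem := (hE.mem_right _ hd).2 (by rw [e3]; linarith)
    have := hE.chart_right _ hmem hd
    rw [A'.apply_symm_apply] at this
    rw [← this, hQ _ _ hmem, e2]
  obtain ⟨h1, h2⟩ := qFunctions_across_line hE.pos hn
    (fun w hw hwn => (hup w hw hwn.ge).symm.trans (hdown w hw hwn.le))
  rw [hα, hα'] at h2
  have h3 : ‖α'‖ ^ 2 = ‖α‖ ^ 2 + height (T.corner p'.1) p'.2 (a p'.1) ^ 2 -
      height (T.corner p.1) p.2 (a p.1) ^ 2 := by
    rw [h2, norm_add_sq_real, inner_smul_right, hα, norm_smul, mul_pow, hn, Real.norm_eq_abs,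
      sq_abs]
    ring
  refine ⟨by linarith, ε, hE.pos, φ, n, α, hE.flat, hn, fun w hw => ?_⟩
  rcases le_total 0 (inner ℝ w n) with h | h
  · rw [hup w hw h, min_eq_right h]; ring
  · rw [hdown w hw h, min_eq_left h, norm_sub_sq_real, norm_sub_sq_real]
    have : inner ℝ w α' = inner ℝ w α + (-height (T.corner p'.1) p'.2 (a p'.1) -
        height (T.corner p.1) p.2 (a p.1)) * inner ℝ w n := by
      conv_lhs => rw [h2]
      rw [inner_add_right, inner_smul_right]
    rw [this]
    linarith

end Metric

/-! ### Q-concavity and the sign of the jumps -/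

/-- A continuous function with nonpositive small second differences is concave. -/
theorem concaveOn_of_locally_midpoint {g : ℝ → ℝ} {L : ℝ} (hc : ContinuousOn g (Set.Icc 0 L))
    (h : ∀ s ∈ Set.Ioo 0 L, ∃ ε > 0, ∀ d, 0 < d → d < ε → g (s - d) + g (s + d) ≤ 2 * g s) :
    ConcaveOn ℝ (Set.Icc 0 L) g := by
  refine LinearOrder.concaveOn_of_lt (convex_Icc 0 L) fun x hx y hy hxy α β hα hβ hαβ => ?_
  by_contra hcon
  push Not at hcon
  set ℓ : ℝ → ℝ := fun z => g x + (g y - g x) / (y - x) * (z - x) with hℓ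
  have hyx : y - x ≠ 0 := by linarith
  have hℓx : ℓ x = g x := by simp [hℓ]
  have hℓy : ℓ y = g y := by simp only [hℓ]; field_simp; ring
  have hsub : Set.Icc x y ⊆ Set.Icc 0 L := Set.Icc_subset_Icc hx.1 hy.2
  have hdc : ContinuousOn (fun z => g z - ℓ z) (Set.Icc x y) :=
    (hc.mono hsub).sub (by simp only [hℓ]; fun_prop)
  obtain ⟨m, hm, hmin⟩ := isCompact_Icc.exists_isMinOn (Set.nonempty_Icc.2 hxy.le) hdc
  have hneg : g m - ℓ m < 0 := by
    have hz : α • x + β • y ∈ Set.Icc x y := by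
      have : α = 1 - β := by linarith
      subst this
      simp only [smul_eq_mul]
      constructor <;> nlinarith
    have h1 := hmin hz
    simp only [Set.mem_ofPred_eq] at h1
    have h2 : ℓ (α • x + β • y) = α * g x + β * g y := by
      have : α = 1 - β := by linarith
      subst this
      simp only [hℓ, smul_eq_mul]
      field_simp
      ring
    simp only [smul_eq_mul] at hcon h1 h2
    linarith
  set S := Set.Icc x y ∩ (fun z => g z - ℓ z) ⁻¹' {g m - ℓ m}
  have hS : IsCompact S := isCompact_Icc.of_isClosed_subset
    (hdc.preimage_isClosed_of_isClosed isClosed_Icc isClosed_singleton) Set.inter_subset_left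
  -- If `g` drops below its chord `ℓ`, then `g - ℓ` has a negative minimum; `p` is the leftmost
  -- minimum point. The second difference at `p` forces `p - d` to be a minimum point too.
  obtain ⟨p, ⟨hp, hpm⟩, hpmin⟩ := hS.exists_isLeast ⟨m, hm, rfl⟩
  simp only [Set.mem_preimage, Set.mem_singleton_iff] at hpm
  have hpx : x < p := hp.1.lt_of_ne (by rintro rfl; rw [hℓx] at hpm; linarith)
  have hpy : p < y := hp.2.lt_of_ne (by rintro rfl; rw [hℓy] at hpm; linarith)
  obtain ⟨ε, hε, H⟩ := h p ⟨hx.1.trans_lt hpx, hpy.trans_le hy.2⟩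
  obtain ⟨d, hd0, hd⟩ := exists_between (lt_min hε (lt_min (sub_pos.2 hpx) (sub_pos.2 hpy)))
  have hd1 := hd.trans_le (min_le_left _ _)
  have hd2 := hd.trans_le ((min_le_right _ _).trans (min_le_left _ _))
  have hd3 := hd.trans_le ((min_le_right _ _).trans (min_le_right _ _))
  have h1 := H d hd0 hd1
  have hl : p - d ∈ Set.Icc x y := ⟨by linarith, by linarith⟩
  have hr : p + d ∈ Set.Icc x y := ⟨by linarith, by linarith⟩
  have h2 := hmin hl
  have h3 := hmin hr
  simp only [Set.mem_ofPred_eq] at h2 h3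
  have h4 : ℓ (p - d) + ℓ (p + d) = 2 * ℓ p := by simp only [hℓ]; ring
  have h5 : p ≤ p - d := hpmin ⟨hl, by
    simp only [Set.mem_preimage, Set.mem_singleton_iff]; linarith⟩
  linarith

section Metric
variable {M : Type*} [MetricSpace M]

theorem IsGeodesicArc.continuousOn {γ : ℝ → M} {L : ℝ} (h : IsGeodesicArc γ L) :
    ContinuousOn γ (Set.Icc 0 L) := by
  intro s hs
  obtain ⟨ε, hε, H⟩ := h s hs
  rw [Metric.continuousWithinAt_iff]
  intro δ hδ
  refine ⟨min ε δ, lt_min hε hδ, fun {u} hu hd => ?_⟩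
  rw [H u hu s hs (hd.trans_le (min_le_left _ _)) (by simpa using hε)]
  exact hd.trans_le (min_le_right _ _)

variable {T : GeodesicTriangulation M} {f : M → ℝ} {a : Fin T.numFaces → E2}
  {b : Fin T.numFaces → ℝ}

theorem IsQData.interior_formula (hQ : IsQData T f a b) {t : Fin T.numFaces} {x : E2}
    (hx : x ∈ interior (T.face t)) : ∃ ε > 0, ∃ φ α, IsFlatChart (T.chart t x) ε φ ∧
      ∀ w : E2, ‖w‖ < ε → f (φ w) = ‖w - α‖ ^ 2 + b t := by
  have hxf := interior_subset hx
  have hxc : x ∉ Set.range (T.corner t) := by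
    rintro ⟨k, rfl⟩
    have := (mem_interior_triangle_iff (T.corner_indep t) _).1 hx (k + 1)
    rw [((eq_corner_iff (T.corner_indep t) k _).1 rfl).1] at this
    exact this.false
  obtain ⟨ε, hε, φ, hφ⟩ := (T.isRegularPoint_iff hxf).2 hxc
  obtain ⟨A, hA, δ, hδ, H⟩ := T.exists_transition hxf hxc hε hφ
  obtain ⟨η, hη, Hη⟩ := Metric.isOpen_iff.1 isOpen_interior x hx
  refine ⟨min ε (min δ η), lt_min hε (lt_min hδ hη), φ, A (a t),
    hφ.mono (lt_min hε (lt_min hδ hη)) (min_le_left _ _), fun w hw => ?_⟩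
  have hd : dist (A.symm w) x = ‖w‖ := by
    rw [← A.dist_map, A.apply_symm_apply, hA, dist_zero_right]
  have hmem : A.symm w ∈ T.face t := interior_subset (Hη (by
    rw [Metric.mem_ball, hd]; exact hw.trans_le ((min_le_right _ _).trans (min_le_right _ _))))
  have h1 := H _ hmem (by rw [hd]; exact hw.trans_le ((min_le_right _ _).trans (min_le_left _ _)))
  rw [A.apply_symm_apply] at h1
  rw [← h1, hQ _ _ hmem, ← dist_eq_norm, ← A.dist_map, A.apply_symm_apply, dist_eq_norm]

/-- In a flat chart a geodesic is a straight line parametrized by arc length, so after subtracting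
the squared length there remains an affine function plus `2 * J * min (linear) 0`, whose second
differences at the centre are nonpositive. Interior points of triangles are the case `J = 0`. -/
theorem IsQData.isQConcave (hQ : IsQData T f a b) (hf : Continuous f)
    (hJ : ∀ p, 0 ≤ jump T a p) : IsQConcave f := by
  intro L γ hγ hreg
  refine concaveOn_of_locally_midpoint
    ((hf.comp_continuousOn hγ.continuousOn).sub (by fun_prop)) fun s hs => ?_
  -- the local form of `f` at `γ s`
  obtain ⟨ε, hε, φ, n, α, c, J, hJ0, hφ, hform⟩ : ∃ ε > 0, ∃ φ n α, ∃ c J : ℝ, 0 ≤ J ∧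
      IsFlatChart (γ s) ε φ ∧ ∀ w : E2, ‖w‖ < ε →
        f (φ w) = ‖w - α‖ ^ 2 + c + 2 * J * min (inner ℝ w n) 0 := by
    have hr := hreg s hs
    obtain ⟨t, x, hx, he⟩ := T.cover (γ s)
    rcases T.trichotomy hx with hi | ⟨k, hk⟩ | hc
    · obtain ⟨ε, hε, φ, α, hφ, H⟩ := hQ.interior_formula hi
      exact ⟨ε, hε, φ, 0, α, b t, 0, le_rfl, he ▸ hφ, fun w hw => by rw [H w hw]; simp⟩
    · obtain ⟨-, ε, hε, φ, n, α, hφ, -, H⟩ := hQ.edge_formula (t, k) hk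
      exact ⟨ε, hε, φ, n, α, b t, _, hJ (t, k), he ▸ hφ, H⟩
    · exact absurd (he ▸ (T.chart_mem_singularSet t x hx).2 hc) hr
  obtain ⟨δ, hδ, Hδ⟩ := hγ s (Set.Ioo_subset_Icc_self hs)
  set I := Set.Icc 0 L ∩ {u | |u - s| < δ}
  set κ := min (min δ ε) (min s (L - s))
  have hκ : 0 < κ := lt_min (lt_min hδ hε) (lt_min hs.1 (sub_pos.2 hs.2))
  have hκδ : κ ≤ δ := (min_le_left _ _).trans (min_le_left _ _)
  have hκε : κ ≤ ε := (min_le_left _ _).trans (min_le_right _ _)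
  have hκs : κ ≤ s := (min_le_right _ _).trans (min_le_left _ _)
  have hκL : κ ≤ L - s := (min_le_right _ _).trans (min_le_right _ _)
  have hI : ∀ u, |u - s| < κ → u ∈ I ∧ |u - s| < ε := by
    intro u hu
    have := abs_lt.1 hu
    exact ⟨⟨⟨by linarith, by linarith⟩, hu.trans_le hκδ⟩, hu.trans_le hκε⟩
  have h2 : |s + κ / 2 - s| < κ := by
    rw [add_sub_cancel_left, abs_of_pos (half_pos hκ)]; exact half_lt_self hκ
  obtain ⟨e, he, hγe⟩ := hφ.geodesic (I := I) (fun u hu v hv => Hδ u hu.1 v hv.1 hu.2 hv.2)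
    (hI s (by simpa using hκ)).1 rfl (hI _ h2).1 (by linarith) (hI _ h2).2
  have hval : ∀ u, |u - s| < κ → f (γ u) = (u - s) ^ 2 - 2 * (u - s) * inner ℝ e α + ‖α‖ ^ 2 + c +
      2 * J * min ((u - s) * inner ℝ e n) 0 := by
    intro u hu
    rw [hγe u (hI u hu).1 (hI u hu).2, hform, norm_sub_sq_real, norm_smul, he, inner_smul_left,
      inner_smul_left, mul_one, Real.norm_eq_abs, sq_abs]
    · simp only [conj_trivial]; ring
    · rw [norm_smul, he, mul_one]; exact (hI u hu).2
  refine ⟨κ, hκ, fun d hd hdκ => ?_⟩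
  have v0 := hval s (by simpa using hκ)
  have v1 := hval (s - d) (by rw [abs_lt]; constructor <;> linarith)
  have v2 := hval (s + d) (by rw [abs_lt]; constructor <;> linarith)
  simp only [sub_self, zero_mul, min_self] at v0
  have e1 : s - d - s = -d := by ring
  have e2 : s + d - s = d := by ring
  rw [e1] at v1
  rw [e2] at v2
  rw [v0, v1, v2]
  have m1 : min (-d * inner ℝ e n) 0 + min (d * inner ℝ e n) 0 ≤ 0 :=
    add_nonpos (min_le_right _ _) (min_le_right _ _)
  nlinarith [mul_nonneg hJ0 (neg_nonneg.2 m1)]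

/-- Test Q-concavity on a short geodesic crossing the edge at a right angle: its second difference
at the edge is a negative multiple of the jump. -/
theorem IsQData.jump_nonneg (hQ : IsQData T f a b) (hf : IsQConcave f)
    (p : Fin T.numFaces × Fin 3) : 0 ≤ jump T a p := by
  obtain ⟨x, hx⟩ := T.openSide_nonempty p.1 p.2
  obtain ⟨-, ε, hε, φ, n, α, hφ, hn, H⟩ := hQ.edge_formula p hx
  set δ := ε / 2
  have hδ : 0 < δ := half_pos hε
  have hδε : δ < ε := half_lt_self hε
  have hnorm : ∀ u : ℝ, ‖u • n‖ = |u| := fun u => by rw [norm_smul, hn, mul_one, Real.norm_eq_abs]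
  have hin : ∀ u ∈ Set.Icc (0 : ℝ) (2 * δ), (u - δ) • n ∈ Metric.ball (0 : E2) ε := by
    intro u hu
    rw [mem_ball_zero_iff, hnorm, abs_lt]
    constructor <;> linarith [hu.1, hu.2]
  have hg : IsGeodesicArc (fun u => φ ((u - δ) • n)) (2 * δ) := by
    refine fun s hs => ⟨1, one_pos, fun u hu v hv _ _ => ?_⟩
    rw [hφ.isometric _ (hin u hu) _ (hin v hv), dist_eq_norm, ← sub_smul, hnorm,
      sub_sub_sub_cancel_right]
  have hc := hf _ _ hg fun s hs =>
    not_not.2 (hφ.translate (hin s (Set.Ioo_subset_Icc_self hs)))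
  have hmid := hc.2 (Set.left_mem_Icc.2 (by linarith)) (Set.right_mem_Icc.2 (by linarith))
    (one_half_pos (α := ℝ)).le one_half_pos.le (add_halves 1)
  have hval : ∀ u : ℝ, |u| < ε → f (φ (u • n)) = u ^ 2 - 2 * u * inner ℝ n α + ‖α‖ ^ 2 + b p.1 +
      2 * jump T a p * min u 0 := by
    intro u hu
    rw [H _ (by rwa [hnorm]), norm_sub_sq_real, hnorm, sq_abs, inner_smul_left, inner_smul_left,
      real_inner_self_eq_norm_sq, hn]
    simp only [conj_trivial]
    ring_nf
  have e0 : (0 : ℝ) - δ = -δ := by ring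
  have e1 : 2 * δ - δ = δ := by ring
  have e2 : (1 / 2 : ℝ) * 0 + 1 / 2 * (2 * δ) = δ := by ring
  simp only [smul_eq_mul, e0, e1, e2, sub_self] at hmid
  rw [hval (-δ) (by rw [abs_neg, abs_of_pos hδ]; exact hδε),
    hval δ (by rw [abs_of_pos hδ]; exact hδε), hval 0 (by simpa using hε),
    min_eq_left (by linarith : -δ ≤ 0), min_eq_right hδ.le, min_self] at hmid
  by_contra hneg
  push Not at hneg
  nlinarith [mul_pos hδ (neg_pos.2 hneg)]

theorem IsQData.isQConcave_iff (hQ : IsQData T f a b) (hf : Continuous f) :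
    IsQConcave f ↔ ∀ p, 0 ≤ jump T a p :=
  ⟨hQ.jump_nonneg, hQ.isQConcave hf⟩

/-- The chart in which `f` is a Q-function need not be the chart of `edge_formula`, but the
perpendicular to the edge is straight in both. Comparing second differences along it isolates the
jump. The jump belongs to the whole edge, so the answer does not depend on the point. -/
theorem IsQData.isQFunctionNear_iff (hQ : IsQData T f a b) (p : Fin T.numFaces × Fin 3) {x : E2}
    (hx : x ∈ T.side p.1 p.2) : IsQFunctionNear f (T.chart p.1 x) ↔ jump T a p = 0 := by
  obtain ⟨-, ε, hε, φ, n, α, hφ, hn, H⟩ := hQ.edge_formula p hx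
  constructor
  · rintro ⟨ε', hε', φ', hφ', α', c, H'⟩
    have hnorm : ∀ u : ℝ, ‖u • n‖ = |u| := fun u => by
      rw [norm_smul, hn, mul_one, Real.norm_eq_abs]
    set δ := min ε ε' / 2
    have hm : 0 < min ε ε' := lt_min hε hε'
    have hδ : 0 < δ := half_pos hm
    have hδm : δ < min ε ε' := half_lt_self hm
    have hδε : δ < ε := hδm.trans_le (min_le_left _ _)
    have hδε' : δ < ε' := hδm.trans_le (min_le_right _ _)
    obtain ⟨e, he, hγ⟩ := hφ'.geodesic (γ := fun u => φ (u • n)) (I := {u | |u| < ε})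
      (fun u hu v hv => by
        rw [hφ.isometric _ (by rw [mem_ball_zero_iff, hnorm]; exact hu) _
          (by rw [mem_ball_zero_iff, hnorm]; exact hv), dist_eq_norm, ← sub_smul, hnorm])
      (s := 0) (by simpa using hε) (by simp [hφ.center]) (u₁ := δ)
      (by simp [abs_of_pos hδ, hδε]) hδ.ne' (by simp [abs_of_pos hδ, hδε'])
    simp only [sub_zero, Set.mem_ofPred_eq] at hγ
    have hval : ∀ u : ℝ, |u| < ε → f (φ (u • n)) = u ^ 2 - 2 * u * inner ℝ n α + ‖α‖ ^ 2 + b p.1 +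
        2 * jump T a p * min u 0 := by
      intro u hu
      rw [H _ (by rwa [hnorm]), norm_sub_sq_real, hnorm, sq_abs, inner_smul_left, inner_smul_left,
        real_inner_self_eq_norm_sq, hn]
      simp only [conj_trivial]
      ring_nf
    have hval' : ∀ u : ℝ, |u| < ε → |u| < ε' →
        f (φ (u • n)) = u ^ 2 - 2 * u * inner ℝ e α' + ‖α'‖ ^ 2 + c := by
      intro u hu hu'
      rw [hγ u hu hu']
      refine (H' _ (by rw [mem_ball_zero_iff, norm_smul, he, mul_one]; exact hu')).trans ?_
      rw [norm_sub_sq_real, norm_smul, he, mul_one, Real.norm_eq_abs, sq_abs, inner_smul_left]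
      simp only [conj_trivial]
      ring
    have a1 : |δ| < ε := by rwa [abs_of_pos hδ]
    have a1' : |δ| < ε' := by rwa [abs_of_pos hδ]
    have a2 : |-δ| < ε := by rwa [abs_neg]
    have a2' : |-δ| < ε' := by rwa [abs_neg]
    have v0 := (hval 0 (by simpa)).symm.trans (hval' 0 (by simpa) (by simpa))
    have v1 := (hval δ a1).symm.trans (hval' δ a1 a1')
    have v2 := (hval (-δ) a2).symm.trans (hval' (-δ) a2 a2')
    rw [min_self] at v0
    rw [min_eq_right hδ.le] at v1
    rw [min_eq_left (by linarith : -δ ≤ 0)] at v2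
    have : jump T a p * δ = 0 := by linarith
    exact (mul_eq_zero.1 this).resolve_right hδ.ne'
  · intro hJ
    refine ⟨ε, hε, φ, hφ, α, b p.1, fun w hw => ?_⟩
    refine (H w (mem_ball_zero_iff.1 hw)).trans ?_
    rw [hJ]
    ring

/-! ### Dihedral angles -/

theorem inner_lift (x y : E2) : inner ℝ (lift x) (lift y) = inner ℝ x y := by
  simp [lift, PiLp.inner_apply, Fin.sum_univ_three, Fin.sum_univ_two]

theorem lift_sub (x y : E2) : lift (x - y) = lift x - lift y := by
  ext i; fin_cases i <;> simp [lift]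

theorem lift_smul (s : ℝ) (x : E2) : lift (s • x) = s • lift x := by
  ext i; fin_cases i <;> simp [lift]

theorem arccos_add_arccos_le_pi_iff {x y : ℝ} (hx : |x| ≤ 1) (hy : |y| ≤ 1) :
    Real.arccos x + Real.arccos y ≤ π ↔ 0 ≤ x + y := by
  have e : Real.arccos x + Real.arccos y ≤ π ↔ Real.arccos y ≤ Real.arccos (-x) := by
    rw [Real.arccos_neg]; constructor <;> intro h <;> linarith
  rw [e]
  rw [abs_le] at hx hy
  rw [Real.strictAntiOn_arccos.le_iff_ge ⟨hy.1, hy.2⟩ ⟨by linarith, by linarith⟩]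
  constructor <;> intro h <;> linarith

namespace Couple
variable (C : Couple M)

/-- In the plane orthogonal to the side, the base points along the inner normal, and the apex has
coordinates given by the signed distance of its foot from the side and by its altitude. -/
theorem dihedralAngle_eq (t : Fin C.T.numFaces) (k : Fin 3) :
    C.dihedralAngle t k = Real.arccos (height (C.T.corner t) k (C.foot t) /
      √(height (C.T.corner t) k (C.foot t) ^ 2 + C.apex t 2 ^ 2)) := by
  have hind := C.T.corner_indep t
  set c := C.T.corner t
  set e₃ : E3 := !₂[0, 0, 1]
  set ν := height c k (C.foot t) with hν
  have h1 : perpPart (lift (c (k + 2)) - lift (c (k + 1))) (lift (c k) - lift (c (k + 1))) =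
      lift (altVec c k) := by
    rw [perpPart, ← lift_sub, ← lift_sub, inner_lift, inner_lift, ← lift_smul, ← lift_sub]
    rfl
  have h2 : perpPart (lift (c (k + 2)) - lift (c (k + 1))) (C.apex t - lift (c (k + 1))) =
      lift (ν • triNormal c k) + C.apex t 2 • e₃ := by
    have ha : C.apex t - lift (c (k + 1)) = lift (C.foot t - c (k + 1)) + C.apex t 2 • e₃ := by
      ext i; fin_cases i <;> simp [lift, foot, e₃]
    have h3 : ∀ y, inner ℝ (lift y) e₃ = 0 := fun y => by
      simp [lift, e₃, PiLp.inner_apply, Fin.sum_univ_three]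
    rw [ha, perpPart, ← lift_sub, ← sideVec, inner_add_right, inner_lift, inner_smul_right, h3,
      inner_lift, mul_zero, add_zero, ← lift_smul, add_sub_right_comm, ← lift_sub]
    congr 2
    have hd := eq_of_orthonormal (norm_sideDir hind k) (norm_triNormal hind k)
      (inner_sideDir_triNormal hind k) (C.foot t - c (k + 1))
    have hs := (norm_sideVec_pos hind k).ne'
    have hp : inner ℝ (sideDir c k) (C.foot t - c (k + 1)) • sideDir c k =
        (inner ℝ (sideVec c k) (C.foot t - c (k + 1)) / inner ℝ (sideVec c k) (sideVec c k)) •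
          sideVec c k := by
      rw [sideDir, inner_smul_left, real_inner_self_eq_norm_sq, smul_smul]
      congr 1
      simp only [conj_trivial]
      field_simp
    rw [← hp]
    rw [sub_eq_iff_eq_add', hν, height, real_inner_comm (triNormal c k)]
    exact hd
  have hn := norm_triNormal hind k
  have hA := norm_altVec_pos hind k
  have hl : ∀ y, ‖lift y‖ = ‖y‖ := fun y => by
    rw [← sq_eq_sq₀ (norm_nonneg _) (norm_nonneg _), ← real_inner_self_eq_norm_sq, inner_lift,
      real_inner_self_eq_norm_sq]
  have h3 : ∀ y, inner ℝ (lift y) e₃ = 0 := fun y => by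
    simp [lift, e₃, PiLp.inner_apply, Fin.sum_univ_three]
  have he : ‖e₃‖ = 1 := by simp [e₃, EuclideanSpace.norm_eq, Fin.sum_univ_three]
  have hnorm : ‖lift (ν • triNormal c k) + C.apex t 2 • e₃‖ = √(ν ^ 2 + C.apex t 2 ^ 2) := by
    rw [← Real.sqrt_sq (norm_nonneg (lift (ν • triNormal c k) + C.apex t 2 • e₃)),
      norm_add_sq_real, hl, norm_smul, norm_smul, hn, he, inner_smul_right, h3]
    simp
  change InnerProductGeometry.angle
    (perpPart (lift (c (k + 2)) - lift (c (k + 1))) (lift (c k) - lift (c (k + 1))))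
    (perpPart (lift (c (k + 2)) - lift (c (k + 1))) (C.apex t - lift (c (k + 1)))) = _
  rw [h1, h2, InnerProductGeometry.angle, hnorm, hl, inner_add_right, inner_lift, inner_smul_right,
    inner_smul_right, h3, mul_zero, add_zero]
  have : inner ℝ (altVec c k) (triNormal c k) = ‖altVec c k‖ := by
    rw [triNormal, inner_smul_right, real_inner_self_eq_norm_sq]; field_simp
  rw [this]
  congr 1
  rw [mul_comm, mul_div_mul_left _ _ hA.ne']

theorem boundaryAngle_eq (p : Fin C.T.numFaces × Fin 3) :
    C.boundaryAngle (C.T.openSide p.1 p.2) =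
      C.dihedralAngle p.1 p.2 + C.dihedralAngle (C.T.partner p).1 (C.T.partner p).2 := by
  classical
  unfold boundaryAngle
  rw [← Finset.sum_filter,
    ← Finset.sum_pair (f := fun p : Fin C.T.numFaces × Fin 3 => C.dihedralAngle p.1 p.2)
      (C.T.partner_ne p).symm]
  refine Finset.sum_congr ?_ fun _ _ => rfl
  ext p''
  simp [C.T.openSide_eq_iff]

/-- The denominators in the two cosines at an edge coincide by `edge_formula`, so the sum of the
cosines is the jump divided by their common value `R`. The sum of two arccosines is at most `π`
exactly when the sum of the cosines is nonnegative. -/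
theorem hasConvexBoundary_iff : C.HasConvexBoundary ↔ ∀ p, 0 ≤ jump C.T C.foot p := by
  have key : ∀ p, C.boundaryAngle (C.T.openSide p.1 p.2) ≤ π ↔ 0 ≤ jump C.T C.foot p := by
    intro p
    obtain ⟨x, hx⟩ := C.T.openSide_nonempty p.1 p.2
    have hR := (C.isQData_sqDist.edge_formula p hx).1
    simp only at hR
    rw [boundaryAngle_eq, dihedralAngle_eq, dihedralAngle_eq, ← hR, jump]
    set R := √(height (C.T.corner p.1) p.2 (C.foot p.1) ^ 2 + C.apex p.1 2 ^ 2) with hRdef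
    have hh := C.apex_height p.1
    have hRpos : 0 < R := Real.sqrt_pos.2 (by positivity)
    rw [arccos_add_arccos_le_pi_iff, ← add_div, div_nonneg_iff]
    · constructor
      · rintro (h | h)
        · exact h.1
        · linarith [h.2]
      · exact fun h => Or.inl ⟨h, hRpos.le⟩
    · rw [abs_div, abs_of_pos hRpos, div_le_one hRpos]
      exact Real.abs_le_sqrt (by nlinarith [sq_nonneg (C.apex p.1 2)])
    · rw [abs_div, abs_of_pos hRpos, div_le_one hRpos, hRdef, hR]
      exact Real.abs_le_sqrt (by nlinarith [sq_nonneg (C.apex (C.T.partner p).1 2)])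
  constructor
  · exact fun h p => (key p).1 (h _ ⟨p.1, p.2, rfl⟩)
  · rintro h E ⟨t, k, rfl⟩
    exact (key (t, k)).2 (h (t, k))

theorem isQConcave_iff : IsQConcave C.sqDist ↔ C.HasConvexBoundary := by
  rw [hasConvexBoundary_iff, C.isQData_sqDist.isQConcave_iff C.isPQExtension_sqDist.1]

end Couple
end Metric

/-! ### Minimality and uniqueness of Q-concave PQ-extensions -/

theorem height_lineMap (c : Fin 3 → E2) (k : Fin 3) (y z : E2) (s : ℝ) :
    height c k (AffineMap.lineMap y z s) = (1 - s) * height c k y + s * height c k z := by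
  have : AffineMap.lineMap y z s - c (k + 1) =
      (1 - s) • (y - c (k + 1)) + s • (z - c (k + 1)) := by
    rw [AffineMap.lineMap_apply_module]; module
  rw [height, this, inner_add_left, inner_smul_left, inner_smul_left]; rfl

/-- The corners of a triangle are extreme points. -/
theorem lineMap_notMem_corners {c : Fin 3 → E2} (h : AffineIndependent ℝ c) {y z : E2}
    (hy : y ∈ convexHull ℝ (Set.range c)) (hz : z ∈ convexHull ℝ (Set.range c)) (hyz : y ≠ z)
    {s : ℝ} (hs : s ∈ Set.Ioo (0 : ℝ) 1) : AffineMap.lineMap y z s ∉ Set.range c := by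
  rintro ⟨j, hj⟩
  rw [mem_triangle_iff h] at hy hz
  obtain ⟨h1, h2⟩ := (eq_corner_iff h j _).1 hj.symm
  rw [height_lineMap] at h1 h2
  have hs0 := hs.1
  have hs1 : 0 < 1 - s := sub_pos.2 hs.2
  have aux : ∀ k, (1 - s) * height c k y + s * height c k z = 0 →
      height c k y = 0 ∧ height c k z = 0 := by
    intro k hk
    have p1 := mul_nonneg hs1.le (hy k)
    have p2 := mul_nonneg hs0.le (hz k)
    exact ⟨(mul_eq_zero.1 (by linarith : (1 - s) * height c k y = 0)).resolve_left hs1.ne',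
      (mul_eq_zero.1 (by linarith : s * height c k z = 0)).resolve_left hs0.ne'⟩
  obtain ⟨a1, a2⟩ := aux _ h1
  obtain ⟨b1, b2⟩ := aux _ h2
  exact hyz (((eq_corner_iff h j y).2 ⟨a1, b1⟩).trans ((eq_corner_iff h j z).2 ⟨a2, b2⟩).symm)

section Metric
variable {M : Type*} [MetricSpace M]
variable {T : GeodesicTriangulation M} {f g : M → ℝ} {a : Fin T.numFaces → E2}
  {b : Fin T.numFaces → ℝ}

open AffineMap in
/-- Q-concavity along the segments of a triangle. -/
theorem IsQConcave.concaveOn_lineMap (hg : IsQConcave g) (hgc : Continuous g) {t : Fin T.numFaces}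
    {y z : E2} (hy : y ∈ T.face t) (hz : z ∈ T.face t) (hyz : y ≠ z) :
    ConcaveOn ℝ (Set.Icc 0 1)
      (fun u => g (T.chart t (lineMap y z u)) - u ^ 2 * ‖z - y‖ ^ 2) := by
  have hface : ∀ u ∈ Set.Icc (0 : ℝ) 1, lineMap y z u ∈ T.face t := fun u hu =>
    (T.convex_face t).lineMap_mem hy hz hu
  have hreg : ∀ u ∈ Set.Ioo (0 : ℝ) 1, lineMap y z u ∉ Set.range (T.corner t) := fun u hu =>
    lineMap_notMem_corners (T.corner_indep t) hy hz hyz hu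
  set ℓ := ‖z - y‖ with hℓ
  have hℓ0 : 0 < ℓ := norm_pos_iff.2 (sub_ne_zero.2 hyz.symm)
  have hdist : ∀ u v : ℝ, dist (lineMap y z u) (lineMap y z v) = |u - v| * ℓ := fun u v => by
    rw [dist_lineMap_lineMap, dist_comm y z, dist_eq_norm z y, Real.dist_eq]
  refine concaveOn_of_locally_midpoint ?_ fun s hs => ?_
  · refine ContinuousOn.sub (hgc.comp_continuousOn ?_) (by fun_prop)
    exact (T.chart_continuousOn t).comp lineMap_continuous.continuousOn hface
  obtain ⟨ε, hε, H⟩ := T.chart_isometric t _ ⟨hface s (Set.Ioo_subset_Icc_self hs), hreg s hs⟩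
  refine ⟨min (min s (1 - s)) (ε / ℓ),
    lt_min (lt_min hs.1 (sub_pos.2 hs.2)) (div_pos hε hℓ0), fun d hd hdlt => ?_⟩
  have d1 : d < s := hdlt.trans_le ((min_le_left _ _).trans (min_le_left _ _))
  have d2 : d < 1 - s := hdlt.trans_le ((min_le_left _ _).trans (min_le_right _ _))
  have d3 : d * ℓ < ε := (lt_div_iff₀ hℓ0).1 (hdlt.trans_le (min_le_right _ _))
  -- Arc-length parametrization of the piece of the segment between the parameters `s - d` and `s +
  -- d`, short enough for the chart to be isometric on it.
  set θ : ℝ → ℝ := fun r => s + (r / ℓ - d) with hθ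
  have hθr : ∀ r ∈ Set.Icc 0 (2 * (d * ℓ)), |θ r - s| ≤ d := by
    intro r hr
    have h1 : 0 ≤ r / ℓ := div_nonneg hr.1 hℓ0.le
    have h2 : r / ℓ ≤ 2 * d := by rw [div_le_iff₀ hℓ0]; linarith [hr.2]
    rw [hθ, add_sub_cancel_left, abs_le]
    constructor <;> linarith
  have hθI : ∀ r ∈ Set.Icc 0 (2 * (d * ℓ)), θ r ∈ Set.Ioo (0 : ℝ) 1 := by
    intro r hr
    have := abs_le.1 (hθr r hr)
    constructor <;> linarith
  have hball : ∀ r ∈ Set.Icc 0 (2 * (d * ℓ)),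
      lineMap y z (θ r) ∈ convexHull ℝ (Set.range (T.corner t)) ∩ Metric.ball (lineMap y z s) ε := by
    intro r hr
    refine ⟨hface _ (Set.Ioo_subset_Icc_self (hθI r hr)), ?_⟩
    rw [Metric.mem_ball, hdist]
    exact (mul_le_mul_of_nonneg_right (hθr r hr) hℓ0.le).trans_lt d3
  have harc : IsGeodesicArc (fun r => T.chart t (lineMap y z (θ r))) (2 * (d * ℓ)) := by
    refine fun r _ => ⟨1, one_pos, fun u hu v hv _ _ => ?_⟩
    rw [H _ (hball u hu) _ (hball v hv), hdist, hθ]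
    simp only
    rw [← abs_of_pos hℓ0, ← abs_mul, abs_of_pos hℓ0]
    congr 1
    field_simp
    ring
  have hdl : 0 < d * ℓ := mul_pos hd hℓ0
  have hc := hg _ _ harc fun r hr => by
    rw [T.chart_mem_singularSet t _ (hball r (Set.Ioo_subset_Icc_self hr)).1]
    exact hreg _ (hθI r (Set.Ioo_subset_Icc_self hr))
  have hmid := hc.2 (Set.left_mem_Icc.2 (by linarith)) (Set.right_mem_Icc.2 (by linarith))
    (one_half_pos (α := ℝ)).le one_half_pos.le (add_halves 1)
  have e0 : θ 0 = s - d := by simp only [hθ]; ring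
  have e1 : θ (2 * (d * ℓ)) = s + d := by simp only [hθ]; field_simp; ring
  have e2 : (1 / 2 : ℝ) * 0 + 1 / 2 * (2 * (d * ℓ)) = d * ℓ := by ring
  have e3 : θ (d * ℓ) = s := by simp only [hθ]; field_simp; ring
  simp only [smul_eq_mul, e0, e1, e2, e3] at hmid
  linarith

/-- A PQ-function is the smallest Q-concave function with the given values at the vertices. -/
theorem IsPQExtension.le_of_isQConcave {q : singularSet M → ℝ} (hf : IsPQExtension T q f)
    (hgc : Continuous g) (hg : IsQConcave g) (hq : ∀ i : singularSet M, g i = q i) (m : M) :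
    f m ≤ g m := by
  obtain ⟨a, b, hQ⟩ := hf.exists_qData
  -- Along a segment `f` attains equality in the concavity inequality that `g` satisfies, so `f ≤ g`
  -- passes from the ends to the segment. This is used twice: on the side opposite to corner `0`,
  -- then on segments from that corner.
  have seg : ∀ t, ∀ y ∈ T.face t, ∀ z ∈ T.face t, f (T.chart t y) ≤ g (T.chart t y) →
      f (T.chart t z) ≤ g (T.chart t z) → ∀ x ∈ segment ℝ y z,
      f (T.chart t x) ≤ g (T.chart t x) := by
    intro t y hy z hz h1 h2 x hx
    by_cases hyz : y = z
    · subst hyz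
      rw [segment_same] at hx
      rw [hx]; exact h1
    rw [segment_eq_image_lineMap] at hx
    obtain ⟨s, hs, rfl⟩ := hx
    have hc := (hg.concaveOn_lineMap hgc hy hz hyz).2 (Set.left_mem_Icc.2 zero_le_one)
      (Set.right_mem_Icc.2 zero_le_one) (sub_nonneg.2 hs.2) hs.1 (sub_add_cancel 1 s)
    simp only [smul_eq_mul, AffineMap.lineMap_apply_zero, AffineMap.lineMap_apply_one, mul_zero,
      mul_one, zero_add] at hc
    rw [hQ t _ ((T.convex_face t).lineMap_mem hy hz hs), quad_lineMap, ← hQ t y hy, ← hQ t z hz]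
    nlinarith [mul_le_mul_of_nonneg_left h1 (sub_nonneg.2 hs.2),
      mul_le_mul_of_nonneg_left h2 hs.1]
  obtain ⟨t, x, hx, rfl⟩ := T.cover m
  have hcorner : ∀ k, f (T.chart t (T.corner t k)) ≤ g (T.chart t (T.corner t k)) := fun k =>
    ((hf.2.2 (T.vertex t k)).trans (hq (T.vertex t k)).symm).le
  have hr : Set.range (T.corner t) = insert (T.corner t 0) {T.corner t 1, T.corner t 2} := by
    ext y; simp [Fin.exists_fin_succ, eq_comm]
  rw [hr, convexHull_insert ⟨_, Set.mem_insert _ _⟩, convexHull_pair, mem_convexJoin] at hx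
  obtain ⟨_, rfl, z, hz, hx⟩ := hx
  have hzf : z ∈ T.face t :=
    (T.convex_face t).segment_subset (T.corner_mem_face t 1) (T.corner_mem_face t 2) hz
  exact seg t _ (T.corner_mem_face t 0) z hzf (hcorner 0)
    (seg t _ (T.corner_mem_face t 1) _ (T.corner_mem_face t 2) (hcorner 1) (hcorner 2) z hz) x hx

/-- The Q-concave PQ-extension is determined by the values at the vertices. -/
theorem IsPQExtension.eq_of_isQConcave {T' : GeodesicTriangulation M} {q : singularSet M → ℝ}
    (hf : IsPQExtension T q f) (hfc : IsQConcave f) (hg : IsPQExtension T' q g)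
    (hgc : IsQConcave g) : f = g :=
  funext fun m => le_antisymm (hf.le_of_isQConcave hg.1 hgc hg.2.2 m)
    (hg.le_of_isQConcave hf.1 hfc hf.2.2 m)

/-! ### Essential edges -/

theorem IsQData.mem_essentialEdges_iff (hQ : IsQData T f a b) (E : Set M) :
    E ∈ essentialEdges T f ↔ ∃ p, E = T.openSide p.1 p.2 ∧ jump T a p ≠ 0 := by
  constructor
  · rintro ⟨⟨t, k, rfl⟩, h⟩
    refine ⟨(t, k), rfl, fun hJ => h ?_⟩
    rintro _ ⟨x, hx, rfl⟩
    exact (hQ.isQFunctionNear_iff (t, k) hx).2 hJ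
  · rintro ⟨p, rfl, hJ⟩
    refine ⟨⟨p.1, p.2, rfl⟩, fun h => hJ ?_⟩
    obtain ⟨x, hx⟩ := T.openSide_nonempty p.1 p.2
    exact (hQ.isQFunctionNear_iff p hx).1 (h _ ⟨x, hx, rfl⟩)

namespace GeodesicTriangulation
variable (T)

theorem isRegularPoint_of_mem_openSide {t : Fin T.numFaces} {k : Fin 3} {m : M}
    (hm : m ∈ T.openSide t k) : IsRegularPoint m := by
  obtain ⟨x, hx, rfl⟩ := hm
  exact (T.isRegularPoint_iff (T.side_subset t k hx)).2 (T.notMem_range_of_mem_side hx)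

/-- The edge with its endpoints. -/
def closedSide (t : Fin T.numFaces) (k : Fin 3) : Set M :=
  T.chart t '' segment ℝ (T.corner t (k + 1)) (T.corner t (k + 2))

theorem isClosed_closedSide (t : Fin T.numFaces) (k : Fin 3) : IsClosed (T.closedSide t k) := by
  have hc : IsCompact (segment ℝ (T.corner t (k + 1)) (T.corner t (k + 2))) := by
    rw [← convexHull_pair]
    exact (Set.toFinite _).isCompact_convexHull (𝕜 := ℝ)
  exact (hc.image_of_continuousOn ((T.chart_continuousOn t).mono
    (segment_subset_convexHull ⟨_, rfl⟩ ⟨_, rfl⟩))).isClosed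

theorem openSide_subset_closedSide (t : Fin T.numFaces) (k : Fin 3) :
    T.openSide t k ⊆ T.closedSide t k := Set.image_mono (openSegment_subset_segment ..)

theorem mem_openSide_of_isRegularPoint {t : Fin T.numFaces} {k : Fin 3} {m : M}
    (hm : m ∈ T.closedSide t k) (hr : IsRegularPoint m) : m ∈ T.openSide t k := by
  obtain ⟨x, hx, rfl⟩ := hm
  have hxf : x ∈ T.face t :=
    (T.convex_face t).segment_subset (T.corner_mem_face t _) (T.corner_mem_face t _) hx
  rw [T.isRegularPoint_iff hxf] at hr
  exact ⟨x, mem_openSegment_of_ne_left_right (fun e => hr ⟨_, e⟩) (fun e => hr ⟨_, e⟩) hx, rfl⟩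

theorem openSide_eq_of_mem_of_mem {t t' : Fin T.numFaces} {k k' : Fin 3} {m : M}
    (hm : m ∈ T.openSide t k) (hm' : m ∈ T.openSide t' k') :
    T.openSide t k = T.openSide t' k' :=
  (T.side_eq_or_disjoint t t' k k').resolve_right fun h => Set.disjoint_left.1 h hm hm'

theorem isPreconnected_openSide (t : Fin T.numFaces) (k : Fin 3) :
    IsPreconnected (T.openSide t k) :=
  (convex_openSegment _ _).isPreconnected.image _
    ((T.chart_continuousOn t).mono (T.side_subset t k))

end GeodesicTriangulation

/-- Near no point of an essential edge is `f` a Q-function, so in the other triangulation such a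
point lies neither inside a triangle nor on an inessential edge. The open edge is thus covered by
finitely many essential edges of `T'`; these are disjoint and relatively closed in the regular part,
so by connectedness one of them contains it. -/
theorem IsQData.essentialEdge_subset {T' : GeodesicTriangulation M} {a' : Fin T'.numFaces → E2}
    {b' : Fin T'.numFaces → ℝ} (hQ : IsQData T f a b) (hQ' : IsQData T' f a' b') {E : Set M}
    (hE : E ∈ essentialEdges T f) : ∃ E' ∈ essentialEdges T' f, E ⊆ E' := by
  obtain ⟨p, rfl, hJ⟩ := (hQ.mem_essentialEdges_iff E).1 hE
  have hcov : ∀ m ∈ T.openSide p.1 p.2, ∃ p', jump T' a' p' ≠ 0 ∧ m ∈ T'.openSide p'.1 p'.2 := by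
    rintro m hm
    have hr := T.isRegularPoint_of_mem_openSide hm
    obtain ⟨x, hx, rfl⟩ := hm
    have hnear : ¬ IsQFunctionNear f (T.chart p.1 x) := fun h =>
      hJ ((hQ.isQFunctionNear_iff p hx).1 h)
    obtain ⟨t', x', hx', he⟩ := T'.cover (T.chart p.1 x)
    rw [← he] at hr hnear ⊢
    rcases T'.trichotomy hx' with hi | ⟨k, hk⟩ | hc
    · obtain ⟨ε, hε, φ, α, hφ, H⟩ := hQ'.interior_formula hi
      exact absurd ⟨ε, hε, φ, hφ, α, b' t', fun w hw => H w (mem_ball_zero_iff.1 hw)⟩ hnear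
    · exact ⟨(t', k), fun h => hnear ((hQ'.isQFunctionNear_iff (t', k) hk).2 h), x', hk, rfl⟩
    · exact absurd hc ((T'.isRegularPoint_iff hx').1 hr)
  obtain ⟨x₀, hx₀⟩ := T.openSide_nonempty p.1 p.2
  have hm₀ : T.chart p.1 x₀ ∈ T.openSide p.1 p.2 := ⟨x₀, hx₀, rfl⟩
  obtain ⟨p', hJ', hp'⟩ := hcov _ hm₀
  refine ⟨_, (hQ'.mem_essentialEdges_iff _).2 ⟨p', rfl, hJ'⟩, ?_⟩
  set v := ⋃ p'' ∈ {p'' : Fin T'.numFaces × Fin 3 |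
    T'.openSide p''.1 p''.2 ≠ T'.openSide p'.1 p'.2}, T'.closedSide p''.1 p''.2
  have hv : IsClosed v := (Set.toFinite _).isClosed_biUnion fun _ _ => T'.isClosed_closedSide _ _
  have hvm : ∀ m, IsRegularPoint m → m ∈ v → m ∉ T'.openSide p'.1 p'.2 := by
    intro m hr hm hm'
    simp only [v, Set.mem_iUnion] at hm
    obtain ⟨p'', hne, hm⟩ := hm
    exact hne (T'.openSide_eq_of_mem_of_mem (T'.mem_openSide_of_isRegularPoint hm hr) hm')
  have hpre := isPreconnected_iff_subset_of_disjoint_closed.1 (T.isPreconnected_openSide p.1 p.2)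
    _ v (T'.isClosed_closedSide p'.1 p'.2) hv ?_ ?_
  · rcases hpre with h | h
    · exact fun m hm => T'.mem_openSide_of_isRegularPoint (h hm)
        (T.isRegularPoint_of_mem_openSide hm)
    · exact absurd hp' (hvm _ (T.isRegularPoint_of_mem_openSide hm₀) (h hm₀))
  · intro m hm
    obtain ⟨p'', -, hp''⟩ := hcov m hm
    by_cases he : T'.openSide p''.1 p''.2 = T'.openSide p'.1 p'.2
    · exact Or.inl (T'.openSide_subset_closedSide _ _ (he ▸ hp''))
    · exact Or.inr (Set.mem_biUnion he (T'.openSide_subset_closedSide _ _ hp''))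
  · rw [Set.eq_empty_iff_forall_notMem]
    rintro m ⟨hm, hm', hmv⟩
    have hr := T.isRegularPoint_of_mem_openSide hm
    exact hvm m hr hmv (T'.mem_openSide_of_isRegularPoint hm' hr)

/-- Passing to `T'` and back puts the edge inside an edge of `T`. Two edges of `T` with a common
point coincide, so both inclusions are equalities. -/
theorem IsQData.essentialEdges_subset {T' : GeodesicTriangulation M} {a' : Fin T'.numFaces → E2}
    {b' : Fin T'.numFaces → ℝ} (hQ : IsQData T f a b) (hQ' : IsQData T' f a' b') :
    essentialEdges T f ⊆ essentialEdges T' f := by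
  intro E hE
  obtain ⟨E', hE', h1⟩ := hQ.essentialEdge_subset hQ' hE
  obtain ⟨E'', hE'', h2⟩ := hQ'.essentialEdge_subset hQ hE'
  obtain ⟨⟨t, k, rfl⟩, -⟩ := hE
  obtain ⟨⟨t'', k'', rfl⟩, -⟩ := hE''
  obtain ⟨x, hx⟩ := T.openSide_nonempty t k
  have hm : T.chart t x ∈ T.openSide t k := ⟨x, hx, rfl⟩
  rw [← T.openSide_eq_of_mem_of_mem hm (h2 (h1 hm))] at h2
  rwa [h1.antisymm h2]

theorem IsQData.essentialEdges_eq {T' : GeodesicTriangulation M} {a' : Fin T'.numFaces → E2}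
    {b' : Fin T'.numFaces → ℝ} (hQ : IsQData T f a b) (hQ' : IsQData T' f a' b') :
    essentialEdges T f = essentialEdges T' f :=
  (hQ.essentialEdges_subset hQ').antisymm (hQ'.essentialEdges_subset hQ)

end Metric

/-! ### Positivity of the constants: existence of the pyramids -/

/-- The unit vector from the corner `j` to the corner `o`. -/
def cornerDir (c : Fin 3 → E2) (j o : Fin 3) : E2 := ‖c o - c j‖⁻¹ • (c o - c j)

theorem Fin.eq_of_distinct {j k o : Fin 3} (hjk : j ≠ k) (hko : k ≠ o) (hjo : j ≠ o) :
    (j = k + 1 ∧ o = k + 2) ∨ (j = k + 2 ∧ o = k + 1) := by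
  revert j k o; decide

theorem Fin.eq_third {j k o i : Fin 3} (hjk : j ≠ k) (hko : k ≠ o) (hjo : j ≠ o) (hij : i ≠ j)
    (hik : i ≠ k) : i = o := by
  rcases Fin.eq_of_distinct hjk hko hjo with ⟨rfl, rfl⟩ | ⟨rfl, rfl⟩ <;>
    rcases Fin.three_cases k i with rfl | rfl | rfl <;> first | rfl | contradiction

theorem Fin.exists_third {j k : Fin 3} (hjk : j ≠ k) : ∃ o, k ≠ o ∧ j ≠ o := by
  revert j k; decide

section Triangle
variable {c : Fin 3 → E2} (h : AffineIndependent ℝ c)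
include h

theorem height_corner_of_ne {k j : Fin 3} (hjk : j ≠ k) : height c k (c j) = 0 := by
  rcases Fin.three_cases k j with rfl | rfl | rfl
  · exact absurd rfl hjk
  · exact height_one _
  · exact height_two h _

theorem norm_cornerDir {j o : Fin 3} (hjo : j ≠ o) : ‖cornerDir c j o‖ = 1 := by
  have : ‖c o - c j‖ ≠ 0 := norm_ne_zero_iff.2 (sub_ne_zero.2 fun e => hjo (h.injective e).symm)
  rw [cornerDir, norm_smul, norm_inv, norm_norm, inv_mul_cancel₀ this]

theorem inner_cornerDir_triNormal {j k o : Fin 3} (hjk : j ≠ k) (hko : k ≠ o) :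
    inner ℝ (cornerDir c j o) (triNormal c k) = 0 := by
  rw [cornerDir, inner_smul_left, ← height_sub, height_corner_of_ne h hko.symm,
    height_corner_of_ne h hjk, sub_zero, mul_zero]

theorem inner_cornerDir_triNormal_pos {j k : Fin 3} (hjk : j ≠ k) :
    0 < inner ℝ (cornerDir c j k) (triNormal c k) := by
  have : 0 < ‖c k - c j‖ := norm_pos_iff.2 (sub_ne_zero.2 fun e => hjk (h.injective e).symm)
  rw [cornerDir, inner_smul_left, ← height_sub, height_corner_of_ne h hjk, height_self h, sub_zero]
  exact mul_pos (inv_pos.2 this) (norm_altVec_pos h k)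

/-- The angle of a triangle at a corner is strictly between `0` and `π`. -/
theorem exists_corner_angle {j k o : Fin 3} (hjk : j ≠ k) (hko : k ≠ o) (hjo : j ≠ o) :
    0 < Real.arccos (inner ℝ (cornerDir c j o) (cornerDir c j k)) ∧
    Real.arccos (inner ℝ (cornerDir c j o) (cornerDir c j k)) < π ∧
    inner ℝ (triNormal c k) (cornerDir c j k) =
      Real.sin (Real.arccos (inner ℝ (cornerDir c j o) (cornerDir c j k))) := by
  set e := cornerDir c j o
  set e' := cornerDir c j k
  have hpos := inner_cornerDir_triNormal_pos h hjk
  rw [real_inner_comm] at hpos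
  have hsq := normSq_eq_of_orthonormal (norm_cornerDir h hjo) (norm_triNormal h k)
    (inner_cornerDir_triNormal h hjk hko) e'
  rw [norm_cornerDir h hjk] at hsq
  have hlt : inner ℝ e e' ^ 2 < 1 := by nlinarith
  have habs : |inner ℝ e e'| < 1 := by
    rw [← sq_abs] at hlt
    nlinarith [abs_nonneg (inner ℝ e e')]
  rw [abs_lt] at habs
  refine ⟨Real.arccos_pos.2 habs.2, ?_, ?_⟩
  · refine lt_of_le_of_ne (Real.arccos_le_pi _) fun hπ => ?_
    rw [Real.arccos_eq_pi] at hπ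
    linarith [habs.1]
  · rw [Real.sin_arccos, eq_comm, Real.sqrt_eq_iff_mul_self_eq (by linarith) hpos.le]
    nlinarith

/-- If a point `x` of a triangle is not separated from `y` by a side through `x`, then `x` can be
moved towards `y` within the triangle. -/
theorem exists_lineMap_mem_triangle {x y : E2} (hx : x ∈ convexHull ℝ (Set.range c))
    (hy : ∀ k, height c k x = 0 → 0 ≤ height c k y) :
    ∃ s : ℝ, 0 < s ∧ AffineMap.lineMap x y s ∈ convexHull ℝ (Set.range c) := by
  rw [mem_triangle_iff h] at hx
  have hev : ∀ k, ∀ᶠ s : ℝ in nhdsWithin 0 (Set.Ioi 0),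
      0 ≤ height c k (AffineMap.lineMap x y s) := by
    intro k
    rcases (hx k).eq_or_lt with h0 | h0
    · filter_upwards [self_mem_nhdsWithin] with s hs
      rw [height_lineMap, ← h0, mul_zero, zero_add]
      exact mul_nonneg (le_of_lt hs) (hy k h0.symm)
    · refine nhdsWithin_le_nhds ?_
      have hc : Continuous fun s : ℝ => height c k (AffineMap.lineMap x y s) :=
        (height_continuous k).comp AffineMap.lineMap_continuous
      have h1 : (fun s : ℝ => height c k (AffineMap.lineMap x y s)) 0 > 0 := by simpa using h0
      filter_upwards [hc.continuousAt.eventually (lt_mem_nhds h1)] with s hs using le_of_lt hs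
  obtain ⟨s, hs, hs0⟩ := ((Filter.eventually_all.2 hev).and self_mem_nhdsWithin).exists
  exact ⟨s, hs0, (mem_triangle_iff h _).2 hs⟩

end Triangle

section Metric
variable {M : Type*} [MetricSpace M]
variable {T : GeodesicTriangulation M} {f g : M → ℝ} {a : Fin T.numFaces → E2}
  {b : Fin T.numFaces → ℝ}

theorem GeodesicTriangulation.corners_match {t t' : Fin T.numFaces} {k k' : Fin 3}
    (h : T.openSide t k = T.openSide t' k') {j o : Fin 3} (hjk : j ≠ k) (hko : k ≠ o)
    (hjo : j ≠ o) : ∃ j' o', j' ≠ k' ∧ k' ≠ o' ∧ j' ≠ o' ∧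
      T.chart t (T.corner t j) = T.chart t' (T.corner t' j') ∧
      T.chart t (T.corner t o) = T.chart t' (T.corner t' o') ∧
      ‖T.corner t o - T.corner t j‖ = ‖T.corner t' o' - T.corner t' j'‖ := by
  have d : k' + 1 ≠ k' ∧ k' ≠ k' + 2 ∧ k' + 1 ≠ k' + 2 := by clear * -; revert k'; decide
  obtain ⟨d1, d2, d3⟩ := d
  obtain ⟨hl, hm⟩ := T.sides_match h
  have hl' : ‖T.corner t (k + 1) - T.corner t (k + 2)‖ =
      ‖T.corner t' (k' + 1) - T.corner t' (k' + 2)‖ := by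
    rw [norm_sub_rev, norm_sub_rev (T.corner t' _)]; exact hl
  unfold sideVec at hl
  rcases hm with hm | hm
  · have h0 := hm 0 (by simp)
    have h1 := hm 1 (by simp)
    simp only [AffineMap.lineMap_apply_zero, AffineMap.lineMap_apply_one] at h0 h1
    rcases Fin.eq_of_distinct hjk hko hjo with ⟨rfl, rfl⟩ | ⟨rfl, rfl⟩
    · exact ⟨_, _, d1, d2, d3, h0, h1, hl⟩
    · exact ⟨_, _, d2.symm, d1.symm, d3.symm, h1, h0, hl'⟩
  · have h0 := hm 0 (by simp)
    have h1 := hm 1 (by simp)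
    simp only [AffineMap.lineMap_apply_zero, AffineMap.lineMap_apply_one, sub_zero, sub_self]
      at h0 h1
    rcases Fin.eq_of_distinct hjk hko hjo with ⟨rfl, rfl⟩ | ⟨rfl, rfl⟩
    · exact ⟨_, _, d2.symm, d1.symm, d3.symm, h0, h1, hl.trans (norm_sub_rev _ _)⟩
    · exact ⟨_, _, d1, d2, d3, h1, h0, hl'.trans (norm_sub_rev _ _)⟩

/-- `(t, x)` is a lowest point of `f` among the points of the triangles with `b t = β`. -/
structure IsLowest (T : GeodesicTriangulation M) (f : M → ℝ) (b : Fin T.numFaces → ℝ) (β : ℝ)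
    (t : Fin T.numFaces) (x : E2) : Prop where
  mem : x ∈ T.face t
  eq : b t = β
  le : ∀ t', b t' = β → ∀ x' ∈ T.face t', f (T.chart t x) ≤ f (T.chart t' x')

theorem IsLowest.of_eq {β : ℝ} {t t' : Fin T.numFaces} {x x' : E2} (h : IsLowest T f b β t x)
    (hx' : x' ∈ T.face t') (hb : b t' = β) (he : T.chart t x = T.chart t' x') :
    IsLowest T f b β t' x' := ⟨hx', hb, he ▸ h.le⟩

/-- First-order condition at a minimum. If the inner product were positive, a step towards `y` short
enough for the linear term to beat the quadratic one would lower `f`. -/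
theorem IsLowest.inner_nonpos (hQ : IsQData T f a b) {β : ℝ} {t : Fin T.numFaces} {x y : E2}
    (h : IsLowest T f b β t x) (hy : y ∈ T.face t) : inner ℝ (y - x) (a t - x) ≤ 0 := by
  by_contra hcon
  push Not at hcon
  set κ := inner ℝ (y - x) (a t - x)
  set s := min 1 (κ / (‖y - x‖ ^ 2 + 1))
  have hs0 : 0 < s := lt_min one_pos (by positivity)
  have hs1 : s ≤ 1 := min_le_left _ _
  have hs2 : s * (‖y - x‖ ^ 2 + 1) ≤ κ := (le_div_iff₀ (by positivity)).1 (min_le_right _ _)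
  have hmem : AffineMap.lineMap x y s ∈ T.face t :=
    (T.convex_face t).lineMap_mem h.mem hy ⟨hs0.le, hs1⟩
  have hle := h.le t h.eq _ hmem
  have e : AffineMap.lineMap x y s - a t = s • (y - x) - (a t - x) := by
    rw [AffineMap.lineMap_apply_module']; abel
  rw [hQ t _ hmem, hQ t x h.mem, e, norm_sub_rev x, norm_sub_sq_real (s • (y - x)), norm_smul,
    inner_smul_left, mul_pow, Real.norm_eq_abs, sq_abs] at hle
  simp only [conj_trivial] at hle
  nlinarith [mul_pos hs0 hcon]

/-- If no side through `x` separated it from the centre, then `x` could be moved towards the centre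
within the triangle, against `inner_nonpos`. -/
theorem IsLowest.exists_height_neg (hQ : IsQData T f a b) {β : ℝ} {t : Fin T.numFaces} {x : E2}
    (h : IsLowest T f b β t x) (hne : a t ≠ x) :
    ∃ k, height (T.corner t) k x = 0 ∧ height (T.corner t) k (a t) < 0 := by
  by_contra hcon
  push Not at hcon
  obtain ⟨s, hs, hmem⟩ := exists_lineMap_mem_triangle (T.corner_indep t) h.mem hcon
  have h1 := h.inner_nonpos hQ hmem
  have e : AffineMap.lineMap x (a t) s - x = s • (a t - x) := by
    rw [AffineMap.lineMap_apply_module']; abel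
  rw [e, inner_smul_left, real_inner_self_eq_norm_sq] at h1
  have : 0 < ‖a t - x‖ := norm_pos_iff.2 (sub_ne_zero.2 hne)
  have : 0 < s * ‖a t - x‖ ^ 2 := by positivity
  simp only [conj_trivial] at h1
  linarith

/-- Let `h` and `h'` be the signed distances of the centres from the edge. From `h < 0` and `0 ≤ h +
h'` follow `0 < -h ≤ h'` and `h ^ 2 ≤ h' ^ 2`, so the relation `h ^ 2 + b = h' ^ 2 + b'` yields `b'
≤ b`; minimality of `b` forces equality. -/
theorem IsQData.cross (hQ : IsQData T f a b) (hJ : ∀ p, 0 ≤ jump T a p) {β : ℝ}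
    (hβ : ∀ t, β ≤ b t) {p : Fin T.numFaces × Fin 3} (hb : b p.1 = β)
    (hneg : height (T.corner p.1) p.2 (a p.1) < 0) :
    b (T.partner p).1 = β ∧
      0 < height (T.corner (T.partner p).1) (T.partner p).2 (a (T.partner p).1) := by
  obtain ⟨x, hx⟩ := T.openSide_nonempty p.1 p.2
  have hR := (hQ.edge_formula p hx).1
  have hj := hJ p
  unfold jump at hj
  refine ⟨le_antisymm ?_ (hβ _), by linarith⟩
  nlinarith

/-- Going around a vertex, the direction of steepest descent cannot leave the lowest point. -/
theorem IsQData.not_isLowest_corner (hQ : IsQData T f a b) (hJ : ∀ p, 0 ≤ jump T a p) {β : ℝ}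
    (hβ : ∀ t, β ≤ b t) (hβ0 : β ≤ 0) (hpos : ∀ m, 0 < f m) {t : Fin T.numFaces}
    {j k : Fin 3} (hjk : j ≠ k) (hlow : IsLowest T f b β t (T.corner t j))
    (hneg : height (T.corner t) k (a t) < 0) : False := by
  classical
  -- A common positive lower bound for the finitely many triangle angles; the value `1` is a filler
  -- for index triples that are not distinct.
  obtain ⟨θ₀, hθ₀, hθ⟩ : ∃ θ₀ > 0, ∀ (t : Fin T.numFaces) (j k o : Fin 3), j ≠ k → k ≠ o → j ≠ o →
      θ₀ ≤ Real.arccos (inner ℝ (cornerDir (T.corner t) j o) (cornerDir (T.corner t) j k)) := by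
    let F : Fin T.numFaces × Fin 3 × Fin 3 × Fin 3 → ℝ := fun i =>
      if i.2.1 ≠ i.2.2.1 ∧ i.2.2.1 ≠ i.2.2.2 ∧ i.2.1 ≠ i.2.2.2 then
        Real.arccos (inner ℝ (cornerDir (T.corner i.1) i.2.1 i.2.2.2)
          (cornerDir (T.corner i.1) i.2.1 i.2.2.1)) else 1
    have : Nonempty (Fin T.numFaces × Fin 3 × Fin 3 × Fin 3) := ⟨(t, 0, 0, 0)⟩
    obtain ⟨i₀, hi₀⟩ := Finite.exists_min F
    refine ⟨F i₀, ?_, fun t j k o h1 h2 h3 => ?_⟩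
    · simp only [F]
      split_ifs with hd
      · exact (exists_corner_angle (T.corner_indep _) hd.1 hd.2.1 hd.2.2).1
      · exact one_pos
    · have := hi₀ (t, j, k, o)
      rwa [show F (t, j, k, o) = _ from if_pos ⟨h1, h2, h3⟩] at this
  -- `ρ` is the distance from the vertex to the centre, the same in all triangles met, since `f` at
  -- the vertex and the constant `β` do not change.
  set f₀ := f (T.chart t (T.corner t j)) with hf₀
  set ρ := √(f₀ - β)
  have hρ2 : 0 < f₀ - β := by linarith [hpos (T.chart t (T.corner t j))]
  have hρ : 0 < ρ := Real.sqrt_pos.2 hρ2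
  have hρsq : ρ ^ 2 = f₀ - β := Real.sq_sqrt hρ2.le
  -- The angle from the crossed side to the direction of the centre is at least `π / 2` at a lowest
  -- point. Each crossing reduces it by the angle of the new triangle, at least `θ₀`, so `n` bounds
  -- the number of crossings left.
  have key : ∀ (n : ℕ) (t : Fin T.numFaces) (j k o : Fin 3), j ≠ k → k ≠ o → j ≠ o →
      IsLowest T f b β t (T.corner t j) → f (T.chart t (T.corner t j)) = f₀ →
      height (T.corner t) k (a t) < 0 →
      Real.arccos (inner ℝ (cornerDir (T.corner t) j o) (a t - T.corner t j) / ρ) <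
        π / 2 + n * θ₀ → False := by
    intro n
    induction n with
    | zero =>
      intro t j k o hjk hko hjo hlow hf hneg hφ
      have h1 : inner ℝ (cornerDir (T.corner t) j o) (a t - T.corner t j) ≤ 0 := by
        rw [cornerDir, inner_smul_left]
        exact mul_nonpos_of_nonneg_of_nonpos (inv_nonneg.2 (norm_nonneg _))
          (hlow.inner_nonpos hQ (T.corner_mem_face t o))
      rw [Nat.cast_zero, zero_mul, add_zero, Real.arccos_lt_pi_div_two] at hφ
      exact absurd (div_nonpos_of_nonpos_of_nonneg h1 hρ.le) (not_le.2 hφ)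
    | succ n ih =>
      intro t j k o hjk hko hjo hlow hf hneg hφ
      obtain ⟨hb', hpos'⟩ := hQ.cross hJ hβ (p := (t, k)) hlow.eq hneg
      obtain ⟨j', o', hjk', hko', hjo', mj, mo, hl⟩ :=
        T.corners_match (T.openSide_partner (t, k)).symm hjk hko hjo
      generalize T.partner (t, k) = p' at hb' hpos' hjk' hko' mj mo hl
      obtain ⟨t', k'⟩ := p'
      simp only at hb' hpos' hjk' hko' mj mo hl
      have hind := T.corner_indep t'
      have hlow' := hlow.of_eq (T.corner_mem_face t' j') hb' mj
      have hf' : f (T.chart t' (T.corner t' j')) = f₀ := mj ▸ hf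
      have hu : ‖a t' - T.corner t' j'‖ ^ 2 = ρ ^ 2 := by
        rw [hρsq, ← hf', hQ t' _ (T.corner_mem_face t' j'), hb', norm_sub_rev]; ring
      have hu0 : a t' ≠ T.corner t' j' := by
        rintro e
        rw [e, sub_self, norm_zero] at hu
        nlinarith
      -- the tangential components agree
      have htan : inner ℝ (cornerDir (T.corner t') j' o') (a t' - T.corner t' j') =
          inner ℝ (cornerDir (T.corner t) j o) (a t - T.corner t j) := by
        have aux : ∀ t j o, inner ℝ (cornerDir (T.corner t) j o) (a t - T.corner t j) =
            ‖T.corner t o - T.corner t j‖⁻¹ *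
              ((‖T.corner t o - T.corner t j‖ ^ 2 + f (T.chart t (T.corner t j)) -
                f (T.chart t (T.corner t o))) / 2) := by
          intro t j o
          rw [cornerDir, inner_smul_left, hQ t _ (T.corner_mem_face t j),
            hQ t _ (T.corner_mem_face t o),
            real_inner_eq_norm_mul_self_add_norm_mul_self_sub_norm_sub_mul_self_div_two,
            sub_sub_sub_cancel_right, norm_sub_rev (a t)]
          simp only [conj_trivial]
          ring
        rw [aux, aux, mj, mo, hl]
      set e := cornerDir (T.corner t') j' o'
      set e'' := cornerDir (T.corner t') j' k'
      set N := T.normal t' k'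
      set u := a t' - T.corner t' j'
      set φ := Real.arccos (inner ℝ e u / ρ)
      rw [← htan] at hφ
      obtain ⟨hθ1, hθ2, hsin⟩ := exists_corner_angle hind hjk' hko' hjo'
      set θ := Real.arccos (inner ℝ e e'')
      have hθmin : θ₀ ≤ θ := hθ t' j' k' o' hjk' hko' hjo'
      have he : ‖e‖ = 1 := norm_cornerDir hind hjo'
      have he'' : ‖e''‖ = 1 := norm_cornerDir hind hjk'
      have hN : ‖N‖ = 1 := norm_triNormal hind k'
      have heN : inner ℝ e N = 0 := inner_cornerDir_triNormal hind hjk' hko'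
      have hη : 0 < inner ℝ N u := by
        rw [real_inner_comm, ← height_sub, height_corner_of_ne hind hjk', sub_zero]
        exact hpos'
      have husq := normSq_eq_of_orthonormal he hN heN u
      rw [hu] at husq
      have hle1 : |inner ℝ e u / ρ| ≤ 1 := by
        rw [abs_div, abs_of_pos hρ, div_le_one hρ]
        exact abs_le_of_sq_le_sq (by nlinarith) hρ.le
      have hcosφ : inner ℝ e u = ρ * Real.cos φ := by
        rw [Real.cos_arccos (abs_le.1 hle1).1 (abs_le.1 hle1).2]; field_simp
      have hsinφ : inner ℝ N u = ρ * Real.sin φ := by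
        rw [← sq_eq_sq₀ hη.le (mul_nonneg hρ.le (Real.sin_nonneg_of_nonneg_of_le_pi
          (Real.arccos_nonneg _) (Real.arccos_le_pi _))), mul_pow, Real.sin_sq]
        rw [hcosφ] at husq
        linarith
      have hcosθ : inner ℝ e e'' = Real.cos θ := by
        have := abs_real_inner_le_norm e e''
        rw [he, he'', one_mul, abs_le] at this
        rw [Real.cos_arccos this.1 this.2]
      have hnew : inner ℝ e'' u = ρ * Real.cos (φ - θ) := by
        rw [inner_eq_of_orthonormal he hN heN, hcosθ, hsin, hcosφ, hsinφ, Real.cos_sub]; ring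
      have hle : inner ℝ e'' u ≤ 0 := by
        have := hlow'.inner_nonpos hQ (T.corner_mem_face t' k')
        simp only [e'', cornerDir, inner_smul_left, conj_trivial]
        exact mul_nonpos_of_nonneg_of_nonpos (inv_nonneg.2 (norm_nonneg _)) this
      have hle' : inner ℝ e u ≤ 0 := by
        have := hlow'.inner_nonpos hQ (T.corner_mem_face t' o')
        simp only [e, cornerDir, inner_smul_left, conj_trivial]
        exact mul_nonpos_of_nonneg_of_nonpos (inv_nonneg.2 (norm_nonneg _)) this
      -- Only `cos (φ - θ) ≤ 0` is known. The bounds on `φ` and `θ` place `φ - θ` above `-(π / 2)`,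
      -- so it is at least `π / 2` and equals the new angle.
      have hφ1 : π / 2 ≤ φ := by
        by_contra hc
        exact absurd (Real.arccos_lt_pi_div_two.1 (not_le.1 hc))
          (not_lt.2 (div_nonpos_of_nonpos_of_nonneg hle' hρ.le))
      have hφ2 : φ ≤ π := Real.arccos_le_pi _
      have hcos : Real.cos (φ - θ) ≤ 0 := by
        by_contra hc
        push Not at hc
        have := mul_pos hρ hc
        linarith
      have hφθ : π / 2 ≤ φ - θ := by
        by_contra hc
        push Not at hc
        exact absurd hcos (not_le.2 (Real.cos_pos_of_mem_Ioo ⟨by linarith, hc⟩))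
      have hangle : Real.arccos (inner ℝ e'' u / ρ) = φ - θ := by
        rw [hnew, mul_div_cancel_left₀ _ hρ.ne', Real.arccos_cos (by linarith [Real.pi_pos])
          (by linarith)]
      -- A separating side passes through the vertex and is not the side just crossed, where the
      -- height is positive; so it is the other side at the vertex, the next to be crossed.
      have hneg' : height (T.corner t') o' (a t') < 0 := by
        obtain ⟨i, hi0, hi⟩ := hlow'.exists_height_neg hQ hu0
        have hij : i ≠ j' := by
          rintro rfl
          rw [height_self hind] at hi0
          exact (norm_altVec_pos hind i).ne' hi0
        have hik : i ≠ k' := by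
          rintro rfl; linarith
        exact Fin.eq_third hjk' hko' hjo' hij hik ▸ hi
      refine ih t' j' o' k' hjo' hko'.symm hjk' hlow' hf' hneg' ?_
      rw [hangle]
      push_cast at hφ
      linarith
  obtain ⟨o, hko, hjo⟩ : ∃ o, k ≠ o ∧ j ≠ o := Fin.exists_third hjk
  obtain ⟨n, hn⟩ := exists_nat_gt
    (Real.arccos (inner ℝ (cornerDir (T.corner t) j o) (a t - T.corner t j) / ρ) / θ₀)
  rw [div_lt_iff₀ hθ₀] at hn
  exact key n t j k o hjk hko hjo hlow rfl hneg (by linarith [Real.pi_pos])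

/-- For a positive Q-concave PQ-function all the pyramids exist. -/
theorem IsQData.pos_of_isQConcave (hQ : IsQData T f a b) (hf : Continuous f)
    (hc : IsQConcave f) (hpos : ∀ m, 0 < f m) (t : Fin T.numFaces) : 0 < b t := by
  by_contra hcon
  push Not at hcon
  have hJ := hQ.jump_nonneg hc
  have : Nonempty (Fin T.numFaces) := ⟨t⟩
  obtain ⟨t₀, ht₀⟩ := Finite.exists_min b
  set β := b t₀
  have hβ0 : β ≤ 0 := (ht₀ t).trans hcon
  obtain ⟨t₁, x₁, hlow⟩ : ∃ t₁ x₁, IsLowest T f b β t₁ x₁ := by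
    have hmin : ∀ t, ∃ x ∈ T.face t, ∀ y ∈ T.face t, f (T.chart t x) ≤ f (T.chart t y) := by
      intro t
      obtain ⟨x, hx, hm⟩ := (T.isCompact_face t).exists_isMinOn ⟨_, T.corner_mem_face t 0⟩
        (hf.comp_continuousOn (T.chart_continuousOn t))
      exact ⟨x, hx, fun y hy => hm hy⟩
    choose ξ hξ hξm using hmin
    have : Nonempty {t // b t = β} := ⟨⟨t₀, rfl⟩⟩
    obtain ⟨i, hi⟩ := Finite.exists_min
      (fun i : {t // b t = β} => f (T.chart i.1 (ξ i.1)))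
    exact ⟨i.1, ξ i.1, hξ _, i.2, fun t' ht' x' hx' => (hi ⟨t', ht'⟩).trans (hξm t' x' hx')⟩
  have hne : ∀ {t x}, IsLowest T f b β t x → a t ≠ x := by
    rintro t x h e
    have := hQ t x h.mem
    rw [e, sub_self, norm_zero, h.eq] at this
    linarith [hpos (T.chart t x)]
  obtain ⟨k, hk0, hk⟩ := hlow.exists_height_neg hQ (hne hlow)
  rcases T.trichotomy hlow.mem with hi | ⟨k', hk'⟩ | ⟨j, rfl⟩
  · exact ((mem_interior_triangle_iff (T.corner_indep t₁) _).1 hi k).ne' hk0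
  · have hkk : k = k' := by
      obtain ⟨-, h1, h2⟩ := (mem_openSide_iff (T.corner_indep t₁) k' _).1 hk'
      rcases Fin.three_cases k' k with rfl | rfl | rfl
      · rfl
      · exact absurd hk0 h1.ne'
      · exact absurd hk0 h2.ne'
    subst hkk
    obtain ⟨hb', hpos'⟩ := hQ.cross hJ ht₀ (p := (t₁, k)) hlow.eq hk
    obtain ⟨x', hx', hm, -⟩ := T.exists_edgeChart_partner (t₁, k) hk'
    have hlow' := hlow.of_eq (T.side_subset _ _ hx') hb' hm.symm
    -- The only side through `x'` is the one just crossed, and the centre is now on its inner side.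
    obtain ⟨i, hi0, hi⟩ := hlow'.exists_height_neg hQ (hne hlow')
    obtain ⟨-, h1, h2⟩ := (mem_openSide_iff (T.corner_indep _) _ _).1 hx'
    rcases Fin.three_cases (T.partner (t₁, k)).2 i with rfl | rfl | rfl
    · linarith
    · exact absurd hi0 h1.ne'
    · exact absurd hi0 h2.ne'
  · have hjk : j ≠ k := by
      rintro rfl
      rw [height_self (T.corner_indep t₁)] at hk0
      exact (norm_altVec_pos (T.corner_indep t₁) j).ne' hk0
    exact hQ.not_isLowest_corner hJ ht₀ hβ0 hpos hjk hlow hk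

end Metric

/-! ### The polyhedral complex as a cone over `M` -/

/-- Forward growth is controlled only at interior points; at the ends continuity suffices. This
allows segments of a pyramid to end over a vertex, where the triangle charts are not locally
isometric. -/
theorem le_add_of_locally_le {φ : ℝ → ℝ} {K : ℝ} (hc : ContinuousOn φ (Set.Icc 0 1))
    (h : ∀ p ∈ Set.Ioo (0 : ℝ) 1, ∃ δ > 0, ∀ τ, p < τ → τ < p + δ → τ < 1 →
      φ τ ≤ φ p + K * (τ - p)) : φ 1 ≤ φ 0 + K := by
  by_contra hcon
  push Not at hcon
  set ψ : ℝ → ℝ := fun τ => φ τ - K * τ with hψ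
  have hψc : ContinuousOn ψ (Set.Icc 0 1) := hc.sub (by fun_prop)
  -- A level strictly between the end values makes the last point with `ψ ≤ c` interior, so that the
  -- local bound applies there and produces a later such point.
  obtain ⟨c, hc0, hc1⟩ : ∃ c, ψ 0 < c ∧ c < ψ 1 := exists_between (by simp only [hψ]; linarith)
  have hS : IsCompact (Set.Icc 0 1 ∩ ψ ⁻¹' Set.Iic c) := isCompact_Icc.of_isClosed_subset
    (hψc.preimage_isClosed_of_isClosed isClosed_Icc isClosed_Iic) Set.inter_subset_left
  obtain ⟨p, ⟨hp, hpc⟩, hmax⟩ := hS.exists_isGreatest ⟨0, by simp, hc0.le⟩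
  simp only [Set.mem_preimage, Set.mem_Iic] at hpc
  have hp1 : p < 1 := hp.2.lt_of_ne (by rintro rfl; linarith)
  have hp0 : 0 < p := by
    refine hp.1.lt_of_ne ?_
    rintro rfl
    have h1 := (hψc 0 hp).eventually (gt_mem_nhds hc0)
    rw [eventually_nhdsWithin_iff, Metric.eventually_nhds_iff] at h1
    obtain ⟨ε, hε, H⟩ := h1
    obtain ⟨τ, hτ0, hτ⟩ := exists_between (lt_min hε one_pos)
    have hτI : τ ∈ Set.Icc (0 : ℝ) 1 := ⟨hτ0.le, (hτ.trans_le (min_le_right _ _)).le⟩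
    have h2 := H (y := τ) (by
      rw [Real.dist_eq, sub_zero, abs_of_pos hτ0]; exact hτ.trans_le (min_le_left _ _)) hτI
    exact absurd (hmax ⟨hτI, le_of_lt h2⟩) (not_le.2 hτ0)
  obtain ⟨δ, hδ, H⟩ := h p ⟨hp0, hp1⟩
  obtain ⟨τ, hτ0, hτ⟩ := exists_between (lt_min (lt_add_of_pos_right p hδ) hp1)
  have hτ1 := hτ.trans_le (min_le_right _ _)
  have h1 := H τ hτ0 (hτ.trans_le (min_le_left _ _)) hτ1
  refine absurd (hmax ⟨⟨(hp0.trans hτ0).le, hτ1.le⟩, ?_⟩) (not_le.2 hτ0)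
  simp only [Set.mem_preimage, Set.mem_Iic, hψ] at hpc ⊢
  linarith

theorem lift_add (x y : E2) : lift (x + y) = lift x + lift y := by
  ext i; fin_cases i <;> simp [lift]

theorem lift_injective : Function.Injective lift := by
  intro x y h
  rw [← sub_eq_zero, ← inner_self_eq_zero (𝕜 := ℝ), ← inner_lift, lift_sub, h, sub_self,
    inner_zero_left]

theorem norm_lift (y : E2) : ‖lift y‖ = ‖y‖ := by
  rw [← sq_eq_sq₀ (norm_nonneg _) (norm_nonneg _), ← real_inner_self_eq_norm_sq, inner_lift,
    real_inner_self_eq_norm_sq]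

section Metric
variable {M : Type*} [MetricSpace M]

namespace Couple
variable (C : Couple M)

/-- The point dividing the segment from a base point to the apex in the ratio `s`. -/
def pt (t : Fin C.T.numFaces) (s : ℝ) (x : E2) : E3 := (1 - s) • lift x + s • C.apex t

theorem pt_mem {t : Fin C.T.numFaces} {s : ℝ} (hs : s ∈ Set.Icc (0 : ℝ) 1) {x : E2}
    (hx : x ∈ C.T.face t) : C.pt t s x ∈ C.pyramid t :=
  convex_convexHull ℝ _ (C.lift_mem hx) (C.apex_mem t) (sub_nonneg.2 hs.2) hs.1
    (sub_add_cancel 1 s)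

theorem exists_eq_pt {t : Fin C.T.numFaces} {u : E3} (hu : u ∈ C.pyramid t) :
    ∃ s ∈ Set.Icc (0 : ℝ) 1, ∃ x ∈ C.T.face t, u = C.pt t s x := by
  have hne : (lift '' C.T.face t).Nonempty := ⟨_, _, C.T.corner_mem_face t 0, rfl⟩
  have hconv : Convex ℝ (lift '' C.T.face t) :=
    (C.T.convex_face t).is_linear_image ⟨lift_add, lift_smul⟩
  rw [pyramid, convexHull_insert hne, hconv.convexHull_eq, mem_convexJoin] at hu
  obtain ⟨_, rfl, _, ⟨x, hx, rfl⟩, hu⟩ := hu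
  rw [segment_symm, segment_eq_image] at hu
  obtain ⟨s, hs, rfl⟩ := hu
  exact ⟨s, hs, x, hx, rfl⟩

theorem pt_inj {t : Fin C.T.numFaces} {s s' : ℝ} {x x' : E2} (h : C.pt t s x = C.pt t s' x') :
    s = s' ∧ (s = 1 ∨ x = x') := by
  have hz : ∀ s x, C.pt t s x 2 = s * C.apex t 2 := fun s x => by simp [pt, lift]
  have h2 : s = s' := by
    have := congrArg (fun v : E3 => v 2) h
    simp only [hz] at this
    exact mul_right_cancel₀ (C.apex_height t).ne' this
  subst h2
  refine ⟨rfl, or_iff_not_imp_left.2 fun hs => ?_⟩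
  have := add_right_cancel h
  exact lift_injective (smul_right_injective _ (sub_ne_zero.2 (Ne.symm hs)) this)

/-- The point of the complex in the ratio `s` between the boundary point `m` and the apex. -/
def conePoint (m : M) (s : Set.Icc (0 : ℝ) 1) : C.Complex :=
  C.toComplex (C.T.cover m).choose
    ⟨C.pt _ s (C.T.cover m).choose_spec.choose, C.pt_mem s.2 (C.T.cover m).choose_spec.choose_spec.1⟩

theorem toComplex_pt {t : Fin C.T.numFaces} {s : Set.Icc (0 : ℝ) 1} {x : E2} (hx : x ∈ C.T.face t)
    {m : M} (h : (s : ℝ) = 1 ∨ C.T.chart t x = m) :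
    C.toComplex t ⟨C.pt t s x, C.pt_mem s.2 hx⟩ = C.conePoint m s :=
  Quot.sound ⟨s, s.2, x, hx, _, (C.T.cover m).choose_spec.choose_spec.1, rfl, rfl,
    h.imp_right fun h => h.trans (C.T.cover m).choose_spec.choose_spec.2.symm⟩

theorem exists_eq_conePoint (P : C.Complex) : ∃ m s, P = C.conePoint m s := by
  obtain ⟨⟨t, u, hu⟩, rfl⟩ := Quot.exists_rep P
  obtain ⟨s, hs, x, hx, rfl⟩ := C.exists_eq_pt hu
  exact ⟨C.T.chart t x, ⟨s, hs⟩, C.toComplex_pt (s := ⟨s, hs⟩) hx (Or.inr rfl)⟩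

theorem conePoint_eq_of_eq_one (m m' : M) {s : Set.Icc (0 : ℝ) 1} (hs : (s : ℝ) = 1) :
    C.conePoint m s = C.conePoint m' s := by
  obtain ⟨t, x, hx, -⟩ := C.T.cover m
  rw [← C.toComplex_pt hx (m := m) (Or.inl hs), ← C.toComplex_pt hx (m := m') (Or.inl hs)]

theorem conePoint_inj {m m' : M} {s s' : Set.Icc (0 : ℝ) 1}
    (h : C.conePoint m s = C.conePoint m' s') : s = s' ∧ ((s : ℝ) = 1 ∨ m = m') := by
  classical
  choose σ _ ξ _ hσξ using fun p : (Σ t, C.pyramid t) => C.exists_eq_pt p.2.2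
  -- The ratio and the boundary point, the latter forgotten at the apex; this makes `κ` compatible
  -- with the gluing, so it descends to the complex and separates cone points.
  let κ : (Σ t, C.pyramid t) → ℝ × Option M := fun p =>
    (σ p, if σ p = 1 then none else some (C.T.chart p.1 (ξ p)))
  have hκ : ∀ t s x (hs : s ∈ Set.Icc (0 : ℝ) 1) (hx : x ∈ C.T.face t),
      κ ⟨t, C.pt t s x, C.pt_mem hs hx⟩ = (s, if s = 1 then none else some (C.T.chart t x)) := by
    intro t s x hs hx
    obtain ⟨h1, h2⟩ := C.pt_inj (hσξ ⟨t, C.pt t s x, C.pt_mem hs hx⟩)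
    simp only [κ]
    rw [← h1]
    by_cases hs1 : s = 1
    · simp [hs1]
    · rw [if_neg hs1, if_neg hs1, ← h2.resolve_left hs1]
  have hglue : ∀ p q, C.Glued p q → κ p = κ q := by
    rintro ⟨t, u, hu⟩ ⟨t', u', hu'⟩ ⟨s, hs, x, hx, y, hy, h1, h2, h3⟩
    change u = C.pt t s x at h1
    change u' = C.pt t' s y at h2
    subst h1 h2
    rw [hκ t s x hs hx, hκ t' s y hs hy]
    rcases h3 with rfl | h3
    · simp
    · simp only at h3; rw [h3]
  have hcone : ∀ m (s : Set.Icc (0 : ℝ) 1), Quot.lift κ hglue (C.conePoint m s) =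
      ((s : ℝ), if (s : ℝ) = 1 then none else some m) := by
    intro m s
    obtain ⟨t, x, hx, rfl⟩ := C.T.cover m
    rw [← C.toComplex_pt hx (Or.inr rfl)]
    exact hκ t s x s.2 hx
  have h1 := congrArg (Quot.lift κ hglue) h
  rw [hcone, hcone, Prod.mk.injEq] at h1
  obtain ⟨h1, h2⟩ := h1
  refine ⟨Subtype.ext h1, or_iff_not_imp_left.2 fun hs => ?_⟩
  rw [if_neg hs, if_neg (h1 ▸ hs)] at h2
  exact Option.some.inj h2

/-! ### The intrinsic distance -/

variable {C}

theorem IsChain.nonneg {p q : C.Complex} {ℓ : ℝ} (h : C.IsChain p q ℓ) : 0 ≤ ℓ := by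
  induction h with
  | nil p => exact le_rfl
  | cons t u v q ℓ _ ih => exact add_nonneg dist_nonneg ih

theorem IsChain.trans {p q r : C.Complex} {ℓ ℓ' : ℝ} (h : C.IsChain p q ℓ)
    (h' : C.IsChain q r ℓ') : C.IsChain p r (ℓ + ℓ') := by
  induction h with
  | nil p => rwa [zero_add]
  | cons t u v q ℓ _ ih => rw [add_assoc]; exact .cons t u v r _ (ih h')

variable (C) in
theorem isChain_dist (t : Fin C.T.numFaces) (u v : C.pyramid t) :
    C.IsChain (C.toComplex t u) (C.toComplex t v) (dist u v) := by
  have := IsChain.cons (C := C) t u v _ 0 (.nil _)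
  rwa [add_zero] at this

theorem IsChain.symm {p q : C.Complex} {ℓ : ℝ} (h : C.IsChain p q ℓ) : C.IsChain q p ℓ := by
  induction h with
  | nil p => exact .nil p
  | cons t u v q ℓ _ ih =>
    rw [add_comm, dist_comm]
    exact ih.trans (C.isChain_dist t v u)

variable (C) in
theorem exists_isChain (p q : C.Complex) : ∃ ℓ, C.IsChain p q ℓ := by
  obtain ⟨⟨t, u⟩, rfl⟩ := Quot.exists_rep p
  obtain ⟨⟨t', v⟩, rfl⟩ := Quot.exists_rep q
  have h1 := C.isChain_dist t u ⟨C.apex t, C.apex_mem t⟩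
  rw [C.toComplex_apex t t'] at h1
  exact ⟨_, h1.trans (C.isChain_dist t' _ v)⟩

variable (C) in
theorem complexDist_bddBelow (p q : C.Complex) : BddBelow {ℓ | C.IsChain p q ℓ} :=
  ⟨0, fun _ h => IsChain.nonneg h⟩

theorem IsChain.complexDist_le {p q : C.Complex} {ℓ : ℝ} (h : C.IsChain p q ℓ) :
    C.complexDist p q ≤ ℓ := csInf_le (C.complexDist_bddBelow p q) h

variable (C)

theorem le_complexDist {p q : C.Complex} {d : ℝ} (h : ∀ ℓ, C.IsChain p q ℓ → d ≤ ℓ) :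
    d ≤ C.complexDist p q := le_csInf (C.exists_isChain p q) h

theorem complexDist_comm (p q : C.Complex) : C.complexDist p q = C.complexDist q p :=
  le_antisymm (C.le_complexDist fun _ h => h.symm.complexDist_le)
    (C.le_complexDist fun _ h => h.symm.complexDist_le)

theorem complexDist_triangle (p q r : C.Complex) :
    C.complexDist p r ≤ C.complexDist p q + C.complexDist q r := by
  rw [← sub_le_iff_le_add]
  refine C.le_complexDist fun ℓ h => ?_
  rw [sub_le_comm]
  refine C.le_complexDist fun ℓ' h' => ?_
  rw [sub_le_iff_le_add, add_comm]
  exact (h.trans h').complexDist_le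

theorem complexDist_self (p : C.Complex) : C.complexDist p p = 0 :=
  le_antisymm (IsChain.nil p).complexDist_le (C.le_complexDist fun _ h => h.nonneg)

/-- The distance to the apex within the pyramids. -/
theorem pt_sub_apex (t : Fin C.T.numFaces) (s : ℝ) (x : E2) :
    C.pt t s x - C.apex t = (1 - s) • (lift x - C.apex t) := by
  rw [pt]; module

theorem norm_lift_sub_apex {t : Fin C.T.numFaces} {x : E2} (hx : x ∈ C.T.face t) :
    ‖lift x - C.apex t‖ = √(C.sqDist (C.T.chart t x)) := by
  rw [C.sqDist_chart hx, Real.sqrt_sq dist_nonneg, dist_comm, dist_eq_norm]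

/-- The straight segment in a pyramid gives the upper bound. For the lower bound, the distance to
the apex inside a pyramid is compatible with the gluing, and it changes along each segment of a
chain by at most the length of the segment. -/
theorem complexDist_apex {t t' : Fin C.T.numFaces} {x : E2} (hx : x ∈ C.T.face t) :
    C.complexDist (C.toComplex t ⟨lift x, C.lift_mem hx⟩)
      (C.toComplex t' ⟨C.apex t', C.apex_mem t'⟩) = √(C.sqDist (C.T.chart t x)) := by
  have hglue : ∀ p q, C.Glued p q →
      dist (p.2 : E3) (C.apex p.1) = dist (q.2 : E3) (C.apex q.1) := by
    rintro ⟨t, u, hu⟩ ⟨t', u', hu'⟩ ⟨s, hs, x, hx, y, hy, h1, h2, h3⟩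
    change u = C.pt t s x at h1
    change u' = C.pt t' s y at h2
    subst h1 h2
    simp only [dist_eq_norm, pt_sub_apex, norm_smul]
    rcases h3 with rfl | h3
    · simp
    · simp only at hx hy h3
      rw [C.norm_lift_sub_apex hx, C.norm_lift_sub_apex hy, h3]
  let ρ : C.Complex → ℝ := Quot.lift (fun p => dist (p.2 : E3) (C.apex p.1)) hglue
  have hρ : ∀ p q ℓ, C.IsChain p q ℓ → ρ p - ρ q ≤ ℓ := by
    intro p q ℓ h
    induction h with
    | nil p => simp
    | cons t u v q ℓ _ ih =>
      have h1 : ρ (C.toComplex t u) = dist (u : E3) (C.apex t) := rfl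
      have h2 : ρ (C.toComplex t v) = dist (v : E3) (C.apex t) := rfl
      have h3 := dist_triangle (u : E3) v (C.apex t)
      have h4 : dist u v = dist (u : E3) v := rfl
      linarith
  have h1 : dist (lift x) (C.apex t) = √(C.sqDist (C.T.chart t x)) := by
    rw [dist_eq_norm, C.norm_lift_sub_apex hx]
  refine le_antisymm ?_ (C.le_complexDist fun ℓ h => ?_)
  · rw [← C.toComplex_apex t t', ← h1]
    exact (C.isChain_dist t _ _).complexDist_le
  · have h2 := hρ _ _ _ h
    have h3 : ρ (C.toComplex t ⟨lift x, C.lift_mem hx⟩) = dist (lift x) (C.apex t) := rfl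
    have h4 : ρ (C.toComplex t' ⟨C.apex t', C.apex_mem t'⟩) = 0 := dist_self _
    linarith

theorem Equivalent.sqDist_eq {C C' : Couple M} (h : C.Equivalent C') : C.sqDist = C'.sqDist := by
  obtain ⟨e, hd, ha, hb⟩ := h
  funext m
  obtain ⟨t, x, hx, rfl⟩ := C.T.cover m
  obtain ⟨t', x', hx', he⟩ := C'.T.cover (C.T.chart t x)
  have h1 := hd (C.toComplex t ⟨lift x, C.lift_mem hx⟩) (C.toComplex t ⟨C.apex t, C.apex_mem t⟩)
  rw [ha t t', hb t t' x x' hx hx' he.symm, C.complexDist_apex hx, C'.complexDist_apex hx',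
    he] at h1
  exact ((Real.sqrt_inj (C'.sqDist_pos _).le (C.sqDist_pos _).le).1 h1).symm

/-! ### Comparison of complexes -/

/-- Law of cosines at the apex. The right-hand side involves the pyramid only through `C.sqDist` and
the base distance, which is what makes complexes over different triangulations comparable. -/
theorem dist_pt_sq {t : Fin C.T.numFaces} {x y : E2} (hx : x ∈ C.T.face t) (hy : y ∈ C.T.face t)
    (s s' : ℝ) : dist (C.pt t s x) (C.pt t s' y) ^ 2 =
      (1 - s) ^ 2 * C.sqDist (C.T.chart t x) + (1 - s') ^ 2 * C.sqDist (C.T.chart t y) -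
        (1 - s) * (1 - s') * (C.sqDist (C.T.chart t x) + C.sqDist (C.T.chart t y) -
          dist x y ^ 2) := by
  have e : C.pt t s x - C.pt t s' y =
      (1 - s) • (lift x - C.apex t) - (1 - s') • (lift y - C.apex t) := by
    rw [← pt_sub_apex, ← pt_sub_apex]; abel
  have h : dist x y = ‖(lift x - C.apex t) - (lift y - C.apex t)‖ := by
    rw [sub_sub_sub_cancel_right, ← lift_sub, norm_lift, dist_eq_norm]
  rw [dist_eq_norm, e, h, C.sqDist_chart hx, C.sqDist_chart hy, dist_comm, dist_eq_norm,
    dist_comm, dist_eq_norm, norm_sub_sq_real, norm_sub_sq_real (lift x - C.apex t), norm_smul,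
    norm_smul, mul_pow, mul_pow, inner_smul_left, inner_smul_right, Real.norm_eq_abs,
    Real.norm_eq_abs, sq_abs, sq_abs]
  simp only [conj_trivial]
  ring

variable {C}
variable {C' : Couple M} (hCC : C.sqDist = C'.sqDist)
include hCC

theorem dist_pt_eq {t : Fin C.T.numFaces} {t' : Fin C'.T.numFaces} {x y x' y' : E2}
    (hx : x ∈ C.T.face t) (hy : y ∈ C.T.face t) (hx' : x' ∈ C'.T.face t')
    (hy' : y' ∈ C'.T.face t') (ex : C'.T.chart t' x' = C.T.chart t x)
    (ey : C'.T.chart t' y' = C.T.chart t y) (hd : dist x' y' = dist x y) (s s' : ℝ) :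
    dist (C'.pt t' s x') (C'.pt t' s' y') = dist (C.pt t s x) (C.pt t s' y) := by
  rw [← sq_eq_sq₀ dist_nonneg dist_nonneg, dist_pt_sq _ hx' hy', dist_pt_sq _ hx hy, hCC, ex, ey, hd]

omit hCC in
theorem complexDist_conePoint_le {t : Fin C.T.numFaces} {x y : E2} (hx : x ∈ C.T.face t)
    (hy : y ∈ C.T.face t) (s s' : Set.Icc (0 : ℝ) 1) :
    C.complexDist (C.conePoint (C.T.chart t x) s) (C.conePoint (C.T.chart t y) s') ≤
      dist (C.pt t s x) (C.pt t s' y) := by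
  rw [← C.toComplex_pt hx (Or.inr rfl), ← C.toComplex_pt hy (Or.inr rfl)]
  exact (C.isChain_dist t _ _).complexDist_le

omit hCC in
/-- Continuity of the points of one complex as functions of the points of another one. -/
theorem complexDist_conePoint_small {t : Fin C.T.numFaces} {x : E2} (hx : x ∈ C.T.face t) {ε : ℝ}
    (hε : 0 < ε) : ∃ δ > 0, ∀ y ∈ C.T.face t, dist y x < δ → ∀ s s' : Set.Icc (0 : ℝ) 1,
      C'.complexDist (C'.conePoint (C.T.chart t x) s) (C'.conePoint (C.T.chart t y) s') ≤
        |(s' : ℝ) - s| * √(C'.sqDist (C.T.chart t x)) + ε := by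
  obtain ⟨η, hη, H⟩ := C'.T.exists_near_preimage (C.T.chart t x) (fun _ _ => ε) (fun _ _ _ _ => hε)
  obtain ⟨δ, hδ, Hδ⟩ := Metric.continuousWithinAt_iff.1 (C.T.chart_continuousOn t x hx) η hη
  refine ⟨δ, hδ, fun y hy hyx s s' => ?_⟩
  obtain ⟨t', x', hx', y', hy', ex, ey, hd⟩ := H _ (Hδ hy hyx)
  rw [← ex, ← ey]
  refine (complexDist_conePoint_le hx' hy' s s').trans ?_
  have e : C'.pt t' s x' - C'.pt t' s' y' =
      ((s' : ℝ) - s) • (lift x' - C'.apex t') - (1 - (s' : ℝ)) • (lift (y' - x')) := by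
    rw [pt, pt, lift_sub]; module
  rw [dist_eq_norm, e]
  refine (norm_sub_le _ _).trans ?_
  rw [norm_smul, norm_smul, norm_lift, C'.norm_lift_sub_apex hx', Real.norm_eq_abs,
    ← dist_eq_norm y' x']
  have h1 : ‖1 - (s' : ℝ)‖ ≤ 1 := by
    rw [Real.norm_eq_abs, abs_le]; constructor <;> linarith [s'.2.1, s'.2.2]
  have : ‖1 - (s' : ℝ)‖ * dist y' x' ≤ 1 * ε :=
    mul_le_mul h1 hd.le dist_nonneg zero_le_one
  linarith

/-- Distances are locally not increased under the comparison of complexes. -/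
theorem complexDist_conePoint_local {t : Fin C.T.numFaces} {x : E2} (hx : x ∈ C.T.face t)
    (hxc : x ∉ Set.range (C.T.corner t)) : ∃ δ > 0, ∀ y ∈ C.T.face t, dist y x < δ →
      ∀ s s' : Set.Icc (0 : ℝ) 1,
      C'.complexDist (C'.conePoint (C.T.chart t x) s) (C'.conePoint (C.T.chart t y) s') ≤
        dist (C.pt t s x) (C.pt t s' y) := by
  have hreg := (C.T.isRegularPoint_iff hx).2 hxc
  have hδ : ∀ t' x', ∃ δ : ℝ, x' ∈ C'.T.face t' → C'.T.chart t' x' = C.T.chart t x → 0 < δ ∧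
      ∀ y ∈ C'.T.face t', dist y x' < δ →
        dist (C'.T.chart t' y) (C'.T.chart t' x') = dist y x' := by
    intro t' x'
    by_cases h : x' ∈ C'.T.face t' ∧ C'.T.chart t' x' = C.T.chart t x
    · have hxc' : x' ∉ Set.range (C'.T.corner t') := (C'.T.isRegularPoint_iff h.1).1 (h.2 ▸ hreg)
      obtain ⟨δ, hδ, H⟩ := C'.T.chart_isometric t' x' ⟨h.1, hxc'⟩
      exact ⟨δ, fun _ _ => ⟨hδ, fun y hy hd => H y ⟨hy, hd⟩ x' ⟨h.1, Metric.mem_ball_self hδ⟩⟩⟩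
    · exact ⟨0, fun h1 h2 => absurd ⟨h1, h2⟩ h⟩
  choose δ hδ using hδ
  obtain ⟨η, hη, H⟩ := C'.T.exists_near_preimage (C.T.chart t x) δ (fun t' x' h1 h2 =>
    (hδ t' x' h1 h2).1)
  obtain ⟨κ, hκ, Hκ⟩ := C.T.chart_isometric t x ⟨hx, hxc⟩
  refine ⟨min κ η, lt_min hκ hη, fun y hy hyx s s' => ?_⟩
  have h1 : dist (C.T.chart t y) (C.T.chart t x) = dist y x :=
    Hκ y ⟨hy, hyx.trans_le (min_le_left _ _)⟩ x ⟨hx, Metric.mem_ball_self hκ⟩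
  obtain ⟨t', x', hx', y', hy', ex, ey, hd⟩ := H _ (h1 ▸ hyx.trans_le (min_le_right _ _))
  have h2 := (hδ t' x' hx' ex).2 y' hy' hd
  rw [ex, ey, h1] at h2
  rw [← dist_pt_eq hCC hx hy hx' hy' ex ey (by rw [dist_comm, ← h2, dist_comm]) s s', ← ex, ← ey]
  exact complexDist_conePoint_le hx' hy' s s'

/-- Distances within a pyramid are not increased under the comparison of complexes. -/
theorem complexDist_conePoint_pyramid {t : Fin C.T.numFaces} {x y : E2} (hx : x ∈ C.T.face t)
    (hy : y ∈ C.T.face t) (s s' : Set.Icc (0 : ℝ) 1) :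
    C'.complexDist (C'.conePoint (C.T.chart t x) s) (C'.conePoint (C.T.chart t y) s') ≤
      dist (C.pt t s x) (C.pt t s' y) := by
  have radial : ∀ z ∈ C.T.face t, C'.complexDist (C'.conePoint (C.T.chart t z) s)
      (C'.conePoint (C.T.chart t z) s') ≤ dist (C.pt t s z) (C.pt t s' z) := by
    intro z hz
    obtain ⟨t', z', hz', e⟩ := C'.T.cover (C.T.chart t z)
    rw [← dist_pt_eq hCC hz hz hz' hz' e e (by simp) s s', ← e]
    exact complexDist_conePoint_le hz' hz' s s'
  by_cases hxy : x = y
  · subst hxy; exact radial x hx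
  by_cases hs1 : (s : ℝ) = 1
  · have h1 := radial y hy
    rw [C'.conePoint_eq_of_eq_one (C.T.chart t x) (C.T.chart t y) hs1]
    have e : C.pt t s x = C.pt t s y := by simp [pt, hs1]
    rwa [e]
  by_cases hs1' : (s' : ℝ) = 1
  · have h1 := radial x hx
    rw [C'.conePoint_eq_of_eq_one (C.T.chart t y) (C.T.chart t x) hs1']
    have e : C.pt t s' y = C.pt t s' x := by simp [pt, hs1']
    rwa [e]
  have hp : 0 < 1 - (s : ℝ) := sub_pos.2 (s.2.2.lt_of_ne hs1)
  have hq : 0 < 1 - (s' : ℝ) := sub_pos.2 (s'.2.2.lt_of_ne hs1')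
  -- coordinates along the segment
  set σ : ℝ → ℝ := fun τ => (1 - τ) * s + τ * s' with hσ
  -- Projecting the segment from the apex to the base gives a fractional linear parameter: `θ τ` is
  -- the weight of `y` in `(1 - τ) * (1 - s) • x + τ * (1 - s') • y` after division by the total
  -- weight `1 - σ τ`.
  set θ : ℝ → ℝ := fun τ => τ * (1 - s') / (1 - σ τ) with hθ
  have hσ1 : ∀ τ ∈ Set.Icc (0 : ℝ) 1, 0 < 1 - σ τ := by
    intro τ hτ
    have e : 1 - σ τ = (1 - τ) * (1 - s) + τ * (1 - s') := by simp only [hσ]; ring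
    rw [e]
    rcases hτ.1.eq_or_lt with rfl | h0
    · simpa using hp
    · have := mul_nonneg (sub_nonneg.2 hτ.2) hp.le
      have := mul_pos h0 hq
      linarith
  have hσI : ∀ τ ∈ Set.Icc (0 : ℝ) 1, σ τ ∈ Set.Icc (0 : ℝ) 1 := fun τ hτ =>
    ⟨add_nonneg (mul_nonneg (sub_nonneg.2 hτ.2) s.2.1) (mul_nonneg hτ.1 s'.2.1),
      by linarith [hσ1 τ hτ]⟩
  have hθ1 : ∀ τ ∈ Set.Icc (0 : ℝ) 1, 1 - θ τ = (1 - τ) * (1 - s) / (1 - σ τ) := by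
    intro τ hτ
    have := (hσ1 τ hτ).ne'
    simp only [hθ]
    field_simp
    simp only [hσ]
    ring
  have hθI : ∀ τ ∈ Set.Icc (0 : ℝ) 1, θ τ ∈ Set.Icc (0 : ℝ) 1 := by
    intro τ hτ
    refine ⟨div_nonneg (mul_nonneg hτ.1 hq.le) (hσ1 τ hτ).le, sub_nonneg.1 ?_⟩
    rw [hθ1 τ hτ]
    exact div_nonneg (mul_nonneg (sub_nonneg.2 hτ.2) hp.le) (hσ1 τ hτ).le
  have hθo : ∀ τ ∈ Set.Ioo (0 : ℝ) 1, θ τ ∈ Set.Ioo (0 : ℝ) 1 := by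
    intro τ hτ
    have hτ' := Set.Ioo_subset_Icc_self hτ
    refine ⟨div_pos (mul_pos hτ.1 hq) (hσ1 τ hτ'), sub_pos.1 ?_⟩
    rw [hθ1 τ hτ']
    exact div_pos (mul_pos (sub_pos.2 hτ.2) hp) (hσ1 τ hτ')
  have hθc : ContinuousOn θ (Set.Icc 0 1) :=
    ContinuousOn.div (by fun_prop) (by simp only [hσ]; fun_prop) fun τ hτ => (hσ1 τ hτ).ne'
  set ξ : ℝ → E2 := fun τ => AffineMap.lineMap x y (θ τ) with hξ
  have hξf : ∀ τ ∈ Set.Icc (0 : ℝ) 1, ξ τ ∈ C.T.face t := fun τ hτ =>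
    (C.T.convex_face t).lineMap_mem hx hy (hθI τ hτ)
  have hξc : ContinuousOn ξ (Set.Icc 0 1) := AffineMap.lineMap_continuous.comp_continuousOn hθc
  have hpt : ∀ τ ∈ Set.Icc (0 : ℝ) 1, C.pt t (σ τ) (ξ τ) =
      AffineMap.lineMap (C.pt t s x) (C.pt t s' y) τ := by
    intro τ hτ
    have e1 : (1 - σ τ) • ξ τ = ((1 - τ) * (1 - s)) • x + (τ * (1 - s')) • y := by
      have h0 := (hσ1 τ hτ).ne'
      rw [hξ]
      simp only
      rw [AffineMap.lineMap_apply_module, smul_add, smul_smul, smul_smul, hθ1 τ hτ]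
      simp only [hθ]
      rw [mul_div_cancel₀ _ h0, mul_div_cancel₀ _ h0]
    rw [pt, ← lift_smul, e1, lift_add, lift_smul, lift_smul, AffineMap.lineMap_apply_module, pt, pt]
    simp only [hσ]
    module
  -- the path in the other complex
  let S : ℝ → Set.Icc (0 : ℝ) 1 := fun τ => Set.projIcc 0 1 zero_le_one (σ τ)
  have hS : ∀ τ ∈ Set.Icc (0 : ℝ) 1, (S τ : ℝ) = σ τ := fun τ hτ => by
    simp only [S]; rw [Set.projIcc_of_mem _ (hσI τ hτ)]
  have hSc : Continuous fun τ => (S τ : ℝ) :=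
    continuous_subtype_val.comp (continuous_projIcc.comp (by simp only [hσ]; fun_prop))
  let E : ℝ → C'.Complex := fun τ => C'.conePoint (C.T.chart t (ξ τ)) (S τ)
  have h0 : (0 : ℝ) ∈ Set.Icc (0 : ℝ) 1 := by simp
  have h1 : (1 : ℝ) ∈ Set.Icc (0 : ℝ) 1 := by simp
  -- The corresponding path in the other complex is continuous, and at interior times its base point
  -- is not a corner, so there distances locally do not exceed those on the segment.
  have hmain := le_add_of_locally_le (φ := fun τ => C'.complexDist (E 0) (E τ))
    (K := dist (C.pt t s x) (C.pt t s' y)) ?_ ?_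
  · have hE0 : E 0 = C'.conePoint (C.T.chart t x) s := by
      have a1 : ξ 0 = x := by simp [hξ, hθ]
      have a2 : S 0 = s := Subtype.ext (by rw [hS 0 h0]; simp [hσ])
      simp only [E, a1, a2]
    have hE1 : E 1 = C'.conePoint (C.T.chart t y) s' := by
      have a0 : σ 1 = s' := by simp [hσ]
      have a1 : ξ 1 = y := by
        have : θ 1 = 1 := by simp only [hθ]; rw [a0, one_mul, div_self hq.ne']
        simp [hξ, this]
      have a2 : S 1 = s' := Subtype.ext (by rw [hS 1 h1, a0])
      simp only [E, a1, a2]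
    rwa [C'.complexDist_self, zero_add, hE0, hE1] at hmain
  · intro τ hτ
    rw [Metric.continuousWithinAt_iff]
    intro ε hε
    obtain ⟨δ, hδ, H⟩ := complexDist_conePoint_small (C' := C') (hξf τ hτ) (half_pos hε)
    have hA : 0 ≤ √(C'.sqDist (C.T.chart t (ξ τ))) := Real.sqrt_nonneg _
    set A := √(C'.sqDist (C.T.chart t (ξ τ)))
    obtain ⟨δ₁, hδ₁, H₁⟩ := Metric.continuousWithinAt_iff.1 (hξc τ hτ) δ hδ
    obtain ⟨δ₂, hδ₂, H₂⟩ := Metric.continuousAt_iff.1 (hSc.continuousAt (x := τ))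
      (ε / (2 * (A + 1))) (by positivity)
    refine ⟨min δ₁ δ₂, lt_min hδ₁ hδ₂, fun {u} hu hd => ?_⟩
    have b1 := H _ (hξf u hu) (H₁ hu (hd.trans_le (min_le_left _ _))) (S τ) (S u)
    have b2 := H₂ (hd.trans_le (min_le_right _ _))
    rw [Real.dist_eq, lt_div_iff₀ (by positivity)] at b2
    have b3 : C'.complexDist (E τ) (E u) < ε := by
      refine b1.trans_lt ?_
      nlinarith [abs_nonneg ((S u : ℝ) - S τ)]
    have t1 := C'.complexDist_triangle (E 0) (E τ) (E u)
    have t2 := C'.complexDist_triangle (E 0) (E u) (E τ)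
    rw [C'.complexDist_comm (E u)] at t2
    rw [Real.dist_eq, abs_lt]
    constructor <;> linarith
  · intro p hp
    have hp' := Set.Ioo_subset_Icc_self hp
    obtain ⟨δ, hδ, H⟩ := complexDist_conePoint_local hCC (hξf p hp')
      (lineMap_notMem_corners (C.T.corner_indep t) hx hy hxy (hθo p hp))
    obtain ⟨δ₁, hδ₁, H₁⟩ := Metric.continuousWithinAt_iff.1 (hξc p hp') δ hδ
    refine ⟨δ₁, hδ₁, fun τ hpτ hτδ hτ1 => ?_⟩
    have hτ : τ ∈ Set.Icc (0 : ℝ) 1 := ⟨(hp.1.trans hpτ).le, hτ1.le⟩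
    have b1 := H _ (hξf τ hτ) (H₁ hτ (by
      rw [Real.dist_eq, abs_of_pos (sub_pos.2 hpτ)]; linarith)) (S p) (S τ)
    rw [hS p hp', hS τ hτ, hpt p hp', hpt τ hτ, dist_lineMap_lineMap, Real.dist_eq, abs_sub_comm,
      abs_of_pos (sub_pos.2 hpτ), mul_comm] at b1
    have t1 := C'.complexDist_triangle (E 0) (E p) (E τ)
    linarith

/-- A chain is compared segment by segment; the cone coordinates of its vertices are unique except
at the apex, where the boundary point does not matter. -/
theorem complexDist_conePoint_le_complexDist (m m' : M) (s s' : Set.Icc (0 : ℝ) 1) :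
    C'.complexDist (C'.conePoint m s) (C'.conePoint m' s') ≤
      C.complexDist (C.conePoint m s) (C.conePoint m' s') := by
  have key : ∀ p q ℓ, C.IsChain p q ℓ → ∀ m m' s s', p = C.conePoint m s → q = C.conePoint m' s' →
      C'.complexDist (C'.conePoint m s) (C'.conePoint m' s') ≤ ℓ := by
    have hcongr : ∀ m m' s s', C.conePoint m s = C.conePoint m' s' →
        C'.conePoint m s = C'.conePoint m' s' := by
      intro m m' s s' he
      obtain ⟨rfl, h⟩ := C.conePoint_inj he
      rcases h with h | rfl
      · exact C'.conePoint_eq_of_eq_one _ _ h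
      · rfl
    intro p q ℓ h
    induction h with
    | nil p =>
      rintro m m' s s' rfl he
      rw [hcongr _ _ _ _ he, C'.complexDist_self]
    | cons t u v q ℓ _ ih =>
      intro m m' s s' hu hq
      obtain ⟨u, hu0⟩ := u
      obtain ⟨v, hv0⟩ := v
      obtain ⟨su, hsu, x, hx, rfl⟩ := C.exists_eq_pt hu0
      obtain ⟨sv, hsv, y, hy, rfl⟩ := C.exists_eq_pt hv0
      have e1 := C.toComplex_pt (s := ⟨su, hsu⟩) hx (Or.inr rfl)
      have e2 := C.toComplex_pt (s := ⟨sv, hsv⟩) hy (Or.inr rfl)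
      rw [hcongr _ _ _ _ (hu.symm.trans e1)]
      refine (C'.complexDist_triangle _ (C'.conePoint (C.T.chart t y) ⟨sv, hsv⟩) _).trans ?_
      exact add_le_add (complexDist_conePoint_pyramid hCC hx hy ⟨su, hsu⟩ ⟨sv, hsv⟩)
        (ih _ _ _ _ e2 hq)
  exact C.le_complexDist fun ℓ h => key _ _ ℓ h m m' s s' rfl rfl

/-- The isometry keeps the cone coordinates `(m, s)`. The hypothesis is symmetric, so neither this
map nor its inverse increases distances. -/
theorem equivalent_of_sqDist_eq : C.Equivalent C' := by
  choose μ σ hμσ using C.exists_eq_conePoint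
  choose μ' σ' hμσ' using C'.exists_eq_conePoint
  have h1 : ∀ m s, C'.conePoint (μ (C.conePoint m s)) (σ (C.conePoint m s)) = C'.conePoint m s := by
    intro m s
    obtain ⟨h, h'⟩ := C.conePoint_inj (hμσ (C.conePoint m s))
    rw [← h]
    rcases h' with h' | h'
    · exact C'.conePoint_eq_of_eq_one _ _ h'
    · rw [← h']
  have h2 : ∀ m s, C.conePoint (μ' (C'.conePoint m s)) (σ' (C'.conePoint m s)) =
      C.conePoint m s := by
    intro m s
    obtain ⟨h, h'⟩ := C'.conePoint_inj (hμσ' (C'.conePoint m s))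
    rw [← h]
    rcases h' with h' | h'
    · exact C.conePoint_eq_of_eq_one _ _ h'
    · rw [← h']
  let e : C.Complex ≃ C'.Complex :=
    { toFun := fun P => C'.conePoint (μ P) (σ P)
      invFun := fun P => C.conePoint (μ' P) (σ' P)
      left_inv := fun P => by
        change C.conePoint (μ' (C'.conePoint (μ P) (σ P))) (σ' (C'.conePoint (μ P) (σ P))) = P
        rw [h2, ← hμσ]
      right_inv := fun P => by
        change C'.conePoint (μ (C.conePoint (μ' P) (σ' P))) (σ (C.conePoint (μ' P) (σ' P))) = P
        rw [h1, ← hμσ'] }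
  have he : ∀ m s, e (C.conePoint m s) = C'.conePoint m s := h1
  have hpt : ∀ t t' x x' (s : Set.Icc (0 : ℝ) 1) (hx : x ∈ C.T.face t) (hx' : x' ∈ C'.T.face t'),
      (s : ℝ) = 1 ∨ C.T.chart t x = C'.T.chart t' x' →
      e (C.toComplex t ⟨C.pt t s x, C.pt_mem s.2 hx⟩) =
        C'.toComplex t' ⟨C'.pt t' s x', C'.pt_mem s.2 hx'⟩ := by
    intro t t' x x' s hx hx' h
    rw [C.toComplex_pt hx h, he, C'.toComplex_pt hx' (Or.inr rfl)]
  refine ⟨e, fun p q => ?_, fun t t' => ?_, fun t t' x x' hx hx' h => ?_⟩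
  · rw [hμσ p, hμσ q, he, he]
    exact le_antisymm (complexDist_conePoint_le_complexDist hCC _ _ _ _)
      (complexDist_conePoint_le_complexDist hCC.symm _ _ _ _)
  · have := hpt t t' _ _ ⟨1, by simp⟩ (C.T.corner_mem_face t 0) (C'.T.corner_mem_face t' 0)
      (Or.inl rfl)
    simpa [pt] using this
  · have := hpt t t' x x' ⟨0, by simp⟩ hx hx' (Or.inr h)
    simpa [pt] using this

omit hCC in
theorem equivalent_iff (C C' : Couple M) : C.Equivalent C' ↔ C.sqDist = C'.sqDist :=
  ⟨Equivalent.sqDist_eq, equivalent_of_sqDist_eq⟩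

end Couple
end Metric

/-! ### The bijection -/

section Metric
variable {M : Type*} [MetricSpace M]

namespace Couple

theorem represents_iff (C C' : Couple M) {P : GeneralizedPolytope M} (h : C.Represents P) :
    C'.Represents P ↔ C.sqDist = C'.sqDist := by
  rw [← equivalent_iff, ← show _ = P from h]
  exact Quotient.eq.trans ⟨fun h => (Couple.setoid M).symm h, fun h => (Couple.setoid M).symm h⟩

/-- The tessellation obtained from a couple by removing the inessential edges. -/
def tessellation (C : Couple M) : WeightedTessellation M where
  edges := essentialEdges C.T C.sqDist
  weight i := C.radius i ^ 2

theorem isPositiveDelaunayTessellationOf {C : Couple M} (h : C.HasConvexBoundary) :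
    IsPositiveDelaunayTessellationOf C.tessellation C.T (fun i => C.radius i ^ 2) :=
  ⟨C.sqDist, C.isPQExtension_sqDist, C.isQConcave_iff.2 h, C.sqDist_pos, rfl, rfl⟩

/-- The function determines the weights as its values on `Σ`, and the edges by `essentialEdges_eq`.
-/
theorem tessellation_eq {C C' : Couple M} (h : C.sqDist = C'.sqDist) :
    C.tessellation = C'.tessellation := by
  have hQ := C'.isQData_sqDist
  rw [← h] at hQ
  have e1 : essentialEdges C.T C.sqDist = essentialEdges C'.T C'.sqDist := by
    rw [← h]; exact C.isQData_sqDist.essentialEdges_eq hQ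
  have e2 : (fun i => C.radius i ^ 2) = fun i => C'.radius i ^ 2 := funext fun i => by
    refine (C.isPQExtension_sqDist.2.2 i).symm.trans ?_
    rw [h]
    exact C'.isPQExtension_sqDist.2.2 i
  rw [tessellation, tessellation, e1, e2]

theorem hasConvexBoundary_congr {C C' : Couple M} (h : C.sqDist = C'.sqDist) :
    C.HasConvexBoundary ↔ C'.HasConvexBoundary := by
  rw [← isQConcave_iff, ← isQConcave_iff, h]

end Couple

/-- Q-concavity enters twice: with positivity of `f` it makes the constants positive, so the
pyramids exist, and it is the bound on their dihedral angles. -/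
theorem IsPositiveDelaunayTessellationOf.exists_couple {τ : WeightedTessellation M}
    {T : GeodesicTriangulation M} {q : singularSet M → ℝ}
    (h : IsPositiveDelaunayTessellationOf τ T q) :
    ∃ C : Couple M, C.T = T ∧ (∀ i, C.radius i ^ 2 = q i) ∧ C.HasConvexBoundary ∧
      C.tessellation = τ := by
  obtain ⟨f, hf, hc, hpos, he, hw⟩ := h
  obtain ⟨a, b, hQ⟩ := hf.exists_qData
  obtain ⟨C, rfl, hr, hCf⟩ := hf.exists_couple hpos hQ (hQ.pos_of_isQConcave hf.1 hc hpos)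
  refine ⟨C, rfl, hr, C.isQConcave_iff.1 (hCf ▸ hc), ?_⟩
  obtain ⟨E, w⟩ := τ
  simp only at he hw
  rw [Couple.tessellation, hCf, he, hw]
  congr 1
  exact funext hr

namespace GeneralizedConvexPolytope

/-- The tessellation corresponding to a generalized convex polytope. -/
def toTessellation (P : GeneralizedConvexPolytope M) : PositiveDelaunayTessellation M :=
  ⟨P.2.choose.tessellation, _, _,
    Couple.isPositiveDelaunayTessellationOf P.2.choose_spec.2⟩

theorem sqDist_eq (P : GeneralizedConvexPolytope M) {C : Couple M} (h : C.Represents P.1) :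
    P.2.choose.sqDist = C.sqDist :=
  (Couple.represents_iff _ C P.2.choose_spec.1).1 h

theorem toTessellation_eq (P : GeneralizedConvexPolytope M) {C : Couple M}
    (h : C.Represents P.1) : P.toTessellation.1 = C.tessellation :=
  Couple.tessellation_eq (P.sqDist_eq h)

theorem hasConvexBoundary (P : GeneralizedConvexPolytope M) {C : Couple M}
    (h : C.Represents P.1) : C.HasConvexBoundary :=
  (Couple.hasConvexBoundary_congr (P.sqDist_eq h)).1 P.2.choose_spec.2

/-- For injectivity the weights alone suffice: they determine the Q-concave PQ-extension, hence the
class of the couple. Surjectivity is the construction of pyramids over a weighted Delaunay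
triangulation. -/
theorem toTessellation_bijective :
    Function.Bijective (toTessellation : GeneralizedConvexPolytope M → _) := by
  constructor
  · intro P Q h
    obtain ⟨C, hC⟩ := Quotient.exists_rep P.1
    obtain ⟨C', hC'⟩ := Quotient.exists_rep Q.1
    have hP : C.Represents P.1 := hC
    have hQ : C'.Represents Q.1 := hC'
    have h1 : C.tessellation = C'.tessellation := by
      rw [← P.toTessellation_eq hP, ← Q.toTessellation_eq hQ, h]
    have h2 : (fun i => C.radius i ^ 2) = fun i => C'.radius i ^ 2 :=
      congrArg WeightedTessellation.weight h1
    have hf := C.isPQExtension_sqDist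
    rw [h2] at hf
    have h3 := hf.eq_of_isQConcave (C.isQConcave_iff.2 (P.hasConvexBoundary hP))
      C'.isPQExtension_sqDist (C'.isQConcave_iff.2 (Q.hasConvexBoundary hQ))
    have h4 : C'.Represents P.1 := (Couple.represents_iff C C' hP).2 h3
    exact Subtype.ext (h4.symm.trans hQ)
  · rintro ⟨τ, T, q, h⟩
    obtain ⟨C, -, -, hC, hτ⟩ := h.exists_couple
    let P : GeneralizedConvexPolytope M := ⟨Quotient.mk (Couple.setoid M) C, C, rfl, hC⟩
    exact ⟨P, Subtype.ext ((P.toTessellation_eq (C := C) rfl).trans hτ)⟩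

end GeneralizedConvexPolytope
end Metric
end PolyhedralSphere

end

theorem mainTheorem6 {M : Type*} [MetricSpace M]
    (hsphere : Nonempty (M ≃ₜ Metric.sphere (0 : EuclideanSpace ℝ (Fin 3)) 1))
    (hpoly : PolyhedralSphere.IsPolyhedralMetric M) :
    ∃ Φ : PolyhedralSphere.GeneralizedConvexPolytope M ≃
        PolyhedralSphere.PositiveDelaunayTessellation M,
      (∀ (P : PolyhedralSphere.GeneralizedConvexPolytope M) (C : PolyhedralSphere.Couple M),
        C.Represents P.1 →
          PolyhedralSphere.IsPositiveDelaunayTessellationOf (Φ P).1 C.T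
            (fun i => C.radius i ^ 2)) ∧
      (∀ (τ : PolyhedralSphere.PositiveDelaunayTessellation M)
        (T : PolyhedralSphere.GeodesicTriangulation M)
        (q : PolyhedralSphere.singularSet M → ℝ),
        PolyhedralSphere.IsPositiveDelaunayTessellationOf τ.1 T q →
          ∃ C : PolyhedralSphere.Couple M, C.T = T ∧ (∀ i, C.radius i ^ 2 = q i) ∧
            C.HasConvexBoundary ∧ C.Represents (Φ.symm τ).1) := by
  refine ⟨Equiv.ofBijective _
    PolyhedralSphere.GeneralizedConvexPolytope.toTessellation_bijective, fun P C hC => ?_,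
    fun τ T q h => ?_⟩
  · rw [Equiv.ofBijective_apply, P.toTessellation_eq hC]
    exact PolyhedralSphere.Couple.isPositiveDelaunayTessellationOf (P.hasConvexBoundary hC)
  · obtain ⟨C, hT, hr, hconv, hτ⟩ := h.exists_couple
    refine ⟨C, hT, hr, hconv, ?_⟩
    let P : PolyhedralSphere.GeneralizedConvexPolytope M :=
      ⟨Quotient.mk (PolyhedralSphere.Couple.setoid M) C, C, rfl, hconv⟩
    have hP : PolyhedralSphere.GeneralizedConvexPolytope.toTessellation P = τ :=
      Subtype.ext ((P.toTessellation_eq (C := C) rfl).trans hτ)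
    have e : (Equiv.ofBijective _
        PolyhedralSphere.GeneralizedConvexPolytope.toTessellation_bijective).symm τ = P := by
      rw [Equiv.symm_apply_eq]; exact hP.symm
    rw [e]
    rfl
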